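/- Let $\Omega=(0,2\pi)^2$, $\Upsilon=\Omega\times(0,2\pi)$, $\boldsymbol{\xi}=(x,\theta)$ with $x\in\mathbb{R}^2$, $\theta\in\mathbb{R}$, and $\mathbf{e}(\theta)=(\cos\theta,\sin\theta)$; $\nabla$, $\mathrm{div}$, $\Delta$ act in $x$ only, and the subscript "per" denotes functions on $\mathbb{R}^3$ that are $2\pi$-periodic in each variable. For $\mathrm{Pe}\in\mathbb{R}$ and $D_e>0$ consider $$\partial_t f+\mathrm{Pe}\,\mathrm{div}\big((1-\rho)f\,\mathbf{e}(\theta)\big)=D_e\Delta f+\partial_\theta^2 f,\qquad \rho(t,x)=\int_0^{2\pi}f(t,x,\theta)\,d\theta .$$ Let $f_0\in L^2_{\mathrm{per}}(\Upsilon)$ be non-negative with $\rho_0(x)=\int_0^{2\pi}f_0(x,\theta)\,d\theta\in[0,1]$ for a.e. $x\in\Omega$. A weak solution on $[0,T]$ with initial data $f_0$ is a function $f\in C([0,T];L^2_{\mathrm{per}}(\Upsilon))\cap L^2(0,T;H^1_{\mathrm{per}}(\Upsilon))$ with $\partial_t f\in L^2(0,T;(H^1_{\mathrm{per}})'(\Upsilon))$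 such that $0\le\rho\le1$ a.e. in $(0,T)\times\Omega$, $\lim_{t\to0^+}f(t)=f_0$ in $L^2_{\mathrm{per}}(\Upsilon)$ and, for all $\varphi\in L^2(0,T;H^1_{\mathrm{per}}(\Upsilon))$, $$\langle\partial_t f,\varphi\rangle=\mathrm{Pe}\int_0^T\!\!\int_\Upsilon(1-\rho)f\,\mathbf{e}(\theta)\cdot\nabla\varphi\,d\boldsymbol{\xi}\,dt-D_e\int_0^T\!\!\int_\Upsilon\nabla f\cdot\nabla\varphi\,d\boldsymbol{\xi}\,dt-\int_0^T\!\!\int_\Upsilon\partial_\theta f\,\partial_\theta\varphi\,d\boldsymbol{\xi}\,dt .$$ A global-in-time weak solution is a function on $[0,\infty)\times\mathbb{R}^3$ which is a weak solution on $[0,T]$ for every $T>0$. **Theorem 1.5.** There is a function $C(\cdot,\cdot,\cdot)$ such that, for all $\mathrm{Pe}\in\mathbb{R}$ and $D_e>0$, all non-negative $f_0\in L^\infty_{\mathrm{per}}(\Upsilon)$ with $\rho_0\in[0,1]$ a.e. in $\Omega$, and every global-in-time weak solution $f$ with initial data $f_0$, $$\|f\|_{L^\infty((0,\infty)\times\Upsilon)}\le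 C\big(\mathrm{Pe},D_e,\|f_0\|_{L^\infty(\Upsilon)}\big).$$ -/

import Mathlib

open MeasureTheory Set Filter Topology
open scoped ENNReal

namespace ActiveMatter

noncomputable section

/-- The space of the concatenated space-angle variable `ξ = (x, θ)`, with `x ∈ ℝ²`, `θ ∈ ℝ`. -/
abbrev E : Type := (ℝ × ℝ) × ℝ

/-- The spatial cell `Ω = (0, 2π)²`. -/
def Ω : Set (ℝ × ℝ) := Ioo 0 (2 * Real.pi) ×ˢ Ioo 0 (2 * Real.pi)

/-- The space-angle cell `Υ = Ω × (0, 2π)`. -/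
def Υ : Set E := Ω ×ˢ Ioo 0 (2 * Real.pi)

/-- The standard basis of `ℝ³`: indices `0, 1` are the two spatial directions, `2` is the angle. -/
def dir : Fin 3 → E := ![((1, 0), 0), ((0, 1), 0), ((0, 0), 1)]

/-- `Υ`-periodicity: period `2π` in each of the three variables. -/
def IsPer (g : E → ℝ) : Prop := ∀ i, Function.Periodic g ((2 * Real.pi) • dir i)

/-- `g ∈ L^p_per(Υ)`. -/
def MemLpPer (g : E → ℝ) (p : ℝ≥0∞) : Prop := IsPer g ∧ MemLp g p (volume.restrict Υ)

/-- The Lebesgue space `L²(Υ)`. A periodic function is determined by its restriction to the cell,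
so this is also `L²_per(Υ)` up to almost everywhere equality. -/
abbrev L2 : Type := Lp ℝ 2 (volume.restrict Υ)

/-- Smooth `Υ`-periodic functions. -/
def IsSmoothPer (φ : E → ℝ) : Prop := ContDiff ℝ (⊤ : ℕ∞) φ ∧ IsPer φ

lemma volume_Υ_lt_top : volume Υ < ∞ := by
  have h : Υ ⊆ Icc (((0, 0), 0) : E) ((2 * Real.pi, 2 * Real.pi), 2 * Real.pi) := by
    rintro ⟨⟨a, b⟩, c⟩ ⟨⟨ha, hb⟩, hc⟩
    exact ⟨⟨⟨ha.1.le, hb.1.le⟩, hc.1.le⟩, ⟨⟨ha.2.le, hb.2.le⟩, hc.2.le⟩⟩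
  exact (measure_mono h).trans_lt isCompact_Icc.measure_lt_top

lemma measurableSet_Υ : MeasurableSet Υ :=
  (measurableSet_Ioo.prod measurableSet_Ioo).prod measurableSet_Ioo

instance : IsFiniteMeasure (volume.restrict Υ) := ⟨by simpa using volume_Υ_lt_top⟩

lemma memLp_of_continuous {φ : E → ℝ} (hφ : Continuous φ) : MemLp φ 2 (volume.restrict Υ) := by
  have h : Υ ⊆ Icc (((0, 0), 0) : E) ((2 * Real.pi, 2 * Real.pi), 2 * Real.pi) := by
    rintro ⟨⟨a, b⟩, c⟩ ⟨⟨ha, hb⟩, hc⟩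
    exact ⟨⟨⟨ha.1.le, hb.1.le⟩, hc.1.le⟩, ⟨⟨ha.2.le, hb.2.le⟩, hc.2.le⟩⟩
  obtain ⟨C, hC⟩ := (isCompact_Icc (a := (((0, 0), 0) : E))
    (b := ((2 * Real.pi, 2 * Real.pi), 2 * Real.pi))).exists_bound_of_continuousOn hφ.continuousOn
  refine MemLp.of_bound hφ.aestronglyMeasurable C ?_
  filter_upwards [ae_restrict_mem measurableSet_Υ] with ξ hξ using hC ξ (h hξ)

lemma integrable_L2_mul (u : L2) {φ : E → ℝ} (hφ : Continuous φ) :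
    Integrable (fun ξ => u ξ * φ ξ) (volume.restrict Υ) :=
  (Lp.memLp u).integrable_mul (memLp_of_continuous hφ)

lemma integrable_L2_mul_fderiv (u : L2) {φ : E → ℝ} (hφ : IsSmoothPer φ) (e : E) :
    Integrable (fun ξ => u ξ * fderiv ℝ φ ξ e) (volume.restrict Υ) :=
  integrable_L2_mul u ((hφ.1.continuous_fderiv (by simp)).clm_apply continuous_const)

/-- The Sobolev space `H¹_per(Υ)`, as the space of pairs `(u, ∇_ξ u)` of a function `u ∈ L²` and its
weak gradient in `(L²)³`, with the norm `(‖u‖² + ‖∇_ξ u‖²)^{1/2}`. The weak derivatives are tested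
against smooth periodic functions, i.e. they are weak derivatives of the periodic extension. -/
def H1per : Submodule ℝ (WithLp 2 (L2 × PiLp 2 (fun _ : Fin 3 => L2))) where
  carrier := {U | ∀ φ : E → ℝ, IsSmoothPer φ → ∀ i : Fin 3,
    ∫ ξ in Υ, U.fst ξ * fderiv ℝ φ ξ (dir i) = -∫ ξ in Υ, U.snd i ξ * φ ξ}
  zero_mem' := by
    intro φ hφ i
    have h0 : ∀ᵐ ξ ∂(volume.restrict Υ), (0 : L2) ξ = 0 := Lp.coeFn_zero ℝ 2 _
    have h1 : ∫ ξ in Υ, (0 : L2) ξ * fderiv ℝ φ ξ (dir i) = 0 :=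
      integral_eq_zero_of_ae (by filter_upwards [h0] with ξ h; rw [h, zero_mul, Pi.zero_apply])
    have h2 : ∫ ξ in Υ, (0 : L2) ξ * φ ξ = 0 :=
      integral_eq_zero_of_ae (by filter_upwards [h0] with ξ h; rw [h, zero_mul, Pi.zero_apply])
    change ∫ ξ in Υ, (0 : L2) ξ * fderiv ℝ φ ξ (dir i) = -∫ ξ in Υ, (0 : L2) ξ * φ ξ
    rw [h1, h2, neg_zero]
  add_mem' := by
    intro U V hU hV φ hφ i
    have h1 : ∫ ξ in Υ, (U.fst + V.fst : L2) ξ * fderiv ℝ φ ξ (dir i)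
        = (∫ ξ in Υ, U.fst ξ * fderiv ℝ φ ξ (dir i))
          + ∫ ξ in Υ, V.fst ξ * fderiv ℝ φ ξ (dir i) := by
      rw [← integral_add (integrable_L2_mul_fderiv _ hφ _) (integrable_L2_mul_fderiv _ hφ _)]
      refine integral_congr_ae ?_
      filter_upwards [Lp.coeFn_add U.fst V.fst] with ξ h
      rw [h, Pi.add_apply, add_mul]
    have h2 : ∫ ξ in Υ, (U.snd i + V.snd i : L2) ξ * φ ξ
        = (∫ ξ in Υ, U.snd i ξ * φ ξ) + ∫ ξ in Υ, V.snd i ξ * φ ξ := by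
      rw [← integral_add (integrable_L2_mul _ hφ.1.continuous)
        (integrable_L2_mul _ hφ.1.continuous)]
      refine integral_congr_ae ?_
      filter_upwards [Lp.coeFn_add (U.snd i) (V.snd i)] with ξ h
      rw [h, Pi.add_apply, add_mul]
    change ∫ ξ in Υ, (U.fst + V.fst : L2) ξ * fderiv ℝ φ ξ (dir i)
      = -∫ ξ in Υ, (U.snd i + V.snd i : L2) ξ * φ ξ
    rw [h1, h2, hU φ hφ i, hV φ hφ i, neg_add]
  smul_mem' := by
    intro c U hU φ hφ i
    have h1 : ∫ ξ in Υ, (c • U.fst : L2) ξ * fderiv ℝ φ ξ (dir i)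
        = c * ∫ ξ in Υ, U.fst ξ * fderiv ℝ φ ξ (dir i) := by
      rw [← integral_const_mul]
      refine integral_congr_ae ?_
      filter_upwards [Lp.coeFn_smul c U.fst] with ξ h
      rw [h, Pi.smul_apply, smul_eq_mul, mul_assoc]
    have h2 : ∫ ξ in Υ, (c • U.snd i : L2) ξ * φ ξ = c * ∫ ξ in Υ, U.snd i ξ * φ ξ := by
      rw [← integral_const_mul]
      refine integral_congr_ae ?_
      filter_upwards [Lp.coeFn_smul c (U.snd i)] with ξ h
      rw [h, Pi.smul_apply, smul_eq_mul, mul_assoc]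
    change ∫ ξ in Υ, (c • U.fst : L2) ξ * fderiv ℝ φ ξ (dir i)
      = -∫ ξ in Υ, (c • U.snd i : L2) ξ * φ ξ
    rw [h1, h2, hU φ hφ i, mul_neg]

/-- The function underlying an element of `H¹_per(Υ)`. -/
def val (u : H1per) : L2 := u.1.fst

/-- The weak partial derivative of an element of `H¹_per(Υ)` in the direction `i`. -/
def pderiv (i : Fin 3) (u : H1per) : L2 := u.1.snd i

/-- `u ∈ L²(0,T;V)`, for `V` a normed space. -/
def MemL2Time {V : Type*} [NormedAddCommGroup V] (T : ℝ) (u : ℝ → V) : Prop :=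
  MemLp u 2 (volume.restrict (Ioo 0 T))

/-- The angle-independent density `∫₀^{2π} g(x, θ) dθ`. -/
def density (g : E → ℝ) (x : ℝ × ℝ) : ℝ := ∫ θ in Ioo 0 (2 * Real.pi), g (x, θ)

/-- `g ∈ L²(0,T;(H¹_per)'(Υ))` is the weak time derivative of `f : [0,T] → L²(Υ)`. -/
def IsWeakTimeDeriv (T : ℝ) (f : ℝ → E → ℝ) (g : ℝ → StrongDual ℝ H1per) : Prop :=
  MemL2Time T g ∧
    ∀ (v : H1per) (η : ℝ → ℝ), ContDiff ℝ (⊤ : ℕ∞) η → HasCompactSupport η → tsupport η ⊆ Ioo 0 T →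
      ∫ t in Ioo 0 T, g t v * η t
        = -∫ t in Ioo 0 T, (∫ ξ in Υ, f t ξ * val v ξ) * deriv η t

/-- `f ∈ C([0,T];L²_per(Υ))`, for a function `f` that is jointly measurable in time, space, angle. -/
structure IsContL2 (T : ℝ) (f : ℝ → E → ℝ) : Prop where
  aestronglyMeasurable : AEStronglyMeasurable (Function.uncurry f)
    (volume.restrict (Ioo (0 : ℝ) T ×ˢ Υ))
  memLpPer : ∀ t ∈ Icc 0 T, MemLpPer (f t) 2
  continuous : ∀ t ∈ Icc 0 T,
    Tendsto (fun s => eLpNorm (f s - f t) 2 (volume.restrict Υ)) (𝓝[Icc 0 T] t) (𝓝 0)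

/-- Admissible initial data: `f₀ ∈ L²_per(Υ)`, `f₀ ≥ 0`, and `ρ₀ ∈ [0,1]` almost everywhere. -/
structure IsAdmissible (f₀ : E → ℝ) : Prop where
  memLpPer : MemLpPer f₀ 2
  nonneg : ∀ᵐ ξ ∂(volume.restrict Υ), 0 ≤ f₀ ξ
  density_mem : ∀ᵐ x ∂(volume.restrict Ω), density f₀ x ∈ Icc (0 : ℝ) 1

/-- `f` is a weak solution on `[0,T]`, with initial data `f₀`, of
`∂ₜf + Pe div((1-ρ) f e(θ)) = De Δf + ∂_θ² f`, where `e(θ) = (cos θ, sin θ)`.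
Here `F t` is `f(t)` as an element of `H¹_per(Υ)` and `g` is the weak time derivative of `f`. -/
structure IsWeakSolution (Pe De T : ℝ) (f₀ : E → ℝ) (f : ℝ → E → ℝ) : Prop where
  contL2 : IsContL2 T f
  weak : ∃ (F : ℝ → H1per) (g : ℝ → StrongDual ℝ H1per),
    MemL2Time T F ∧
    (∀ᵐ t ∂(volume.restrict (Ioo 0 T)), (val (F t) : E → ℝ) =ᵐ[volume.restrict Υ] f t) ∧
    IsWeakTimeDeriv T f g ∧
    ∀ φ : ℝ → H1per, MemL2Time T φ →
      ∫ t in Ioo 0 T, g t (φ t)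
        = Pe * (∫ t in Ioo 0 T, ∫ ξ in Υ, (1 - density (f t) ξ.1) * f t ξ *
            (Real.cos ξ.2 * pderiv 0 (φ t) ξ + Real.sin ξ.2 * pderiv 1 (φ t) ξ))
          - De * (∫ t in Ioo 0 T, ∫ ξ in Υ,
              (pderiv 0 (F t) ξ * pderiv 0 (φ t) ξ
                + pderiv 1 (F t) ξ * pderiv 1 (φ t) ξ))
          - ∫ t in Ioo 0 T, ∫ ξ in Υ, pderiv 2 (F t) ξ * pderiv 2 (φ t) ξ
  initial : Tendsto (fun t => eLpNorm (f t - f₀) 2 (volume.restrict Υ)) (𝓝[>] 0) (𝓝 0)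
  density_mem : ∀ᵐ p ∂(volume.restrict (Ioo (0 : ℝ) T ×ˢ Ω)),
    density (f p.1) p.2 ∈ Icc (0 : ℝ) 1

/-- A global-in-time weak solution: a weak solution on `[0,T]` for every `T > 0`. -/
def IsGlobalWeakSolution (Pe De : ℝ) (f₀ : E → ℝ) (f : ℝ → E → ℝ) : Prop :=
  ∀ T : ℝ, 0 < T → IsWeakSolution Pe De T f₀ f

end

end ActiveMatter

/-!
A weak solution is bounded because its integral over the angle is `ρ ≤ 1` at all times, and the
diffusion turns such a bound into a pointwise one.

All objects are expanded in the Hartley functions `hart n ξ = cos (n · ξ) + sin (n · ξ)`, a real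
orthogonal basis of `L²(Υ)` that is closed under differentiation, so that the weak formulation,
tested against time-dependent multiples of the basis functions, becomes a family of scalar linear
equations (`IsWeakSolution.hmoment_duhamel`).

*Positivity.* The finite sections `hproj S (f t)` are Lipschitz in time with values in
trigonometric polynomials, so a smooth convex penalization `negPen` of the negative part may be
differentiated along them. The drift term is absorbed by the dissipation, the truncation errors are
controlled by Parseval's identity, and Gronwall's inequality gives `f t ≥ 0`
(`IsWeakSolution.ae_nonneg`). Since `0 ≤ 1 - ρ ≤ 1`, the flux `(1 - ρ) f e(θ)` is then bounded
pointwise by `f`.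

*Smoothing.* For a trigonometric polynomial `ψ ≥ 0`, the diffusion semigroup `P_τ` is an average
against Gaussians. Hence `P_τ ψ ≥ 0`, `|∂ᵢ P_τ ψ| ≤ c τ^(-1/2) P_{2τ} ψ` (`abs_trigD_heat_le`),
and the semigroup in the angle alone is bounded by `c τ^(-1/2)` times the integral over the angle
(`exists_isAngleBound`). With `ρ ≤ 1` this gives `∫ f(t) P_τ ψ ≤ c τ^(-1/2) ∫ ψ`
(`IsWeakSolution.heatPair_le_of_density`).

*Bootstrap.* Duhamel's formula over a window of length at most one reads
`∫ f(t) P_ε ψ = ∫ f(s) P_{t-s+ε} ψ + Pe ∫_s^t ∫ (1 - ρ) f e(θ) · ∇ P_{t-r+ε} ψ`,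
and its last term is at most `c ∫_s^t (t-r+ε)^(-1/2) (∫ f(r) P_{2(t-r+ε)} ψ) dr`. Inserting the rate
`τ^(-1/2)` gives the rate `ε^(-1/4)` (`IsWeakSolution.heatPair_le_rpow`), and inserting that rate
gives a bound independent of `ε` (`IsWeakSolution.heatPair_le`). As `ε → 0`, `∫ (f(t) - M) ψ ≤ 0`
for every trigonometric polynomial `ψ ≥ 0`, so that `f(t) ≤ M` almost everywhere
(`ae_nonpos_of_integral_mul_trig_nonpos`).
-/

namespace ActiveMatter

noncomputable section

/-! ### The periodic cell and integration by parts -/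

/-- The interval `(0, 2π)`, the factor of the cell in each variable. -/
def I₀ : Set ℝ := Ioo 0 (2 * Real.pi)

lemma two_pi_pos : (0 : ℝ) < 2 * Real.pi := by positivity

lemma restrict_Ω : (volume.restrict Ω : Measure (ℝ × ℝ))
    = (volume.restrict I₀).prod (volume.restrict I₀) := by
  rw [Measure.prod_restrict]; rfl

lemma restrict_Υ : (volume.restrict Υ : Measure E)
    = (volume.restrict Ω).prod (volume.restrict I₀) := by
  rw [Measure.prod_restrict]; rfl

instance : IsFiniteMeasure (volume.restrict I₀) := ⟨by simp [I₀, ENNReal.mul_lt_top_iff]⟩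

instance : IsFiniteMeasure (volume.restrict Ω) := by rw [restrict_Ω]; infer_instance

lemma volume_real_Υ : (volume.restrict Υ).real univ = (2 * Real.pi) ^ 3 := by
  have h : (volume.restrict I₀).real univ = 2 * Real.pi := by
    simp [I₀, Measure.real, Real.pi_pos.le]
  rw [restrict_Υ, restrict_Ω, ← univ_prod_univ, measureReal_prod_prod, ← univ_prod_univ,
    measureReal_prod_prod, h]
  ring

lemma integrable_Υ_of_continuous {φ : E → ℝ} (hφ : Continuous φ) :
    Integrable φ (volume.restrict Υ) :=
  (memLp_of_continuous hφ).integrable (by norm_num)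

lemma integrable_Ω_of_continuous {φ : ℝ × ℝ → ℝ} (hφ : Continuous φ) :
    Integrable φ (volume.restrict Ω) := by
  have h : Ω ⊆ Icc ((0, 0) : ℝ × ℝ) (2 * Real.pi, 2 * Real.pi) := by
    rintro ⟨a, b⟩ ⟨ha, hb⟩
    exact ⟨⟨ha.1.le, hb.1.le⟩, ⟨ha.2.le, hb.2.le⟩⟩
  exact (hφ.continuousOn.integrableOn_compact isCompact_Icc).mono_set h

lemma integral_Υ_of_continuous {φ : E → ℝ} (hφ : Continuous φ) :
    ∫ ξ in Υ, φ ξ = ∫ x in Ω, ∫ θ in I₀, φ (x, θ) := by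
  have := integrable_Υ_of_continuous hφ
  rw [restrict_Υ] at this ⊢
  exact integral_prod _ this

lemma integral_deriv_period {g g' : ℝ → ℝ} (h : ∀ t, HasDerivAt g (g' t) t) (hc : Continuous g')
    (hp : g (2 * Real.pi) = g 0) : ∫ t in I₀, g' t = 0 := by
  rw [I₀, ← integral_Ioc_eq_integral_Ioo, ← intervalIntegral.integral_of_le two_pi_pos.le,
    intervalIntegral.integral_eq_sub_of_hasDerivAt (fun t _ => h t) (hc.intervalIntegrable _ _), hp,
    sub_self]

lemma hasDerivAt_of_hasLineDerivAt {w w' : E → ℝ} {e : E}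
    (h : ∀ ξ, HasLineDerivAt ℝ w (w' ξ) ξ e) (ξ : E) (s : ℝ) :
    HasDerivAt (fun t : ℝ => w (ξ + t • e)) (w' (ξ + s • e)) s := by
  have h1 := h (ξ + s • e)
  rw [HasLineDerivAt] at h1
  have h2 : HasDerivAt (fun t : ℝ => t - s) 1 s := (hasDerivAt_id s).sub_const s
  have h3 : HasDerivAt (fun t : ℝ => w (ξ + s • e + t • e)) (w' (ξ + s • e)) (s - s) := by
    rwa [sub_self]
  have h4 := HasDerivAt.comp (h := fun t : ℝ => t - s) s h3 h2
  simp only [mul_one] at h4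
  refine h4.congr_of_eventuallyEq (Eventually.of_forall fun t => ?_)
  simp only [Function.comp]
  congr 1
  rw [sub_smul]; abel

/-- The integral of a partial derivative of a periodic function over the cell vanishes. -/
lemma integral_lineDeriv_eq_zero {w w' : E → ℝ} {i : Fin 3}
    (h : ∀ ξ, HasLineDerivAt ℝ w (w' ξ) ξ (dir i)) (hc : Continuous w') (hp : IsPer w) :
    ∫ ξ in Υ, w' ξ = 0 := by
  have hline : ∀ ξ : E, ∫ t in I₀, w' (ξ + t • dir i) = 0 := fun ξ =>
    integral_deriv_period (hasDerivAt_of_hasLineDerivAt h ξ) (by fun_prop) (by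
      simpa using hp i ξ)
  fin_cases i
  · rw [restrict_Υ, integral_prod_symm _ (by
      rw [← restrict_Υ]; exact integrable_Υ_of_continuous hc)]
    refine integral_eq_zero_of_ae (Eventually.of_forall fun θ => ?_)
    have h1 := integrable_Ω_of_continuous (φ := fun x => w' (x, θ)) (by fun_prop)
    simp only [restrict_Ω] at h1 ⊢
    rw [integral_prod_symm _ h1]
    refine integral_eq_zero_of_ae (Eventually.of_forall fun y => ?_)
    simpa [dir] using! hline ((0, y), θ)
  · rw [restrict_Υ, integral_prod_symm _ (by
      rw [← restrict_Υ]; exact integrable_Υ_of_continuous hc)]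
    refine integral_eq_zero_of_ae (Eventually.of_forall fun θ => ?_)
    have h1 := integrable_Ω_of_continuous (φ := fun x => w' (x, θ)) (by fun_prop)
    simp only [restrict_Ω] at h1 ⊢
    rw [integral_prod _ h1]
    refine integral_eq_zero_of_ae (Eventually.of_forall fun y => ?_)
    simpa [dir] using! hline ((y, 0), θ)
  · rw [integral_Υ_of_continuous hc]
    refine integral_eq_zero_of_ae (Eventually.of_forall fun ⟨y, z⟩ => ?_)
    simpa [dir] using! hline ((y, z), 0)

/-! ### The Hartley system -/

/-- The phase `n · ξ`. -/
def phase (n : Fin 3 → ℤ) (ξ : E) : ℝ := n 0 * ξ.1.1 + n 1 * ξ.1.2 + n 2 * ξ.2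

/-- The Hartley function `cos (n · ξ) + sin (n · ξ)`. Over `n ∈ ℤ³` these form a real orthogonal
system closed under differentiation: `∂ᵢ hₙ = nᵢ h₋ₙ`. -/
def hart (n : Fin 3 → ℤ) (ξ : E) : ℝ := Real.cos (phase n ξ) + Real.sin (phase n ξ)

lemma phase_neg (n : Fin 3 → ℤ) (ξ : E) : phase (-n) ξ = -phase n ξ := by
  simp [phase]; ring

lemma hart_neg (n : Fin 3 → ℤ) (ξ : E) :
    hart (-n) ξ = Real.cos (phase n ξ) - Real.sin (phase n ξ) := by
  simp [hart, phase_neg, sub_eq_add_neg]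

lemma hart_zero (ξ : E) : hart 0 ξ = 1 := by simp [hart, phase]

lemma phase_add_smul_dir (n : Fin 3 → ℤ) (ξ : E) (t : ℝ) (i : Fin 3) :
    phase n (ξ + t • dir i) = phase n ξ + n i * t := by
  fin_cases i <;> simp [phase, dir] <;> ring

lemma hart_add_smul_dir (n : Fin 3 → ℤ) (ξ : E) (t : ℝ) (i : Fin 3) :
    hart n (ξ + t • dir i) = Real.cos (n i * t) * hart n ξ + Real.sin (n i * t) * hart (-n) ξ := by
  rw [hart_neg, hart, hart, phase_add_smul_dir, Real.cos_add, Real.sin_add]; ring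

lemma isPer_hart (n : Fin 3 → ℤ) : IsPer (hart n) := by
  intro i ξ
  rw [hart_add_smul_dir, Real.cos_int_mul_two_pi, ← sub_zero ((n i : ℝ) * (2 * Real.pi)),
    Real.sin_int_mul_two_pi_sub]
  simp

lemma contDiff_hart (n : Fin 3 → ℤ) : ContDiff ℝ (⊤ : ℕ∞) (hart n) := by
  unfold hart phase; fun_prop

@[fun_prop]
lemma continuous_hart (n : Fin 3 → ℤ) : Continuous (hart n) := (contDiff_hart n).continuous

lemma isSmoothPer_hart (n : Fin 3 → ℤ) : IsSmoothPer (hart n) := ⟨contDiff_hart n, isPer_hart n⟩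

lemma abs_hart_le (n : Fin 3 → ℤ) (ξ : E) : |hart n ξ| ≤ 2 :=
  (abs_add_le _ _).trans (by
    linarith [Real.abs_cos_le_one (phase n ξ), Real.abs_sin_le_one (phase n ξ)])

lemma hasLineDerivAt_hart (n : Fin 3 → ℤ) (i : Fin 3) (ξ : E) :
    HasLineDerivAt ℝ (hart n) (n i * hart (-n) ξ) ξ (dir i) := by
  rw [HasLineDerivAt]
  simp only [hart_add_smul_dir]
  have h1 : HasDerivAt (fun t : ℝ => (n i : ℝ) * t) (n i) 0 := by
    simpa using (hasDerivAt_id (0 : ℝ)).const_mul (n i : ℝ)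
  convert! (h1.cos.mul_const (hart n ξ)).add (h1.sin.mul_const (hart (-n) ξ)) using 1
  simp

lemma fderiv_hart (n : Fin 3 → ℤ) (i : Fin 3) (ξ : E) :
    fderiv ℝ (hart n) ξ (dir i) = n i * hart (-n) ξ :=
  ((((contDiff_hart n).differentiable (by simp)) ξ).hasFDerivAt.hasLineDerivAt _).unique
    (hasLineDerivAt_hart n i ξ)

lemma hasLineDerivAt_fderiv {φ : E → ℝ} (hφ : IsSmoothPer φ) (i : Fin 3) (ξ : E) :
    HasLineDerivAt ℝ φ (fderiv ℝ φ ξ (dir i)) ξ (dir i) :=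
  ((hφ.1.differentiable (by simp)) ξ).hasFDerivAt.hasLineDerivAt _

lemma isPer_mul {f g : E → ℝ} (hf : IsPer f) (hg : IsPer g) : IsPer (fun ξ => f ξ * g ξ) :=
  fun i ξ => by simp only [hf i ξ, hg i ξ]

lemma hasLineDerivAt_mul {f g : E → ℝ} {a b : ℝ} {ξ e : E} (hf : HasLineDerivAt ℝ f a ξ e)
    (hg : HasLineDerivAt ℝ g b ξ e) :
    HasLineDerivAt ℝ (fun ξ => f ξ * g ξ) (a * g ξ + f ξ * b) ξ e := by
  rw [HasLineDerivAt] at *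
  simpa using! hf.mul hg

/-- Integration by parts on the periodic cell. -/
lemma integral_mul_lineDeriv {f g f' g' : E → ℝ} {i : Fin 3}
    (hf : ∀ ξ, HasLineDerivAt ℝ f (f' ξ) ξ (dir i)) (hg : ∀ ξ, HasLineDerivAt ℝ g (g' ξ) ξ (dir i))
    (cf : Continuous f) (cg : Continuous g) (cf' : Continuous f') (cg' : Continuous g')
    (pf : IsPer f) (pg : IsPer g) :
    ∫ ξ in Υ, f ξ * g' ξ = -∫ ξ in Υ, f' ξ * g ξ := by
  have h := integral_lineDeriv_eq_zero (fun ξ => hasLineDerivAt_mul (hf ξ) (hg ξ)) (by fun_prop)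
    (isPer_mul pf pg)
  rw [integral_add (integrable_Υ_of_continuous (by fun_prop))
    (integrable_Υ_of_continuous (by fun_prop))] at h
  linarith

lemma integral_hart {n : Fin 3 → ℤ} (hn : n ≠ 0) : ∫ ξ in Υ, hart n ξ = 0 := by
  obtain ⟨i, hi⟩ : ∃ i, n i ≠ 0 := by
    by_contra! h; exact hn (funext h)
  have h := integral_lineDeriv_eq_zero (w := hart (-n)) (w' := fun ξ => -n i * hart n ξ) (i := i)
    (fun ξ => by simpa using hasLineDerivAt_hart (-n) i ξ) (by fun_prop) (isPer_hart _)
  rw [integral_const_mul] at h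
  have : (-(n i : ℝ)) ≠ 0 := by simpa using hi
  exact (mul_eq_zero.1 h).resolve_left this

lemma phase_add (n m : Fin 3 → ℤ) (ξ : E) : phase (n + m) ξ = phase n ξ + phase m ξ := by
  simp [phase]; ring

lemma hart_mul_hart (n m : Fin 3 → ℤ) (ξ : E) :
    hart n ξ * hart m ξ = (1 / 2) * (hart (n - m) ξ + hart (m - n) ξ)
      + (1 / 2) * (hart (n + m) ξ - hart (-(n + m)) ξ) := by
  rw [sub_eq_add_neg n, sub_eq_add_neg m, hart_neg]
  simp only [hart, phase_add, phase_neg, Real.cos_add, Real.sin_add, Real.cos_neg, Real.sin_neg]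
  ring

lemma integral_hart_mul_hart (n m : Fin 3 → ℤ) :
    ∫ ξ in Υ, hart n ξ * hart m ξ = if n = m then (2 * Real.pi) ^ 3 else 0 := by
  simp only [hart_mul_hart]
  have c : ∀ n, Integrable (hart n) (volume.restrict Υ) := fun n =>
    integrable_Υ_of_continuous (continuous_hart n)
  have c1 : ∀ n m, Integrable (fun ξ => 1 / 2 * (hart n ξ + hart m ξ)) (volume.restrict Υ) :=
    fun n m => ((c n).add (c m)).const_mul _
  have c2 : ∀ n m, Integrable (fun ξ => 1 / 2 * (hart n ξ - hart m ξ)) (volume.restrict Υ) :=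
    fun n m => ((c n).sub (c m)).const_mul _
  rw [integral_add (c1 _ _) (c2 _ _), integral_const_mul, integral_const_mul,
    integral_add (c _) (c _), integral_sub (c _) (c _)]
  have h2 : ∫ ξ in Υ, hart (n + m) ξ = ∫ ξ in Υ, hart (-(n + m)) ξ := by
    by_cases h : n + m = 0
    · simp [h]
    · rw [integral_hart h, integral_hart (neg_ne_zero.2 h)]
  rw [h2, sub_self, mul_zero, add_zero]
  split_ifs with h
  · subst h
    have h1 : ∫ ξ in Υ, hart 0 ξ = (2 * Real.pi) ^ 3 := by
      simp only [hart_zero, integral_const, volume_real_Υ]; simp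
    rw [sub_self, h1]; ring
  · rw [integral_hart (sub_ne_zero.2 h), integral_hart (sub_ne_zero.2 (Ne.symm h))]; simp

/-! ### Trigonometric polynomials -/

/-- The trigonometric polynomial with coefficients `a` and frequencies in `S`. -/
def trig (S : Finset (Fin 3 → ℤ)) (a : (Fin 3 → ℤ) → ℝ) (ξ : E) : ℝ := ∑ n ∈ S, a n * hart n ξ

@[fun_prop]
lemma continuous_trig (S : Finset (Fin 3 → ℤ)) (a : (Fin 3 → ℤ) → ℝ) : Continuous (trig S a) := by
  unfold trig; fun_prop

lemma isPer_trig (S : Finset (Fin 3 → ℤ)) (a : (Fin 3 → ℤ) → ℝ) : IsPer (trig S a) := by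
  intro i ξ
  exact Finset.sum_congr rfl fun n _ => by rw [isPer_hart n i ξ]

/-- The coefficients-to-partial-derivative map: `∂ᵢ` of `trig S a`. -/
def trigD (i : Fin 3) (S : Finset (Fin 3 → ℤ)) (a : (Fin 3 → ℤ) → ℝ) (ξ : E) : ℝ :=
  ∑ n ∈ S, a n * (n i * hart (-n) ξ)

@[fun_prop]
lemma continuous_trigD (i : Fin 3) (S : Finset (Fin 3 → ℤ)) (a : (Fin 3 → ℤ) → ℝ) :
    Continuous (trigD i S a) := by
  unfold trigD; fun_prop

lemma isPer_trigD (i : Fin 3) (S : Finset (Fin 3 → ℤ)) (a : (Fin 3 → ℤ) → ℝ) :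
    IsPer (trigD i S a) := by
  intro j ξ
  exact Finset.sum_congr rfl fun n _ => by rw [isPer_hart _ j ξ]

lemma hasLineDerivAt_trig (i : Fin 3) (S : Finset (Fin 3 → ℤ)) (a : (Fin 3 → ℤ) → ℝ) (ξ : E) :
    HasLineDerivAt ℝ (trig S a) (trigD i S a ξ) ξ (dir i) := by
  have h : ∀ n ∈ S, HasDerivAt (fun t : ℝ => a n * hart n (ξ + t • dir i))
      (a n * (n i * hart (-n) ξ)) 0 := fun n _ =>
    HasDerivAt.const_mul (a n) (hasLineDerivAt_hart n i ξ)
  exact HasDerivAt.fun_sum h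

lemma hasLineDerivAt_trigD (i : Fin 3) (S : Finset (Fin 3 → ℤ)) (a : (Fin 3 → ℤ) → ℝ) (ξ : E) :
    HasLineDerivAt ℝ (trigD i S a) (trig S (fun n => -(n i : ℝ) ^ 2 * a n) ξ) ξ (dir i) := by
  have h : ∀ n ∈ S, HasDerivAt (fun t : ℝ => a n * (n i * hart (-n) (ξ + t • dir i)))
      (a n * (n i * (-n i * hart n ξ))) 0 := fun n _ => by
    have := HasDerivAt.const_mul (a n)
      (HasDerivAt.const_mul (n i : ℝ) (hasLineDerivAt_hart (-n) i ξ))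
    simpa using this
  have h1 := HasDerivAt.fun_sum h
  rw [HasLineDerivAt]
  convert! h1 using 1
  exact Finset.sum_congr rfl fun n _ => by ring

lemma integral_trig (S : Finset (Fin 3 → ℤ)) (a : (Fin 3 → ℤ) → ℝ) :
    ∫ ξ in Υ, trig S a ξ = if 0 ∈ S then a 0 * (2 * Real.pi) ^ 3 else 0 := by
  unfold trig
  rw [integral_finsetSum _ fun n _ => (integrable_Υ_of_continuous (continuous_hart n)).const_mul _]
  have h : ∀ n ∈ S, ∫ ξ in Υ, a n * hart n ξ
      = if 0 = n then a n * (2 * Real.pi) ^ 3 else 0 := fun n _ => by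
    rw [integral_const_mul]
    split_ifs with hn
    · subst hn
      simp only [hart_zero, integral_const, volume_real_Υ]; simp
    · rw [integral_hart (Ne.symm hn), mul_zero]
  rw [Finset.sum_congr rfl h, Finset.sum_ite_eq]

/-- The space of trigonometric polynomials. -/
def TrigSpan : Submodule ℝ (E → ℝ) := Submodule.span ℝ (range hart)

lemma exists_trig_of_mem {φ : E → ℝ} (h : φ ∈ TrigSpan) : ∃ S a, φ = trig S a := by
  obtain ⟨c, hc⟩ := (Finsupp.mem_span_range_iff_exists_finsupp).1 h
  refine ⟨c.support, c, ?_⟩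
  rw [← hc]
  funext ξ
  simp [Finsupp.sum, trig]

lemma hart_mem (n : Fin 3 → ℤ) : hart n ∈ TrigSpan := Submodule.subset_span ⟨n, rfl⟩

lemma mul_mem_trigSpan {φ ψ : E → ℝ} (hφ : φ ∈ TrigSpan) (hψ : ψ ∈ TrigSpan) :
    φ * ψ ∈ TrigSpan := by
  have h : TrigSpan * TrigSpan ≤ TrigSpan := by
    rw [TrigSpan, Submodule.span_mul_span, Submodule.span_le]
    rintro _ ⟨_, ⟨n, rfl⟩, _, ⟨m, rfl⟩, rfl⟩
    have : hart n * hart m = (1 / 2 : ℝ) • (hart (n - m) + hart (m - n))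
        + (1 / 2 : ℝ) • (hart (n + m) - hart (-(n + m))) := by
      funext ξ; exact hart_mul_hart n m ξ
    simp only [this]
    exact add_mem (Submodule.smul_mem _ _ (add_mem (hart_mem _) (hart_mem _)))
      (Submodule.smul_mem _ _ (sub_mem (hart_mem _) (hart_mem _)))
  exact h (Submodule.mul_mem_mul hφ hψ)

lemma cos_phase_mem (n : Fin 3 → ℤ) : (fun ξ => Real.cos (phase n ξ)) ∈ TrigSpan := by
  have : (fun ξ => Real.cos (phase n ξ)) = (1 / 2 : ℝ) • (hart n + hart (-n)) := by
    funext ξ; simp [hart_neg]; simp [hart]; ring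
  rw [this]
  exact Submodule.smul_mem _ _ (add_mem (hart_mem _) (hart_mem _))

lemma sin_phase_mem (n : Fin 3 → ℤ) : (fun ξ => Real.sin (phase n ξ)) ∈ TrigSpan := by
  have : (fun ξ => Real.sin (phase n ξ)) = (1 / 2 : ℝ) • (hart n - hart (-n)) := by
    funext ξ; simp [hart_neg]; simp [hart]; ring
  rw [this]
  exact Submodule.smul_mem _ _ (sub_mem (hart_mem _) (hart_mem _))

/-! ### Hartley functions as Sobolev functions -/

/-- The class in `L²` of a continuous function. -/
def contL2 (φ : E → ℝ) (hφ : Continuous φ) : L2 := (memLp_of_continuous hφ).toLp φ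

lemma coeFn_contL2 (φ : E → ℝ) (hφ : Continuous φ) :
    contL2 φ hφ =ᵐ[volume.restrict Υ] φ := MemLp.coeFn_toLp _

/-- The Hartley function `hₙ` as an element of `H¹`. -/
def hartH1 (n : Fin 3 → ℤ) : H1per :=
  ⟨WithLp.toLp 2 (contL2 (hart n) (continuous_hart n), WithLp.toLp 2 fun i =>
      contL2 (fun ξ => n i * hart (-n) ξ) (by fun_prop)), by
    intro φ hφ i
    change ∫ ξ in Υ, contL2 (hart n) (continuous_hart n) ξ * fderiv ℝ φ ξ (dir i)
      = -∫ ξ in Υ, contL2 (fun ξ => n i * hart (-n) ξ) (by fun_prop) ξ * φ ξ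
    have h1 : ∫ ξ in Υ, contL2 (hart n) (continuous_hart n) ξ * fderiv ℝ φ ξ (dir i)
        = ∫ ξ in Υ, hart n ξ * fderiv ℝ φ ξ (dir i) := by
      refine integral_congr_ae ?_
      filter_upwards [coeFn_contL2 (hart n) (continuous_hart n)] with ξ h
      rw [h]
    have h2 : ∫ ξ in Υ, contL2 (fun ξ => n i * hart (-n) ξ) (by fun_prop) ξ * φ ξ
        = ∫ ξ in Υ, n i * hart (-n) ξ * φ ξ := by
      refine integral_congr_ae ?_
      filter_upwards [coeFn_contL2 (fun ξ => n i * hart (-n) ξ) (by fun_prop)] with ξ h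
      rw [h]
    rw [h1, h2]
    exact integral_mul_lineDeriv (hasLineDerivAt_hart n i) (hasLineDerivAt_fderiv hφ i)
      (continuous_hart n) hφ.1.continuous (by fun_prop)
      ((hφ.1.continuous_fderiv (by simp)).clm_apply continuous_const) (isPer_hart n) hφ.2⟩

lemma val_hartH1 (n : Fin 3 → ℤ) : val (hartH1 n) =ᵐ[volume.restrict Υ] hart n :=
  coeFn_contL2 _ (continuous_hart n)

lemma pderiv_hartH1 (n : Fin 3 → ℤ) (i : Fin 3) :
    pderiv i (hartH1 n) =ᵐ[volume.restrict Υ] fun ξ => n i * hart (-n) ξ :=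
  coeFn_contL2 _ (by fun_prop)

/-! ### Completeness of the trigonometric polynomials -/

/-- The three-dimensional torus `(ℝ / 2πℤ)³`. -/
abbrev Torus : Type := (Real.Angle × Real.Angle) × Real.Angle

instance : CompactSpace Real.Angle := by
  have : Fact (0 < 2 * Real.pi) := ⟨two_pi_pos⟩
  exact inferInstanceAs (CompactSpace (AddCircle (2 * Real.pi)))

/-- The projection of `ℝ³` onto the torus. -/
def toTorus (ξ : E) : Torus := ((ξ.1.1, ξ.1.2), ξ.2)

@[fun_prop]
lemma continuous_toTorus : Continuous toTorus := by
  unfold toTorus; fun_prop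

lemma toTorus_surjective : Function.Surjective toTorus := by
  rintro ⟨⟨a, b⟩, c⟩
  induction a using Real.Angle.induction_on with | _ a =>
  induction b using Real.Angle.induction_on with | _ b =>
  induction c using Real.Angle.induction_on with | _ c =>
  exact ⟨((a, b), c), rfl⟩

lemma eq_of_coe_angle_eq {a b : ℝ} (ha : a ∈ Ioo 0 (2 * Real.pi)) (hb : b ∈ Ioo 0 (2 * Real.pi))
    (h : (a : Real.Angle) = b) : a = b := by
  obtain ⟨k, hk⟩ := Real.Angle.angle_eq_iff_two_pi_dvd_sub.1 h
  have h1 : (k : ℝ) < 1 := by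
    by_contra! h1
    nlinarith [ha.1, ha.2, hb.1, hb.2, two_pi_pos]
  have h2 : (-1 : ℝ) < k := by
    by_contra! h2
    nlinarith [ha.1, ha.2, hb.1, hb.2, two_pi_pos]
  have h3 : k = 0 := by
    have h1' : k < 1 := by exact_mod_cast h1
    have h2' : -1 < k := by exact_mod_cast h2
    omega
  subst h3
  simp at hk
  linarith

lemma injOn_toTorus : InjOn toTorus Υ := by
  rintro ⟨⟨a, b⟩, c⟩ ⟨⟨ha, hb⟩, hc⟩ ⟨⟨a', b'⟩, c'⟩ ⟨⟨ha', hb'⟩, hc'⟩ h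
  simp only [toTorus, Prod.mk.injEq] at h
  obtain ⟨⟨h1, h2⟩, h3⟩ := h
  have e1 : a = a' := eq_of_coe_angle_eq ha ha' h1
  have e2 : b = b' := eq_of_coe_angle_eq hb hb' h2
  have e3 : c = c' := eq_of_coe_angle_eq hc hc' h3
  rw [e1, e2, e3]

/-- The algebra of continuous functions on the torus that lift to trigonometric polynomials. -/
def trigAlg : Subalgebra ℝ C(Torus, ℝ) where
  carrier := {q | (fun ξ => q (toTorus ξ)) ∈ TrigSpan}
  mul_mem' := fun ha hb => mul_mem_trigSpan ha hb
  add_mem' := fun ha hb => TrigSpan.add_mem ha hb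
  algebraMap_mem' := fun r => by
    have h : (fun ξ => (algebraMap ℝ C(Torus, ℝ) r) (toTorus ξ)) = r • hart 0 := by
      funext ξ; simp [hart_zero]
    change _ ∈ TrigSpan
    rw [h]
    exact Submodule.smul_mem _ _ (hart_mem _)

lemma separatesPoints_trigAlg : trigAlg.SeparatesPoints := by
  have hc : ∀ (p : Torus → Real.Angle) (hp : Continuous p) (n : Fin 3 → ℤ),
      (∀ ξ, p (toTorus ξ) = (phase n ξ : ℝ)) →
      (⟨fun x => (p x).cos, Real.Angle.continuous_cos.comp hp⟩ : C(Torus, ℝ)) ∈ trigAlg ∧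
      (⟨fun x => (p x).sin, Real.Angle.continuous_sin.comp hp⟩ : C(Torus, ℝ)) ∈ trigAlg := by
    intro p hp n h
    constructor
    · change (fun ξ => (p (toTorus ξ)).cos) ∈ TrigSpan
      simp only [h, Real.Angle.cos_coe]
      exact cos_phase_mem n
    · change (fun ξ => (p (toTorus ξ)).sin) ∈ TrigSpan
      simp only [h, Real.Angle.sin_coe]
      exact sin_phase_mem n
  have key : ∀ (p : Torus → Real.Angle) (_ : Continuous p) (n : Fin 3 → ℤ),
      (∀ ξ, p (toTorus ξ) = (phase n ξ : ℝ)) → ∀ x y, p x ≠ p y →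
      ∃ f ∈ (fun q : C(Torus, ℝ) => (q : Torus → ℝ)) '' (trigAlg : Set C(Torus, ℝ)), f x ≠ f y := by
    intro p hp n h x y hxy
    by_cases hcos : (p x).cos = (p y).cos
    · refine ⟨_, ⟨_, (hc p hp n h).2, rfl⟩, fun hsin => hxy ?_⟩
      obtain ⟨ξ, rfl⟩ := toTorus_surjective x
      obtain ⟨η, rfl⟩ := toTorus_surjective y
      simp only [ContinuousMap.coe_mk] at hsin
      rw [h, h] at hcos hsin ⊢
      exact Real.Angle.cos_sin_inj (by simpa using hcos) (by simpa using hsin)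
    · exact ⟨_, ⟨_, (hc p hp n h).1, rfl⟩, hcos⟩
  intro x y hxy
  by_cases h1 : x.1.1 = y.1.1
  · by_cases h2 : x.1.2 = y.1.2
    · refine key (fun x => x.2) (by fun_prop) ![0, 0, 1] (fun ξ => by simp [toTorus, phase]) x y ?_
      exact fun h3 => hxy (Prod.ext (Prod.ext h1 h2) h3)
    · exact key (fun x => x.1.2) (by fun_prop) ![0, 1, 0] (fun ξ => by simp [toTorus, phase]) x y h2
  · exact key (fun x => x.1.1) (by fun_prop) ![1, 0, 0] (fun ξ => by simp [toTorus, phase]) x y h1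

lemma exists_trig_near (q : C(Torus, ℝ)) {ε : ℝ} (hε : 0 < ε) :
    ∃ S a, ∀ ξ, |trig S a ξ - q (toTorus ξ)| < ε := by
  obtain ⟨⟨p, hp⟩, h⟩ := ContinuousMap.exists_mem_subalgebra_near_continuousMap_of_separatesPoints
    trigAlg separatesPoints_trigAlg q ε hε
  obtain ⟨S, a, hS⟩ := exists_trig_of_mem (show (fun ξ => p (toTorus ξ)) ∈ TrigSpan from hp)
  refine ⟨S, a, fun ξ => ?_⟩
  rw [← hS]
  exact ((p - q).norm_coe_le_norm (toTorus ξ)).trans_lt h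

/-- A function whose integral against every non-negative trigonometric polynomial is non-positive
is itself non-positive. -/
lemma ae_nonpos_of_integral_mul_trig_nonpos {g : E → ℝ} (hg : Integrable g (volume.restrict Υ))
    (h : ∀ S a, (∀ ξ, 0 ≤ trig S a ξ) → ∫ ξ in Υ, g ξ * trig S a ξ ≤ 0) :
    ∀ᵐ ξ ∂(volume.restrict Υ), g ξ ≤ 0 := by
  -- Non-negative continuous functions on the torus are allowed as test functions: approximate
  -- `q + ε` uniformly within `ε`, which keeps the approximation non-negative.
  have hq : ∀ q : C(Torus, ℝ), (∀ x, 0 ≤ q x) → ∫ ξ in Υ, g ξ * q (toTorus ξ) ≤ 0 := by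
    intro q hq0
    have hint : ∀ φ : E → ℝ, Continuous φ → ∀ C, (∀ ξ, |φ ξ| ≤ C) →
        Integrable (fun ξ => g ξ * φ ξ) (volume.restrict Υ) := fun φ hφ C hC =>
      hg.mul_bdd (c := C) hφ.aestronglyMeasurable (Eventually.of_forall hC)
    have hqb : ∀ ξ, |q (toTorus ξ)| ≤ ‖q‖ := fun ξ => q.norm_coe_le_norm _
    have key : ∀ ε : ℝ, 0 < ε → ∫ ξ in Υ, g ξ * q (toTorus ξ) ≤ ε * (2 * ∫ ξ in Υ, |g ξ|) := by
      intro ε hε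
      obtain ⟨S, a, hS⟩ := exists_trig_near (q + ContinuousMap.const _ ε) hε
      have hS' : ∀ ξ, |trig S a ξ - (q (toTorus ξ) + ε)| < ε := hS
      have h1 := h S a fun ξ => by
        have := abs_lt.1 (hS' ξ); linarith [hq0 (toTorus ξ)]
      have h2 : ∫ ξ in Υ, g ξ * q (toTorus ξ)
          ≤ ∫ ξ in Υ, (g ξ * trig S a ξ + 2 * ε * |g ξ|) := by
        refine integral_mono (hint _ (by fun_prop) _ hqb)
          ((hint _ (by fun_prop) (‖q‖ + 2 * ε) fun ξ => ?_).add (hg.abs.const_mul _)) fun ξ => ?_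
        · have h3 := abs_lt.1 (hS' ξ)
          have h4 := abs_le.1 (hqb ξ)
          exact abs_le.2 ⟨by linarith, by linarith⟩
        · have h3 := abs_lt.1 (hS' ξ)
          have h5 : |g ξ * (q (toTorus ξ) - trig S a ξ)| ≤ |g ξ| * (2 * ε) := by
            rw [abs_mul]
            exact mul_le_mul_of_nonneg_left (abs_le.2 ⟨by linarith, by linarith⟩) (abs_nonneg _)
          have h6 := (le_abs_self _).trans h5
          simp only
          linarith
      rw [integral_add (hint _ (by fun_prop) (‖q‖ + 2 * ε) fun ξ => ?_) (hg.abs.const_mul _),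
        integral_const_mul] at h2
      · linarith
      · have h3 := abs_lt.1 (hS' ξ)
        have h4 := abs_le.1 (hqb ξ)
        exact abs_le.2 ⟨by linarith, by linarith⟩
    have hlim : Tendsto (fun ε : ℝ => ε * (2 * ∫ ξ in Υ, |g ξ|)) (𝓝[>] 0) (𝓝 0) := by
      have : Tendsto (fun ε : ℝ => ε * (2 * ∫ ξ in Υ, |g ξ|)) (𝓝 0)
          (𝓝 (0 * (2 * ∫ ξ in Υ, |g ξ|))) := (continuous_mul_const _).tendsto _
      rw [zero_mul] at this
      exact this.mono_left nhdsWithin_le_nhds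
    exact ge_of_tendsto hlim (by filter_upwards [self_mem_nhdsWithin] with ε hε using key ε hε)
  -- Hence so are indicators of compact sets.
  have hK : ∀ K ⊆ Υ, IsCompact K → ∫ ξ in K, g ξ ≤ 0 := by
    intro K hKΥ hKc
    have hKm := hKc.measurableSet
    have hcl : IsClosed (toTorus '' K) := (hKc.image continuous_toTorus).isClosed
    let δ : ℕ → ℝ := fun n => 1 / ((n : ℝ) + 1)
    have hδ : ∀ n, 0 < δ n := fun n => Nat.one_div_pos_of_nat
    have ht := tendsto_pi_nhds.1 (thickenedIndicator_tendsto_indicator_closure hδ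
      tendsto_one_div_add_atTop_nhds_zero_nat (toTorus '' K))
    have h1 : Tendsto (fun n => ∫ ξ in Υ, g ξ *
        (thickenedIndicator (hδ n) (toTorus '' K) (toTorus ξ) : ℝ)) atTop
        (𝓝 (∫ ξ in Υ, K.indicator g ξ)) := by
      refine tendsto_integral_of_dominated_convergence (fun ξ => |g ξ|) (fun n => ?_) hg.abs
        (fun n => Eventually.of_forall fun ξ => ?_) ?_
      · refine hg.aestronglyMeasurable.mul (Continuous.aestronglyMeasurable ?_)
        exact NNReal.continuous_coe.comp
          ((thickenedIndicator (hδ n) (toTorus '' K)).continuous.comp continuous_toTorus)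
      · rw [norm_mul]
        refine mul_le_of_le_one_right (norm_nonneg _) ?_
        rw [Real.norm_of_nonneg (NNReal.coe_nonneg _)]
        exact_mod_cast thickenedIndicator_le_one (hδ n) _ _
      · filter_upwards [ae_restrict_mem measurableSet_Υ] with ξ hξ
        have h2 := ((NNReal.tendsto_coe.2 (ht (toTorus ξ))).const_mul (g ξ))
        convert h2 using 2
        rw [hcl.closure_eq]
        by_cases hk : ξ ∈ K
        · rw [indicator_of_mem hk, indicator_of_mem (mem_image_of_mem _ hk)]; simp
        · rw [indicator_of_notMem hk, indicator_of_notMem]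
          · simp
          · rintro ⟨η, hη, he⟩
            exact hk (injOn_toTorus (hKΥ hη) hξ he ▸ hη)
    have h2 : ∫ ξ in Υ, K.indicator g ξ = ∫ ξ in K, g ξ := by
      rw [setIntegral_indicator hKm, inter_eq_self_of_subset_right hKΥ]
    rw [← h2]
    refine le_of_tendsto h1 (Eventually.of_forall fun n => ?_)
    exact hq ⟨fun x => (thickenedIndicator (hδ n) (toTorus '' K) x : ℝ),
      NNReal.continuous_coe.comp (thickenedIndicator (hδ n) (toTorus '' K)).continuous⟩
      fun x => NNReal.coe_nonneg _
  -- If `g` were positive on a set of positive measure, it would be so on a compact subset.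
  obtain ⟨g', hg'm, hgg'⟩ := hg.aestronglyMeasurable
  by_contra hcon
  have hA : MeasurableSet (Υ ∩ {ξ | 0 < g' ξ}) :=
    measurableSet_Υ.inter (measurableSet_lt measurable_const hg'm.measurable)
  have hpos : 0 < volume (Υ ∩ {ξ | 0 < g' ξ}) := by
    rw [pos_iff_ne_zero]
    intro h0
    refine hcon ?_
    have : ∀ᵐ ξ ∂(volume.restrict Υ), ¬ 0 < g' ξ := by
      rw [ae_restrict_iff' measurableSet_Υ, ae_iff]
      convert! h0 using 2
      ext ξ; simp
    filter_upwards [this, hgg'] with ξ h1 h2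
    rw [h2]; exact not_lt.1 h1
  obtain ⟨K, hKA, hKc, hKpos⟩ := hA.exists_lt_isCompact_of_ne_top
    ((measure_mono inter_subset_left).trans_lt volume_Υ_lt_top).ne hpos
  have hle := hK K (hKA.trans inter_subset_left) hKc
  have hgK : IntegrableOn g K := hg.mono_measure (Measure.restrict_mono_set _
    (hKA.trans inter_subset_left))
  have hgpos : ∀ᵐ ξ ∂(volume.restrict K), 0 < g ξ := by
    filter_upwards [ae_restrict_mem hKc.measurableSet,
      ae_restrict_of_ae_restrict_of_subset (hKA.trans inter_subset_left) hgg'] with ξ h1 h2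
    rw [h2]; exact (hKA h1).2
  have h0 := (integral_eq_zero_iff_of_nonneg_ae (hgpos.mono fun ξ h => h.le) hgK).1
    (le_antisymm hle (integral_nonneg_of_ae (hgpos.mono fun ξ h => h.le)))
  have : ∀ᵐ ξ ∂(volume.restrict K), False := by
    filter_upwards [hgpos, h0] with ξ h1 h2
    rw [h2] at h1
    exact lt_irrefl _ h1
  have hz : volume.restrict K = 0 := by simpa [ae_iff] using this
  rw [Measure.restrict_eq_zero] at hz
  exact hKpos.ne' hz

/-! ### Parseval's identity for the Hartley system -/

/-- The Hartley coefficient of `g`. -/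
def hcoef (g : E → ℝ) (n : Fin 3 → ℤ) : ℝ := (∫ ξ in Υ, g ξ * hart n ξ) / (2 * Real.pi) ^ 3

/-- The partial Hartley sum of `g` over the frequencies in `S`. -/
def hproj (S : Finset (Fin 3 → ℤ)) (g : E → ℝ) : E → ℝ := trig S (hcoef g)

lemma norm_sq_L2 (u : L2) : ‖u‖ ^ 2 = ∫ ξ in Υ, u ξ ^ 2 := by
  rw [← real_inner_self_eq_norm_sq, L2.inner_def]
  refine integral_congr_ae (Eventually.of_forall fun ξ => ?_)
  simp [pow_two]

/-- The normalized Hartley function in `L²`. -/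
def hartL2 (n : Fin 3 → ℤ) : L2 :=
  (√((2 * Real.pi) ^ 3))⁻¹ • contL2 (hart n) (continuous_hart n)

lemma inner_contL2_hart (u : L2) (n : Fin 3 → ℤ) :
    inner ℝ (contL2 (hart n) (continuous_hart n)) u = ∫ ξ in Υ, u ξ * hart n ξ := by
  rw [L2.inner_def]
  refine integral_congr_ae ?_
  filter_upwards [coeFn_contL2 (hart n) (continuous_hart n)] with ξ h
  simp [h]

lemma orthonormal_hartL2 : Orthonormal ℝ hartL2 := by
  classical
  rw [orthonormal_iff_ite]
  intro n m
  rw [hartL2, hartL2, real_inner_smul_left, real_inner_smul_right, inner_contL2_hart]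
  have : ∫ ξ in Υ, contL2 (hart m) (continuous_hart m) ξ * hart n ξ
      = if m = n then (2 * Real.pi) ^ 3 else 0 := by
    rw [← integral_hart_mul_hart]
    refine integral_congr_ae ?_
    filter_upwards [coeFn_contL2 (hart m) (continuous_hart m)] with ξ h
    rw [h]
  rw [this]
  have hp : (0 : ℝ) < (2 * Real.pi) ^ 3 := by positivity
  by_cases hnm : n = m
  · simp only [hnm, if_true]
    rw [← mul_assoc, ← mul_inv, Real.mul_self_sqrt hp.le, inv_mul_cancel₀ hp.ne']
  · simp [hnm, Ne.symm hnm]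

lemma integral_mul_trig {g : E → ℝ} (hg : MemLp g 2 (volume.restrict Υ))
    (S : Finset (Fin 3 → ℤ)) (a : (Fin 3 → ℤ) → ℝ) :
    ∫ ξ in Υ, g ξ * trig S a ξ = ∑ n ∈ S, a n * ∫ ξ in Υ, g ξ * hart n ξ := by
  simp only [trig, Finset.mul_sum]
  rw [integral_finsetSum]
  · refine Finset.sum_congr rfl fun n _ => ?_
    rw [← integral_const_mul]
    exact integral_congr_ae (Eventually.of_forall fun ξ => by simp only; ring)
  · intro n _
    have := (hg.integrable_mul (memLp_of_continuous (continuous_hart n))).const_mul (a n)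
    refine this.congr (Eventually.of_forall fun ξ => ?_)
    simp only [Pi.mul_apply]; ring

lemma orthogonal_span_hartL2 : (Submodule.span ℝ (range hartL2))ᗮ = ⊥ := by
  rw [Submodule.eq_bot_iff]
  intro u hu
  rw [Submodule.mem_orthogonal] at hu
  have h0 : ∀ n, ∫ ξ in Υ, u ξ * hart n ξ = 0 := fun n => by
    have h1 := hu _ (Submodule.subset_span ⟨n, rfl⟩)
    rw [hartL2, real_inner_smul_left, inner_contL2_hart] at h1
    exact (mul_eq_zero.1 h1).resolve_left (by positivity)
  have hint : Integrable u (volume.restrict Υ) := (Lp.memLp u).integrable (by norm_num)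
  have h1 := ae_nonpos_of_integral_mul_trig_nonpos hint fun S a _ => by
    rw [integral_mul_trig (Lp.memLp u)]; simp [h0]
  have h2 := ae_nonpos_of_integral_mul_trig_nonpos (g := fun ξ => -u ξ) hint.neg fun S a _ => by
    simp only [neg_mul]
    rw [integral_neg, integral_mul_trig (Lp.memLp u)]; simp [h0]
  refine (Lp.eq_zero_iff_ae_eq_zero).2 ?_
  filter_upwards [h1, h2] with ξ h3 h4
  exact le_antisymm h3 (by simpa using h4)

lemma integrable_sq {g : E → ℝ} (hg : MemLp g 2 (volume.restrict Υ)) :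
    Integrable (fun ξ => g ξ ^ 2) (volume.restrict Υ) := hg.integrable_sq

lemma memLp_hproj (S : Finset (Fin 3 → ℤ)) (g : E → ℝ) :
    MemLp (hproj S g) 2 (volume.restrict Υ) := memLp_of_continuous (continuous_trig _ _)

/-- The partial Hartley sums of a square-integrable function converge to it in mean square. -/
lemma tendsto_integral_sub_hproj {g : E → ℝ} (hg : MemLp g 2 (volume.restrict Υ)) :
    Tendsto (fun S => ∫ ξ in Υ, (g ξ - hproj S g ξ) ^ 2) atTop (𝓝 0) := by
  let b : HilbertBasis (Fin 3 → ℤ) ℝ L2 :=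
    HilbertBasis.mkOfOrthogonalEqBot orthonormal_hartL2 orthogonal_span_hartL2
  have hb : ∀ n, b n = hartL2 n := fun n => by simp [b]
  have hs : Tendsto (fun S : Finset (Fin 3 → ℤ) => ∑ n ∈ S, b.repr (hg.toLp g) n • b n) atTop
      (𝓝 (hg.toLp g)) := b.hasSum_repr (hg.toLp g)
  have hs2 := ((tendsto_iff_norm_sub_tendsto_zero.1 hs).pow 2)
  rw [zero_pow two_ne_zero] at hs2
  have hp : (0 : ℝ) < (2 * Real.pi) ^ 3 := by positivity
  have hterm : ∀ n, b.repr (hg.toLp g) n • b n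
      = hcoef g n • contL2 (hart n) (continuous_hart n) := fun n => by
    rw [b.repr_apply_apply, hb, hartL2, real_inner_smul_left, inner_contL2_hart, smul_smul]
    congr 1
    have : ∫ ξ in Υ, hg.toLp g ξ * hart n ξ = ∫ ξ in Υ, g ξ * hart n ξ := by
      refine integral_congr_ae ?_
      filter_upwards [hg.coeFn_toLp] with ξ h
      rw [h]
    rw [this, hcoef, mul_right_comm, ← mul_inv, Real.mul_self_sqrt hp.le]
    field_simp
  refine hs2.congr fun S => ?_
  rw [Finset.sum_congr rfl fun n _ => hterm n, norm_sub_rev, norm_sq_L2]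
  refine integral_congr_ae ?_
  have hsum : ((∑ n ∈ S, hcoef g n • contL2 (hart n) (continuous_hart n) : L2) : E → ℝ)
      =ᵐ[volume.restrict Υ] hproj S g := by
    induction S using Finset.induction_on with
    | empty =>
      rw [Finset.sum_empty]
      filter_upwards [Lp.coeFn_zero ℝ 2 (volume.restrict Υ)] with ξ h
      rw [h]; simp [hproj, trig]
    | insert n S hn ih =>
      rw [Finset.sum_insert hn]
      filter_upwards [Lp.coeFn_add (hcoef g n • contL2 (hart n) (continuous_hart n))
        (∑ n ∈ S, hcoef g n • contL2 (hart n) (continuous_hart n)), ih,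
        Lp.coeFn_smul (hcoef g n) (contL2 (hart n) (continuous_hart n)),
        coeFn_contL2 (hart n) (continuous_hart n)] with ξ h1 h2 h3 h4
      rw [h1, Pi.add_apply, h2, h3, Pi.smul_apply, h4]
      simp [hproj, trig, Finset.sum_insert hn]
  filter_upwards [Lp.coeFn_sub (hg.toLp g)
    (∑ n ∈ S, hcoef g n • contL2 (hart n) (continuous_hart n)), hsum, hg.coeFn_toLp] with ξ h1 h2 h3
  rw [h1, Pi.sub_apply, h2, h3]

/-- Pythagoras' identity for the partial Hartley sums. -/
lemma integral_sub_hproj_sq {g : E → ℝ} (hg : MemLp g 2 (volume.restrict Υ))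
    (S : Finset (Fin 3 → ℤ)) :
    ∫ ξ in Υ, (g ξ - hproj S g ξ) ^ 2
      = (∫ ξ in Υ, g ξ ^ 2) - (2 * Real.pi) ^ 3 * ∑ n ∈ S, hcoef g n ^ 2 := by
  have hp : ((2 * Real.pi) ^ 3 : ℝ) ≠ 0 := by positivity
  have hcross : ∫ ξ in Υ, g ξ * hproj S g ξ = (2 * Real.pi) ^ 3 * ∑ n ∈ S, hcoef g n ^ 2 := by
    rw [hproj, integral_mul_trig hg, Finset.mul_sum]
    refine Finset.sum_congr rfl fun n _ => ?_
    rw [hcoef]; field_simp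
  have hself : ∫ ξ in Υ, hproj S g ξ ^ 2 = (2 * Real.pi) ^ 3 * ∑ n ∈ S, hcoef g n ^ 2 := by
    simp only [pow_two (hproj S g _)]
    conv_lhs => rw [hproj]
    rw [integral_mul_trig (memLp_of_continuous (continuous_trig _ _)), Finset.mul_sum]
    refine Finset.sum_congr rfl fun n hn => ?_
    have : ∫ ξ in Υ, trig S (hcoef g) ξ * hart n ξ = hcoef g n * (2 * Real.pi) ^ 3 := by
      simp only [mul_comm (trig S (hcoef g) _)]
      rw [integral_mul_trig (memLp_of_continuous (continuous_hart n))]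
      simp only [integral_hart_mul_hart, mul_ite, mul_zero]
      rw [Finset.sum_ite_eq, if_pos hn]
    rw [this]; ring
  have hi : Integrable (fun ξ => g ξ * hproj S g ξ) (volume.restrict Υ) :=
    hg.integrable_mul (memLp_hproj S g)
  have : ∀ ξ, (g ξ - hproj S g ξ) ^ 2 = g ξ ^ 2 - 2 * (g ξ * hproj S g ξ) + hproj S g ξ ^ 2 :=
    fun ξ => by ring
  simp only [this]
  have h1 : Integrable (fun ξ => g ξ ^ 2 - 2 * (g ξ * hproj S g ξ)) (volume.restrict Υ) :=
    (integrable_sq hg).sub (hi.const_mul 2)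
  rw [integral_add h1 (integrable_sq (memLp_hproj S g)), integral_sub (integrable_sq hg)
    (hi.const_mul 2), integral_const_mul, hcross, hself]
  ring

lemma integral_sub_hproj_sq_le {g : E → ℝ} (hg : MemLp g 2 (volume.restrict Υ))
    (S : Finset (Fin 3 → ℤ)) :
    ∫ ξ in Υ, (g ξ - hproj S g ξ) ^ 2 ≤ ∫ ξ in Υ, g ξ ^ 2 := by
  rw [integral_sub_hproj_sq hg]
  have : 0 ≤ (2 * Real.pi) ^ 3 * ∑ n ∈ S, hcoef g n ^ 2 :=
    mul_nonneg (by positivity) (Finset.sum_nonneg fun n _ => sq_nonneg _)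
  linarith

/-! ### Gaussian integrals -/

/-- The centred Gaussian density of variance `v`. -/
def gauss (v z : ℝ) : ℝ := (√(2 * Real.pi * v))⁻¹ * Real.exp (-z ^ 2 / (2 * v))

lemma gauss_nonneg (v z : ℝ) : 0 ≤ gauss v z := by unfold gauss; positivity

lemma gauss_eq_gaussianPDFReal {v : ℝ} (hv : 0 < v) :
    gauss v = ProbabilityTheory.gaussianPDFReal 0 v.toNNReal := by
  funext z; simp [gauss, ProbabilityTheory.gaussianPDFReal, hv.le]

@[fun_prop]
lemma continuous_gauss (v : ℝ) : Continuous (gauss v) := by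
  unfold gauss; fun_prop

lemma integrable_gauss {v : ℝ} (hv : 0 < v) : Integrable (gauss v) := by
  rw [gauss_eq_gaussianPDFReal hv]
  exact ProbabilityTheory.integrable_gaussianPDFReal _ _

lemma integrable_mul_gauss {v C : ℝ} (hv : 0 < v) {φ : ℝ → ℝ} (hφ : Continuous φ)
    (hC : ∀ z, |φ z| ≤ C) : Integrable (fun z => φ z * gauss v z) :=
  (integrable_gauss hv).bdd_mul (c := C) hφ.aestronglyMeasurable (Eventually.of_forall hC)

lemma gauss_le {v : ℝ} (hv : 0 < v) (z : ℝ) : gauss v z ≤ 2 * gauss (2 * v) z := by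
  have h1 : (√(2 * Real.pi * v))⁻¹ ≤ 2 * (√(2 * Real.pi * (2 * v)))⁻¹ := by
    rw [← div_eq_mul_inv, le_div_iff₀ (by positivity), inv_mul_le_iff₀ (by positivity)]
    rw [Real.sqrt_le_left (by positivity), mul_pow, Real.sq_sqrt (by positivity)]
    nlinarith [Real.pi_pos, mul_pos Real.pi_pos hv]
  have h2 : Real.exp (-z ^ 2 / (2 * v)) ≤ Real.exp (-z ^ 2 / (2 * (2 * v))) := by
    apply Real.exp_le_exp.2
    rw [div_le_div_iff₀ (by positivity) (by positivity)]
    nlinarith [mul_nonneg (sq_nonneg z) hv.le]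
  unfold gauss
  calc _ ≤ 2 * (√(2 * Real.pi * (2 * v)))⁻¹ * Real.exp (-z ^ 2 / (2 * (2 * v))) := by gcongr
    _ = _ := by ring

/-- The derivative of the Gaussian density of variance `v` is controlled by the Gaussian density of
variance `2v`. -/
lemma abs_mul_gauss_le {v : ℝ} (hv : 0 < v) (z : ℝ) :
    |z / v| * gauss v z ≤ 2 / √v * gauss (2 * v) z := by
  have h1 : (√(2 * Real.pi * v))⁻¹ = √2 * (√(2 * Real.pi * (2 * v)))⁻¹ := by
    rw [show 2 * Real.pi * (2 * v) = 2 * (2 * Real.pi * v) by ring,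
      Real.sqrt_mul (by norm_num) (2 * Real.pi * v)]
    field_simp
  have hs : 0 < √v := Real.sqrt_pos.2 hv
  have hsq : √v ^ 2 = v := Real.sq_sqrt hv.le
  set u : ℝ := |z| / √v with hu
  have hu0 : 0 ≤ u := by positivity
  have hz2 : z ^ 2 = u ^ 2 * v := by
    rw [hu, div_pow, hsq, sq_abs]; field_simp
  have h2 : |z / v| = u / √v := by
    rw [abs_div, abs_of_pos hv, hu, div_div, ← pow_two, hsq]
  have h3 : Real.exp (-z ^ 2 / (2 * v))
      = Real.exp (-z ^ 2 / (2 * (2 * v))) * Real.exp (-(u ^ 2 / 4)) := by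
    rw [← Real.exp_add, hz2]
    congr 1
    field_simp
    ring
  -- the elementary inequality `√2 * u ≤ 2 * exp (u² / 4)`
  have h4 : √2 * u * Real.exp (-(u ^ 2 / 4)) ≤ 2 := by
    rw [Real.exp_neg, ← div_eq_mul_inv, div_le_iff₀ (Real.exp_pos _)]
    have h5 := Real.add_one_le_exp (u ^ 2 / 4)
    have h6 : √2 ^ 2 = 2 := Real.sq_sqrt (by norm_num)
    nlinarith [sq_nonneg (√2 - u), sq_nonneg (√2 * u - 2)]
  unfold gauss
  rw [h1, h2, h3]
  calc u / √v * (√2 * (√(2 * Real.pi * (2 * v)))⁻¹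
        * (Real.exp (-z ^ 2 / (2 * (2 * v))) * Real.exp (-(u ^ 2 / 4))))
      = (√2 * u * Real.exp (-(u ^ 2 / 4))) * ((√v)⁻¹ * ((√(2 * Real.pi * (2 * v)))⁻¹
        * Real.exp (-z ^ 2 / (2 * (2 * v))))) := by ring
    _ ≤ 2 * ((√v)⁻¹ * ((√(2 * Real.pi * (2 * v)))⁻¹ * Real.exp (-z ^ 2 / (2 * (2 * v))))) := by
        gcongr
    _ = _ := by ring

lemma hasDerivAt_gauss {v : ℝ} (hv : 0 < v) (z : ℝ) :
    HasDerivAt (gauss v) (-(z / v * gauss v z)) z := by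
  have h1 : HasDerivAt (fun z : ℝ => -z ^ 2 / (2 * v)) (-(z / v)) z := by
    have := ((hasDerivAt_pow 2 z).neg).div_const (2 * v)
    convert! this using 1
    simp; field_simp
  have := (h1.exp).const_mul (√(2 * Real.pi * v))⁻¹
  convert! this using 1
  unfold gauss; ring

lemma integrable_id_mul_gauss {v : ℝ} (hv : 0 < v) : Integrable (fun z => z / v * gauss v z) := by
  refine ((integrable_gauss (v := 2 * v) (by positivity)).const_mul (2 / √v)).mono'
    (by fun_prop) (Eventually.of_forall fun z => ?_)
  rw [norm_mul, Real.norm_eq_abs, Real.norm_of_nonneg (gauss_nonneg _ _)]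
  exact abs_mul_gauss_le hv z

lemma integrable_mul_id_mul_gauss {v C : ℝ} (hv : 0 < v) {φ : ℝ → ℝ} (hφ : Continuous φ)
    (hC : ∀ z, |φ z| ≤ C) : Integrable (fun z => φ z * (z / v * gauss v z)) :=
  (integrable_id_mul_gauss hv).bdd_mul (c := C) hφ.aestronglyMeasurable (Eventually.of_forall hC)

lemma integral_exp_mul_gauss {v : ℝ} (hv : 0 < v) (k : ℝ) :
    ∫ z : ℝ, (gauss v z : ℂ) * Complex.exp (k * z * Complex.I)
      = (Real.exp (-(v * k ^ 2) / 2) : ℝ) := by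
  have h := ProbabilityTheory.charFun_gaussianReal (μ := 0) (v := v.toNNReal) k
  rw [charFun_apply_real, ProbabilityTheory.integral_gaussianReal_eq_integral_smul
    (by simpa using hv)] at h
  rw [gauss_eq_gaussianPDFReal hv]
  simp only [Complex.real_smul] at h
  rw [h]
  push_cast
  congr 1
  simp [hv.le]; ring

lemma integrable_exp_mul_gauss {v : ℝ} (hv : 0 < v) (k : ℝ) :
    Integrable (fun z : ℝ => (gauss v z : ℂ) * Complex.exp (k * z * Complex.I)) := by
  refine (integrable_gauss hv).ofReal.mul_bdd (c := 1) (by fun_prop)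
    (Eventually.of_forall fun z => ?_)
  rw [← Complex.ofReal_mul, Complex.norm_exp_ofReal_mul_I]

lemma integral_cos_mul_gauss {v : ℝ} (hv : 0 < v) (k : ℝ) :
    ∫ z : ℝ, Real.cos (k * z) * gauss v z = Real.exp (-(v * k ^ 2) / 2) := by
  have h := congrArg Complex.re (integral_exp_mul_gauss hv k)
  rw [Complex.ofReal_re] at h
  rw [← h]
  refine Eq.trans ?_ (integral_re (integrable_exp_mul_gauss hv k))
  refine integral_congr_ae (Eventually.of_forall fun z => ?_)
  simp only [RCLike.re_to_complex, Complex.re_ofReal_mul]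
  rw [← Complex.ofReal_mul, Complex.exp_ofReal_mul_I_re, mul_comm]

lemma integral_sin_mul_gauss {v : ℝ} (hv : 0 < v) (k : ℝ) :
    ∫ z : ℝ, Real.sin (k * z) * gauss v z = 0 := by
  have h := congrArg Complex.im (integral_exp_mul_gauss hv k)
  rw [Complex.ofReal_im] at h
  rw [← h]
  refine Eq.trans ?_ (integral_im (integrable_exp_mul_gauss hv k))
  refine integral_congr_ae (Eventually.of_forall fun z => ?_)
  simp only [RCLike.im_to_complex, Complex.im_ofReal_mul]
  rw [← Complex.ofReal_mul, Complex.exp_ofReal_mul_I_im, mul_comm]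

/-- Gaussian integration by parts. -/
lemma integral_mul_id_mul_gauss {v C : ℝ} (hv : 0 < v) {φ φ' : ℝ → ℝ}
    (h : ∀ z, HasDerivAt φ (φ' z) z) (hc : Continuous φ') (hC : ∀ z, |φ z| ≤ C)
    (hC' : ∀ z, |φ' z| ≤ C) :
    ∫ z : ℝ, φ z * (z / v * gauss v z) = ∫ z, φ' z * gauss v z := by
  have hφ : Continuous φ := continuous_iff_continuousAt.2 fun z => (h z).continuousAt
  have h1 := integral_mul_deriv_eq_deriv_mul_of_integrable (u := φ) (v := gauss v) (u' := φ')
    (v' := fun z => -(z / v * gauss v z)) (fun z _ => h z)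
    (fun z _ => hasDerivAt_gauss hv z) (by
      refine (integrable_mul_id_mul_gauss hv hφ hC).neg.congr (Eventually.of_forall fun z => ?_)
      simp) (integrable_mul_gauss hv hc hC') (integrable_mul_gauss hv hφ hC)
  simp only [mul_neg, integral_neg] at h1
  linarith

lemma abs_cos_sin_le (k z : ℝ) : |Real.cos (k * z)| ≤ 1 + |k| ∧ |Real.sin (k * z)| ≤ 1 + |k| :=
  ⟨(Real.abs_cos_le_one _).trans (by simp), (Real.abs_sin_le_one _).trans (by simp)⟩

lemma integral_sin_mul_id_mul_gauss {v : ℝ} (hv : 0 < v) (k : ℝ) :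
    ∫ z : ℝ, Real.sin (k * z) * (z / v * gauss v z) = k * Real.exp (-(v * k ^ 2) / 2) := by
  rw [integral_mul_id_mul_gauss hv (φ' := fun z => k * Real.cos (k * z)) (C := 1 + |k|)
    (fun z => by simpa [mul_comm] using ((hasDerivAt_id z).const_mul k).sin) (by fun_prop)
    (fun z => (abs_cos_sin_le k z).2) (fun z => by
      rw [abs_mul]; nlinarith [Real.abs_cos_le_one (k * z), abs_nonneg k])]
  simp only [mul_assoc]
  rw [integral_const_mul, integral_cos_mul_gauss hv]

lemma integral_cos_mul_id_mul_gauss {v : ℝ} (hv : 0 < v) (k : ℝ) :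
    ∫ z : ℝ, Real.cos (k * z) * (z / v * gauss v z) = 0 := by
  rw [integral_mul_id_mul_gauss hv (φ' := fun z => -k * Real.sin (k * z)) (C := 1 + |k|)
    (fun z => by simpa [mul_comm] using ((hasDerivAt_id z).const_mul k).cos) (by fun_prop)
    (fun z => (abs_cos_sin_le k z).1) (fun z => by
      rw [abs_mul, abs_neg]; nlinarith [Real.abs_sin_le_one (k * z), abs_nonneg k])]
  simp only [mul_assoc]
  rw [integral_const_mul, integral_sin_mul_gauss hv, mul_zero]

/-! ### Heat multipliers -/

/-- The heat flow on Hartley coefficients, run for the time `vᵢ / 2` in the direction `i`. -/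
def heat (v : Fin 3 → ℝ) (a : (Fin 3 → ℤ) → ℝ) (n : Fin 3 → ℤ) : ℝ :=
  Real.exp (-(∑ i, v i * (n i : ℝ) ^ 2) / 2) * a n

lemma heat_add (v w : Fin 3 → ℝ) (a : (Fin 3 → ℤ) → ℝ) : heat (v + w) a = heat v (heat w a) := by
  funext n
  simp only [heat, Pi.add_apply, add_mul, Finset.sum_add_distrib]
  rw [← mul_assoc, ← Real.exp_add]
  congr 2; ring

lemma heat_single (i : Fin 3) (v : ℝ) (a : (Fin 3 → ℤ) → ℝ) (n : Fin 3 → ℤ) :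
    heat (Pi.single i v) a n = Real.exp (-(v * (n i : ℝ) ^ 2) / 2) * a n := by
  simp [heat, Pi.single_apply]

/-- The heat flow in one direction is a Gaussian average. -/
lemma trig_heat_single {v : ℝ} (hv : 0 < v) (i : Fin 3) (S : Finset (Fin 3 → ℤ))
    (a : (Fin 3 → ℤ) → ℝ) (ξ : E) :
    trig S (heat (Pi.single i v) a) ξ = ∫ z : ℝ, trig S a (ξ + z • dir i) * gauss v z := by
  have h1 : ∀ z : ℝ, trig S a (ξ + z • dir i) * gauss v z
      = ∑ n ∈ S, (a n * hart n ξ * (Real.cos (n i * z) * gauss v z)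
          + a n * hart (-n) ξ * (Real.sin (n i * z) * gauss v z)) := fun z => by
    rw [trig, Finset.sum_mul]
    refine Finset.sum_congr rfl fun n _ => ?_
    rw [hart_add_smul_dir]; ring
  have ic : ∀ k : ℝ, Integrable (fun z => Real.cos (k * z) * gauss v z) := fun k =>
    integrable_mul_gauss hv (by fun_prop) fun z => (abs_cos_sin_le k z).1
  have is : ∀ k : ℝ, Integrable (fun z => Real.sin (k * z) * gauss v z) := fun k =>
    integrable_mul_gauss hv (by fun_prop) fun z => (abs_cos_sin_le k z).2
  have hi : ∀ n ∈ S, Integrable (fun z => a n * hart n ξ * (Real.cos (n i * z) * gauss v z)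
      + a n * hart (-n) ξ * (Real.sin (n i * z) * gauss v z)) := fun n _ =>
    ((ic _).const_mul _).add ((is _).const_mul _)
  simp only [h1]
  rw [integral_finsetSum _ hi]
  refine Finset.sum_congr rfl fun n _ => ?_
  rw [integral_add ((ic _).const_mul _) ((is _).const_mul _), integral_const_mul,
    integral_const_mul, integral_cos_mul_gauss hv, integral_sin_mul_gauss hv, heat_single]
  ring

/-- A derivative of the heat flow falls on the Gaussian. -/
lemma trigD_heat_single {v : ℝ} (hv : 0 < v) (i : Fin 3) (S : Finset (Fin 3 → ℤ))
    (a : (Fin 3 → ℤ) → ℝ) (ξ : E) :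
    trigD i S (heat (Pi.single i v) a) ξ
      = ∫ z : ℝ, trig S a (ξ + z • dir i) * (z / v * gauss v z) := by
  have h1 : ∀ z : ℝ, trig S a (ξ + z • dir i) * (z / v * gauss v z)
      = ∑ n ∈ S, (a n * hart n ξ * (Real.cos (n i * z) * (z / v * gauss v z))
          + a n * hart (-n) ξ * (Real.sin (n i * z) * (z / v * gauss v z))) := fun z => by
    rw [trig, Finset.sum_mul]
    refine Finset.sum_congr rfl fun n _ => ?_
    rw [hart_add_smul_dir]; ring
  have ic : ∀ k : ℝ, Integrable (fun z => Real.cos (k * z) * (z / v * gauss v z)) := fun k =>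
    integrable_mul_id_mul_gauss hv (by fun_prop) fun z => (abs_cos_sin_le k z).1
  have is : ∀ k : ℝ, Integrable (fun z => Real.sin (k * z) * (z / v * gauss v z)) := fun k =>
    integrable_mul_id_mul_gauss hv (by fun_prop) fun z => (abs_cos_sin_le k z).2
  have hi : ∀ n ∈ S, Integrable (fun z =>
      a n * hart n ξ * (Real.cos (n i * z) * (z / v * gauss v z))
      + a n * hart (-n) ξ * (Real.sin (n i * z) * (z / v * gauss v z))) := fun n _ =>
    ((ic _).const_mul _).add ((is _).const_mul _)
  simp only [h1]
  rw [integral_finsetSum _ hi]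
  refine Finset.sum_congr rfl fun n _ => ?_
  rw [integral_add ((ic _).const_mul _) ((is _).const_mul _), integral_const_mul,
    integral_const_mul, integral_cos_mul_id_mul_gauss hv, integral_sin_mul_id_mul_gauss hv,
    heat_single]
  ring

lemma abs_trig_le (S : Finset (Fin 3 → ℤ)) (a : (Fin 3 → ℤ) → ℝ) (ξ : E) :
    |trig S a ξ| ≤ ∑ n ∈ S, |a n| * 2 :=
  (Finset.abs_sum_le_sum_abs _ _).trans (Finset.sum_le_sum fun n _ => by
    rw [abs_mul]; exact mul_le_mul_of_nonneg_left (abs_hart_le n ξ) (abs_nonneg _))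

section Positivity

variable {S : Finset (Fin 3 → ℤ)} {a : (Fin 3 → ℤ) → ℝ}

lemma trig_heat_single_nonneg {v : ℝ} (hv : 0 < v) (i : Fin 3) (ha : ∀ ξ, 0 ≤ trig S a ξ) (ξ : E) :
    0 ≤ trig S (heat (Pi.single i v) a) ξ := by
  rw [trig_heat_single hv]
  exact integral_nonneg fun z => mul_nonneg (ha _) (gauss_nonneg _ _)

lemma trig_heat_single_le {v : ℝ} (hv : 0 < v) (i : Fin 3) (ha : ∀ ξ, 0 ≤ trig S a ξ) (ξ : E) :
    trig S (heat (Pi.single i v) a) ξ ≤ 2 * trig S (heat (Pi.single i (2 * v)) a) ξ := by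
  rw [trig_heat_single hv, trig_heat_single (by positivity), ← integral_const_mul]
  refine integral_mono
    (integrable_mul_gauss (φ := fun z => trig S a (ξ + z • dir i)) hv (by fun_prop)
      fun z => abs_trig_le S a _)
    ((integrable_mul_gauss (φ := fun z => trig S a (ξ + z • dir i)) (by positivity) (by fun_prop)
      fun z => abs_trig_le S a _).const_mul 2)
    fun z => ?_
  have := mul_le_mul_of_nonneg_left (gauss_le hv z) (ha (ξ + z • dir i))
  simp only
  linarith

lemma abs_trigD_heat_single_le {v : ℝ} (hv : 0 < v) (i : Fin 3) (ha : ∀ ξ, 0 ≤ trig S a ξ)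
    (ξ : E) : |trigD i S (heat (Pi.single i v) a) ξ|
      ≤ 2 / √v * trig S (heat (Pi.single i (2 * v)) a) ξ := by
  rw [trigD_heat_single hv, trig_heat_single (by positivity), ← integral_const_mul]
  rw [← Real.norm_eq_abs]
  refine norm_integral_le_of_norm_le (g := fun z : ℝ => 2 / √v *
    (trig S a (ξ + z • dir i) * gauss (2 * v) z))
    ((integrable_mul_gauss (φ := fun z => trig S a (ξ + z • dir i)) (by positivity) (by fun_prop)
      fun z => abs_trig_le S a _).const_mul _)
    (Eventually.of_forall fun z => ?_)
  rw [norm_mul, norm_mul, Real.norm_of_nonneg (ha _), Real.norm_of_nonneg (gauss_nonneg _ _),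
    Real.norm_eq_abs]
  have := mul_le_mul_of_nonneg_left (abs_mul_gauss_le hv z) (ha (ξ + z • dir i))
  linarith

lemma heat_comm (v w : Fin 3 → ℝ) : heat v (heat w a) = heat w (heat v a) := by
  rw [← heat_add, ← heat_add, add_comm]

lemma heat_eq_single (v : Fin 3 → ℝ) {i j k : Fin 3} (hij : i ≠ j) (hik : i ≠ k) (hjk : j ≠ k) :
    heat v a
      = heat (Pi.single i (v i)) (heat (Pi.single j (v j)) (heat (Pi.single k (v k)) a)) := by
  rw [← heat_add, ← heat_add]
  congr 1
  funext l
  have : l = i ∨ l = j ∨ l = k := by omega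
  rcases this with rfl | rfl | rfl <;>
    simp [hij, hik, hjk, hij.symm, hik.symm, hjk.symm]

lemma trig_heat_nonneg {v : Fin 3 → ℝ} (hv : ∀ i, 0 < v i) (ha : ∀ ξ, 0 ≤ trig S a ξ) (ξ : E) :
    0 ≤ trig S (heat v a) ξ := by
  rw [heat_eq_single v (i := 0) (j := 1) (k := 2) (by decide) (by decide) (by decide)]
  exact trig_heat_single_nonneg (hv _) _ (trig_heat_single_nonneg (hv _) _
    (trig_heat_single_nonneg (hv _) _ ha)) ξ

/-- Smoothing estimate for the heat flow: a derivative costs half a power of the time, with a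
pointwise bound by the flow at twice the time. In the other two directions the time is doubled by
`gauss_le`, which costs a factor `2` each. -/
lemma abs_trigD_heat_le {v : Fin 3 → ℝ} (hv : ∀ i, 0 < v i) (ha : ∀ ξ, 0 ≤ trig S a ξ)
    (i : Fin 3) (ξ : E) :
    |trigD i S (heat v a) ξ| ≤ 8 / √(v i) * trig S (heat ((2 : ℝ) • v) a) ξ := by
  obtain ⟨j, k, hij, hik, hjk⟩ : ∃ j k : Fin 3, i ≠ j ∧ i ≠ k ∧ j ≠ k := by
    revert i; decide
  have h2 : ∀ l, 0 < 2 * v l := fun l => by linarith [hv l]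
  have e1 : heat ((2 : ℝ) • v) a = heat (Pi.single i (2 * v i)) (heat (Pi.single j (2 * v j))
      (heat (Pi.single k (2 * v k)) a)) := heat_eq_single ((2 : ℝ) • v) hij hik hjk
  rw [heat_eq_single v hij hik hjk, e1]
  have n1 := trig_heat_single_nonneg (hv k) k ha
  have n2 := trig_heat_single_nonneg (hv j) j n1
  refine (abs_trigD_heat_single_le (hv i) i n2 ξ).trans ?_
  have n3 := trig_heat_single_nonneg (h2 i) i n1
  have s1 := trig_heat_single_le (hv j) j n3 ξ
  have n4 := trig_heat_single_nonneg (h2 i) i (trig_heat_single_nonneg (h2 j) j ha)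
  have s2 := trig_heat_single_le (hv k) k n4 ξ
  rw [heat_comm (Pi.single j (v j))] at s1
  rw [heat_comm (Pi.single j (2 * v j)) (Pi.single i (2 * v i)),
    heat_comm (Pi.single j (2 * v j)) (Pi.single k (v k)),
    heat_comm (Pi.single i (2 * v i)) (Pi.single k (v k))] at s1
  rw [heat_comm (Pi.single k (2 * v k)) (Pi.single i (2 * v i)),
    heat_comm (Pi.single k (2 * v k)) (Pi.single j (2 * v j))] at s2
  have hs : 0 ≤ 2 / √(v i) := by positivity
  have := mul_le_mul_of_nonneg_left (s1.trans (mul_le_mul_of_nonneg_left s2 zero_le_two)) hs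
  refine this.trans (le_of_eq ?_)
  ring

lemma integral_trig_heat (v : Fin 3 → ℝ) :
    ∫ ξ in Υ, trig S (heat v a) ξ = ∫ ξ in Υ, trig S a ξ := by
  rw [integral_trig, integral_trig]
  simp [heat]

end Positivity

/-! ### Smoothing in the angle -/

/-- The bound of a Gaussian average of a non-negative periodic function by its integral over a
period: on the `k`-th period the Gaussian is at most a constant times `v^(-1/2) |k + 1/2|^(-2)`,
which is summable over `k`. The shift by `1/2` keeps the denominator away from zero for every
integer. -/
lemma exists_integral_mul_gauss_le : ∃ C : ℝ, 0 ≤ C ∧ ∀ (v : ℝ), 0 < v → v ≤ 20 →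
    ∀ (h : ℝ → ℝ) (B : ℝ), Continuous h → (∀ z, 0 ≤ h z) → (∀ z, h z ≤ B) →
      Function.Periodic h (2 * Real.pi) →
      ∫ z : ℝ, h z * gauss v z ≤ C / √v * ∫ z in I₀, h z := by
  have hsum : Summable fun k : ℤ => 1 / |(k : ℝ) + 1 / 2| ^ (2 : ℝ) :=
    (Real.summable_one_div_int_add_rpow (1 / 2) 2).2 (by norm_num)
  refine ⟨40 * ∑' k : ℤ, 1 / |(k : ℝ) + 1 / 2| ^ (2 : ℝ),
    mul_nonneg (by norm_num) (tsum_nonneg fun k => by positivity), ?_⟩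
  intro v hv hv20 h B hc h0 hB hp
  set s : ℤ → Set ℝ := fun k => Ioc (k • (2 * Real.pi)) ((k + 1) • (2 * Real.pi)) with hs
  have hint : Integrable (fun z => h z * gauss v z) :=
    integrable_mul_gauss (C := B) hv hc fun z => by rw [abs_of_nonneg (h0 z)]; exact hB z
  have hH := hasSum_integral_iUnion (μ := volume) (s := s) (f := fun z => h z * gauss v z)
    (fun k => measurableSet_Ioc) (pairwise_disjoint_Ioc_zsmul (2 * Real.pi))
    hint.integrableOn
  rw [hs, iUnion_Ioc_zsmul two_pi_pos, Measure.restrict_univ] at hH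
  have hper : ∀ k : ℤ, ∫ z in s k, h z = ∫ z in I₀, h z := by
    intro k
    rw [I₀, ← integral_Ioc_eq_integral_Ioo, hs,
      ← intervalIntegral.integral_of_le two_pi_pos.le,
      ← intervalIntegral.integral_of_le (by
        rw [zsmul_eq_mul, zsmul_eq_mul]; push_cast; nlinarith [two_pi_pos])]
    have := hp.intervalIntegral_add_eq (k • (2 * Real.pi)) 0
    rw [zero_add] at this
    rw [← this]
    congr 1
    rw [add_smul, one_smul]
  have hterm : ∀ k : ℤ, ∫ z in s k, h z * gauss v z
      ≤ 1 / |(k : ℝ) + 1 / 2| ^ (2 : ℝ) * (40 / √v * ∫ z in I₀, h z) := by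
    intro k
    have hpt : ∀ z ∈ s k, gauss v z ≤ 1 / |(k : ℝ) + 1 / 2| ^ (2 : ℝ) * (40 / √v) := by
      intro z hz
      rw [hs] at hz
      simp only [zsmul_eq_mul, mem_Ioc] at hz
      push_cast at hz
      have e1 : (√(2 * Real.pi * v))⁻¹ ≤ 1 / √v := by
        rw [one_div]
        gcongr
        nlinarith [Real.pi_gt_three]
      have e2 : Real.exp (-z ^ 2 / (2 * v)) ≤ 40 * (1 / |(k : ℝ) + 1 / 2| ^ (2 : ℝ)) := by
        have hk : (0 : ℝ) < ((k : ℝ) + 1 / 2) ^ 2 := by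
          have : (k : ℝ) + 1 / 2 ≠ 0 := by
            intro hk
            have h3 : (2 * k + 1 : ℝ) = 0 := by linarith
            have h4 : 2 * k + 1 = 0 := by exact_mod_cast h3
            omega
          positivity
        -- here `v ≤ 20` enters
        have e3 : Real.exp (-z ^ 2 / (2 * v)) ≤ Real.exp (-(z ^ 2 / 40)) := by
          apply Real.exp_le_exp.2
          rw [neg_div, neg_le_neg_iff]
          gcongr
          linarith
        have e4 : Real.exp (-(z ^ 2 / 40)) ≤ 1 / (z ^ 2 / 40 + 1) := by
          rw [Real.exp_neg, ← one_div]
          exact one_div_le_one_div_of_le (by positivity) (Real.add_one_le_exp _)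
        -- `|k + 1/2| ≤ |z| / (2π) + 1/2` on the `k`-th interval; only `2π ≥ 6` is used
        have e5 : ((k : ℝ) + 1 / 2) ^ 2 ≤ z ^ 2 + 1 := by
          have hpi := Real.pi_gt_three
          set y := (k : ℝ) + 1 / 2 with hy
          have a1 : 2 * Real.pi * y - Real.pi ≤ z := by rw [hy]; linarith [hz.1]
          have a2 : z ≤ 2 * Real.pi * y + Real.pi := by rw [hy]; linarith [hz.2]
          rcases le_total 0 y with hy0 | hy0
          · rcases le_total y (1 / 2) with hy1 | hy1
            · nlinarith [sq_nonneg z]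
            · have b1 : y ≤ z / 6 + 1 / 2 := by nlinarith
              have b2 := pow_le_pow_left₀ hy0 b1 2
              nlinarith [sq_nonneg (z - 1)]
          · rcases le_total (-(1 / 2)) y with hy1 | hy1
            · nlinarith [sq_nonneg z]
            · have b1 : -y ≤ -z / 6 + 1 / 2 := by nlinarith
              have b2 := pow_le_pow_left₀ (neg_nonneg.2 hy0) b1 2
              nlinarith [sq_nonneg (z + 1)]
        rw [Real.rpow_two, sq_abs]
        refine e3.trans (e4.trans ?_)
        rw [mul_one_div, div_le_div_iff₀ (by positivity) hk]
        nlinarith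
      calc gauss v z ≤ 1 / √v * (40 * (1 / |(k : ℝ) + 1 / 2| ^ (2 : ℝ))) := by
            unfold gauss; gcongr
        _ = _ := by ring
    calc ∫ z in s k, h z * gauss v z
        ≤ ∫ z in s k, h z * (1 / |(k : ℝ) + 1 / 2| ^ (2 : ℝ) * (40 / √v)) := by
          refine setIntegral_mono_on hint.integrableOn ?_ measurableSet_Ioc fun z hz =>
            mul_le_mul_of_nonneg_left (hpt z hz) (h0 z)
          exact ((hc.integrableOn_Icc).mono_set Ioc_subset_Icc_self).mul_const _
      _ = _ := by rw [integral_mul_const, hper]; ring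
  rw [← hH.tsum_eq]
  refine (hH.summable.tsum_le_tsum hterm (hsum.mul_right _)).trans (le_of_eq ?_)
  rw [tsum_mul_right]; ring

/-- `C` is an admissible constant in the smoothing estimate for the heat flow in the angle: a
supremum in `θ` is bounded by `C / √v` times an integral in `θ`. The rate is that of the heat flow
on the line, which on the circle holds for bounded `v` only; the bootstrap over windows of unit
length in time does not go beyond `v = 20`. -/
def IsAngleBound (C : ℝ) : Prop :=
  ∀ (v : ℝ), 0 < v → v ≤ 20 →
    ∀ (S : Finset (Fin 3 → ℤ)) (a : (Fin 3 → ℤ) → ℝ), (∀ ξ, 0 ≤ trig S a ξ) →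
      ∀ (x : ℝ × ℝ) (θ : ℝ), trig S (heat (Pi.single 2 v) a) (x, θ)
        ≤ C / √v * ∫ z in I₀, trig S a (x, z)

lemma exists_isAngleBound : ∃ C : ℝ, 0 ≤ C ∧ IsAngleBound C := by
  obtain ⟨C, hC0, hC⟩ := exists_integral_mul_gauss_le
  refine ⟨C, hC0, fun v hv hv20 S a ha ⟨x₁, x₂⟩ θ => ?_⟩
  set x : ℝ × ℝ := (x₁, x₂) with hx
  have hcont : Continuous fun z : ℝ => trig S a (x, z) := by fun_prop
  have hper : Function.Periodic (fun z : ℝ => trig S a (x, z)) (2 * Real.pi) := fun z => by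
    have := isPer_trig S a 2 (x, z)
    simpa [dir, hx] using this
  have h := hC v hv hv20 (fun z => trig S a (x, θ + z)) (∑ n ∈ S, |a n| * 2) (by fun_prop)
    (fun z => ha _) (fun z => (le_abs_self _).trans (abs_trig_le S a _))
    (fun z => by simpa [add_assoc] using hper (θ + z))
  have e : ∫ z in I₀, trig S a (x, θ + z) = ∫ z in I₀, trig S a (x, z) := by
    rw [I₀, ← integral_Ioc_eq_integral_Ioo, ← integral_Ioc_eq_integral_Ioo,
      ← intervalIntegral.integral_of_le two_pi_pos.le,
      ← intervalIntegral.integral_of_le two_pi_pos.le,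
      intervalIntegral.integral_comp_add_left (fun z => trig S a (x, z)), add_zero]
    simpa using hper.intervalIntegral_add_eq θ 0
  rw [e] at h
  rw [trig_heat_single hv]
  refine le_trans (le_of_eq ?_) h
  refine integral_congr_ae (Eventually.of_forall fun z => ?_)
  simp [dir, hx]

/-! ### Weak derivatives in time -/

/-- Smooth functions with compact support in `(0, T)`. -/
def IsTimeTest (T : ℝ) (η : ℝ → ℝ) : Prop :=
  ContDiff ℝ (⊤ : ℕ∞) η ∧ HasCompactSupport η ∧ tsupport η ⊆ Ioo 0 T

namespace IsTimeTest

variable {T : ℝ} {η ζ : ℝ → ℝ}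

lemma continuous (h : IsTimeTest T η) : Continuous η := h.1.continuous

lemma continuous_deriv (h : IsTimeTest T η) : Continuous (deriv η) :=
  h.1.continuous_deriv (by simp)

lemma hasDerivAt (h : IsTimeTest T η) (t : ℝ) : HasDerivAt η (deriv η t) t :=
  ((h.1.differentiable (by simp)) t).hasDerivAt

lemma eq_zero (h : IsTimeTest T η) {t : ℝ} (ht : t ∉ Ioo 0 T) : η t = 0 :=
  image_eq_zero_of_notMem_tsupport fun h1 => ht (h.2.2 h1)

lemma sub_smul (hη : IsTimeTest T η) (hζ : IsTimeTest T ζ) (c : ℝ) :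
    IsTimeTest T (fun t => η t - c * ζ t) := by
  have hs : tsupport (fun t => η t - c * ζ t) ⊆ tsupport η ∪ tsupport ζ := by
    refine closure_minimal (fun t ht => ?_) ((isClosed_tsupport η).union (isClosed_tsupport ζ))
    by_contra hcon
    rw [mem_union, not_or] at hcon
    exact ht (by simp [image_eq_zero_of_notMem_tsupport hcon.1,
      image_eq_zero_of_notMem_tsupport hcon.2])
  exact ⟨hη.1.sub (contDiff_const.mul hζ.1),
    (hη.2.1.isCompact.union hζ.2.1.isCompact).of_isClosed_subset (isClosed_tsupport _) hs,
    hs.trans (union_subset hη.2.2 hζ.2.2)⟩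

lemma mul_left (hη : IsTimeTest T η) (hζ : ContDiff ℝ (⊤ : ℕ∞) ζ) :
    IsTimeTest T (fun t => ζ t * η t) :=
  ⟨hζ.mul hη.1, hη.2.1.mul_left, (tsupport_mul_subset_right).trans hη.2.2⟩

/-- A test function of integral zero is the derivative of a test function. -/
lemma exists_primitive (hT : 0 < T) (h : IsTimeTest T η) (h0 : ∫ t in Ioo 0 T, η t = 0) :
    ∃ ζ, IsTimeTest T ζ ∧ deriv ζ = η := by
  have hd : ∀ t, HasDerivAt (fun t => ∫ r in (0 : ℝ)..t, η r) (η t) t := fun t =>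
    intervalIntegral.integral_hasDerivAt_right (h.continuous.intervalIntegrable _ _)
      h.continuous.stronglyMeasurable.stronglyMeasurableAtFilter h.continuous.continuousAt
  have hde : deriv (fun t => ∫ r in (0 : ℝ)..t, η r) = η := funext fun t => (hd t).deriv
  rw [← integral_Ioc_eq_integral_Ioo, ← intervalIntegral.integral_of_le hT.le] at h0
  -- the primitive vanishes outside any `[a, b] ⊆ (0, T)` containing the support
  obtain ⟨a, b, ha, hb, hab⟩ : ∃ a b, 0 < a ∧ b < T ∧ tsupport η ⊆ Icc a b := by
    rcases (tsupport η).eq_empty_or_nonempty with he | hne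
    · exact ⟨T, 0, hT, hT, by simp [he]⟩
    · obtain ⟨a, ha, ha'⟩ := h.2.1.isCompact.exists_isLeast hne
      obtain ⟨b, hb, hb'⟩ := h.2.1.isCompact.exists_isGreatest hne
      exact ⟨a, b, (h.2.2 ha).1, (h.2.2 hb).2, fun t ht => ⟨ha' ht, hb' ht⟩⟩
  have hz : ∀ t, t ∉ Icc a b → η t = 0 := fun t ht =>
    image_eq_zero_of_notMem_tsupport fun h1 => ht (hab h1)
  have hsupp : tsupport (fun t => ∫ r in (0 : ℝ)..t, η r) ⊆ Icc a b := by
    refine closure_minimal (fun t ht => ?_) isClosed_Icc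
    by_contra hcon
    refine ht ?_
    rw [mem_Icc, not_and_or, not_le, not_le] at hcon
    rcases hcon with hc | hc
    · refine (intervalIntegral.integral_congr (g := fun _ => (0 : ℝ)) fun r hr => ?_).trans
        (by simp)
      refine hz r fun hr' => ?_
      have h3 : r ≤ max 0 t := hr.2
      have h4 : max 0 t < a := max_lt ha hc
      linarith [hr'.1]
    · have h5 : ∫ r in t..T, η r = 0 := by
        refine (intervalIntegral.integral_congr (g := fun _ => (0 : ℝ)) fun r hr => ?_).trans
          (by simp)
        refine hz r fun hr' => ?_
        have h3 : min t T ≤ r := hr.1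
        have h4 : b < min t T := lt_min hc hb
        linarith [hr'.2]
      have h6 := intervalIntegral.integral_add_adjacent_intervals
        (h.continuous.intervalIntegrable (μ := volume) 0 t)
        (h.continuous.intervalIntegrable (μ := volume) t T)
      change ∫ r in (0 : ℝ)..t, η r = 0
      linarith
  refine ⟨_, ⟨contDiff_infty_iff_deriv.2 ⟨fun t => (hd t).differentiableAt, ?_⟩,
    isCompact_Icc.of_isClosed_subset (isClosed_tsupport _) hsupp,
    hsupp.trans fun t ht => ⟨ha.trans_le ht.1, ht.2.trans_lt hb⟩⟩, hde⟩
  rw [hde]; exact h.1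

lemma exists_integral_eq_one (hT : 0 < T) : ∃ η, IsTimeTest T η ∧ ∫ t in Ioo 0 T, η t = 1 := by
  let φ : ContDiffBump (T / 2 : ℝ) := ⟨T / 8, T / 4, by linarith, by linarith⟩
  have hts : tsupport (φ.normed volume) ⊆ Ioo 0 T := by
    rw [φ.tsupport_normed_eq, Real.closedBall_eq_Icc]
    intro t ht
    simp only [φ, mem_Icc] at ht
    exact ⟨by linarith [ht.1], by linarith [ht.2]⟩
  refine ⟨φ.normed volume, ⟨φ.contDiff_normed, φ.hasCompactSupport_normed, hts⟩, ?_⟩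
  rw [← φ.integral_normed (μ := volume)]
  refine setIntegral_eq_integral_of_forall_compl_eq_zero fun t ht => ?_
  exact image_eq_zero_of_notMem_tsupport fun h1 => ht (hts h1)

lemma integrable_mul {w : ℝ → ℝ} (h : Continuous η) (hw : IntegrableOn w (Ioo 0 T)) :
    IntegrableOn (fun t => w t * η t) (Ioo 0 T) := by
  obtain ⟨K, hK⟩ := (isCompact_Icc (a := (0 : ℝ)) (b := T)).exists_bound_of_continuousOn
    h.continuousOn
  refine hw.mul_bdd (c := K) h.aestronglyMeasurable ?_
  filter_upwards [ae_restrict_mem measurableSet_Ioo] with t ht using hK t ⟨ht.1.le, ht.2.le⟩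

end IsTimeTest

lemma integrableOn_Ioo_of_continuousOn {T : ℝ} {u : ℝ → ℝ} (hu : ContinuousOn u (Icc 0 T)) :
    IntegrableOn u (Ioo 0 T) := (hu.integrableOn_Icc).mono_set Ioo_subset_Icc_self

lemma intervalIntegrable_of_integrableOn_Ioo {T : ℝ} (hT : 0 < T) {v : ℝ → ℝ}
    (hv : IntegrableOn v (Ioo 0 T)) {s t : ℝ} (hs : s ∈ Icc 0 T) (ht : t ∈ Icc 0 T) :
    IntervalIntegrable v volume s t := by
  have h : IntervalIntegrable v volume 0 T := by
    rw [intervalIntegrable_iff_integrableOn_Ioo_of_le hT.le]; exact hv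
  refine h.mono_set ?_
  rw [uIcc_of_le hT.le]
  exact ordConnected_Icc.uIcc_subset hs ht

/-- A continuous function with an integrable weak derivative is the integral of it. -/
lemma sub_eq_integral_of_weak_deriv {T : ℝ} (hT : 0 < T) {u v : ℝ → ℝ}
    (hu : ContinuousOn u (Icc 0 T)) (hv : IntegrableOn v (Ioo 0 T))
    (h : ∀ η, IsTimeTest T η → ∫ t in Ioo 0 T, v t * η t = -∫ t in Ioo 0 T, u t * deriv η t)
    {s t : ℝ} (hs : s ∈ Icc 0 T) (ht : t ∈ Icc 0 T) : u t - u s = ∫ r in s..t, v r := by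
  have h0T : (0 : ℝ) ∈ Icc 0 T := ⟨le_rfl, hT.le⟩
  have hTT : T ∈ Icc 0 T := ⟨hT.le, le_rfl⟩
  have hvi : IntervalIntegrable v volume 0 T :=
    intervalIntegrable_of_integrableOn_Ioo hT hv h0T hTT
  set V : ℝ → ℝ := fun t => ∫ r in (0 : ℝ)..t, v r with hV
  have hVac : AbsolutelyContinuousOnInterval V 0 T :=
    hvi.absolutelyContinuousOnInterval_intervalIntegral (by rw [uIcc_of_le hT.le]; exact h0T)
  have hVc : ContinuousOn V (Icc 0 T) := by
    have := hVac.continuousOn; rwa [uIcc_of_le hT.le] at this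
  -- `u - V` has vanishing weak derivative, so it is constant
  have hparts : ∀ η, IsTimeTest T η →
      ∫ t in Ioo 0 T, v t * η t = -∫ t in Ioo 0 T, V t * deriv η t := by
    intro η hη
    have hηac : AbsolutelyContinuousOnInterval η 0 T :=
      (hη.1.contDiffOn.of_le (by simp)).absolutelyContinuousOnInterval
    have h1 := hVac.integral_mul_deriv_eq_deriv_mul hηac
    have e0 : η 0 = 0 := hη.eq_zero (by simp)
    have eT : η T = 0 := hη.eq_zero (by simp)
    have h2 : ∫ t in (0 : ℝ)..T, deriv V t * η t = ∫ t in (0 : ℝ)..T, v t * η t := by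
      refine intervalIntegral.integral_congr_ae ?_
      filter_upwards [hvi.ae_hasDerivAt_integral] with t h3 h4
      rw [uIoc_of_le hT.le] at h4
      have h5 : t ∈ uIcc 0 T := by rw [uIcc_of_le hT.le]; exact ⟨h4.1.le, h4.2⟩
      rw [(h3 h5 0 (by rw [uIcc_of_le hT.le]; exact h0T)).deriv]
    rw [h2, e0, eT, intervalIntegral.integral_of_le hT.le, intervalIntegral.integral_of_le hT.le,
      integral_Ioc_eq_integral_Ioo, integral_Ioc_eq_integral_Ioo] at h1
    linarith
  have hwc : ContinuousOn (fun t => u t - V t) (Icc 0 T) := hu.sub hVc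
  have hwi := integrableOn_Ioo_of_continuousOn hwc
  have hw : ∀ η, IsTimeTest T η → ∫ t in Ioo 0 T, (u t - V t) * deriv η t = 0 := by
    intro η hη
    have h1 := h η hη
    rw [hparts η hη, neg_inj] at h1
    simp only [sub_mul]
    rw [integral_sub (IsTimeTest.integrable_mul hη.continuous_deriv
      (integrableOn_Ioo_of_continuousOn hu)) (IsTimeTest.integrable_mul hη.continuous_deriv
      (integrableOn_Ioo_of_continuousOn hVc)), h1, sub_self]
  obtain ⟨θ, hθ, hθ1⟩ := IsTimeTest.exists_integral_eq_one hT
  set c := ∫ t in Ioo 0 T, (u t - V t) * θ t with hc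
  have hconst : ∀ᵐ t, t ∈ Ioo 0 T → u t - V t - c = 0 := by
    refine isOpen_Ioo.ae_eq_zero_of_integral_contDiff_smul_eq_zero
      (hwi.sub (integrableOn_const (by simp))).locallyIntegrableOn fun g g1 g2 g3 => ?_
    have hg : IsTimeTest T g := ⟨g1, g2, g3⟩
    have hcont : ∀ φ : ℝ → ℝ, Continuous φ → IntegrableOn φ (Ioo 0 T) := fun φ hφ =>
      integrableOn_Ioo_of_continuousOn hφ.continuousOn
    obtain ⟨ζ, hζ, hζ'⟩ := (hg.sub_smul hθ (∫ t in Ioo 0 T, g t)).exists_primitive hT (by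
      rw [integral_sub (hcont _ hg.continuous) ((hcont _ hθ.continuous).const_mul _),
        integral_const_mul, hθ1, mul_one, sub_self])
    have h1 := hw ζ hζ
    rw [hζ'] at h1
    have e1 : ∀ t, (u t - V t) * (g t - (∫ t in Ioo 0 T, g t) * θ t)
        = (u t - V t) * g t - (∫ t in Ioo 0 T, g t) * ((u t - V t) * θ t) := fun t => by ring
    simp only [e1] at h1
    rw [integral_sub (IsTimeTest.integrable_mul hg.continuous hwi)
      ((IsTimeTest.integrable_mul hθ.continuous hwi).const_mul _), integral_const_mul, ← hc] at h1
    rw [← setIntegral_eq_integral_of_forall_compl_eq_zero (s := Ioo 0 T) fun t ht => by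
      rw [hg.eq_zero ht, zero_smul]]
    have e2 : ∀ t, g t • (u t - V t - c) = (u t - V t) * g t - g t * c := fun t => by
      rw [smul_eq_mul]; ring
    simp only [e2]
    rw [integral_sub (IsTimeTest.integrable_mul hg.continuous hwi)
      ((hcont _ hg.continuous).mul_const _), integral_mul_const]
    linarith
  have hall : EqOn (fun t => u t - V t) (fun _ => c) (Icc 0 T) := by
    refine Measure.eqOn_Icc_of_ae_eq volume hT.ne ?_ hwc continuousOn_const
    rw [← restrict_Ioo_eq_restrict_Icc, Filter.EventuallyEq, ae_restrict_iff' measurableSet_Ioo]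
    filter_upwards [hconst] with t h1 h2 using sub_eq_zero.1 (h1 h2)
  have h1 : u s - V s = c := hall hs
  have h2 : u t - V t = c := hall ht
  have h3 : V t - V s = ∫ r in s..t, v r :=
    intervalIntegral.integral_interval_sub_left
      (intervalIntegrable_of_integrableOn_Ioo hT hv h0T ht)
      (intervalIntegrable_of_integrableOn_Ioo hT hv h0T hs)
  linarith

/-! ### The flux and the equations for the Hartley coefficients -/

/-- The components of the drift direction `(cos θ, sin θ, 0)` in the space-angle variable. -/
def ang (i : Fin 3) (θ : ℝ) : ℝ := ![Real.cos θ, Real.sin θ, 0] i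

/-- The components of the drift flux `(1 - ρ) f e(θ)`. -/
def flux (f : ℝ → E → ℝ) (i : Fin 3) (t : ℝ) (ξ : E) : ℝ :=
  (1 - density (f t) ξ.1) * f t ξ * ang i ξ.2

/-- The unnormalized Hartley coefficient of `f(t)`. -/
def hmoment (f : ℝ → E → ℝ) (n : Fin 3 → ℤ) (t : ℝ) : ℝ := ∫ ξ in Υ, f t ξ * hart n ξ

/-- The contribution of the flux to the evolution of the Hartley coefficients. -/
def drift (f : ℝ → E → ℝ) (n : Fin 3 → ℤ) (t : ℝ) : ℝ :=
  ∑ i, n i * ∫ ξ in Υ, flux f i t ξ * hart (-n) ξ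

/-- The diagonal of the diffusion matrix. -/
def diffusivity (De : ℝ) : Fin 3 → ℝ := ![De, De, 1]

/-- The decay rate of the frequency `n` under the diffusion. -/
def decay (De : ℝ) (n : Fin 3 → ℤ) : ℝ := ∑ i, diffusivity De i * (n i : ℝ) ^ 2

@[fun_prop]
lemma continuous_ang (i : Fin 3) : Continuous (ang i) := by
  fin_cases i
  exacts [Real.continuous_cos, Real.continuous_sin, continuous_const]

lemma abs_ang_le (i : Fin 3) (θ : ℝ) : |ang i θ| ≤ 1 := by
  fin_cases i <;> simp [ang, Real.abs_cos_le_one, Real.abs_sin_le_one]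

lemma sum_ang_sq (θ : ℝ) : ∑ i, ang i θ ^ 2 = 1 := by
  simp [ang, Fin.sum_univ_three]

lemma IsContL2.memLp {T : ℝ} {f : ℝ → E → ℝ} (hf : IsContL2 T f) {t : ℝ} (ht : t ∈ Icc 0 T) :
    MemLp (f t) 2 (volume.restrict Υ) :=
  (hf.memLpPer t ht).2

open Classical in
/-- `f(t)` as an element of `L²`, and zero at times at which it is not square integrable. -/
def toL2 (f : ℝ → E → ℝ) (t : ℝ) : L2 :=
  if h : MemLp (f t) 2 (volume.restrict Υ) then h.toLp (f t) else 0

lemma coeFn_toL2 {f : ℝ → E → ℝ} {t : ℝ} (h : MemLp (f t) 2 (volume.restrict Υ)) :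
    toL2 f t =ᵐ[volume.restrict Υ] f t := by
  rw [toL2, dif_pos h]; exact h.coeFn_toLp

lemma IsContL2.continuousOn_toL2 {T : ℝ} {f : ℝ → E → ℝ} (hf : IsContL2 T f) :
    ContinuousOn (toL2 f) (Icc 0 T) := by
  intro t ht
  refine (Lp.tendsto_Lp_iff_tendsto_eLpNorm' (toL2 f) (toL2 f t)).2 ?_
  refine (hf.continuous t ht).congr' ?_
  filter_upwards [self_mem_nhdsWithin] with s hs
  refine eLpNorm_congr_ae ?_
  filter_upwards [coeFn_toL2 (hf.memLp hs), coeFn_toL2 (hf.memLp ht)] with ξ h1 h2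
  simp [h1, h2]

lemma IsContL2.integral_sq_eq {T : ℝ} {f : ℝ → E → ℝ} (hf : IsContL2 T f) {t : ℝ}
    (ht : t ∈ Icc 0 T) : ∫ ξ in Υ, f t ξ ^ 2 = ‖toL2 f t‖ ^ 2 := by
  rw [norm_sq_L2]
  refine integral_congr_ae ?_
  filter_upwards [coeFn_toL2 (hf.memLp ht)] with ξ h1
  rw [h1]

lemma IsContL2.exists_bound {T : ℝ} {f : ℝ → E → ℝ} (hf : IsContL2 T f) :
    ∃ R, 0 ≤ R ∧ ∀ t ∈ Icc 0 T, ∫ ξ in Υ, f t ξ ^ 2 ≤ R ^ 2 := by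
  obtain ⟨R, hR⟩ := isCompact_Icc.exists_bound_of_continuousOn hf.continuousOn_toL2
  refine ⟨max R 0, le_max_right _ _, fun t ht => ?_⟩
  rw [hf.integral_sq_eq ht]
  exact pow_le_pow_left₀ (norm_nonneg _) ((hR t ht).trans (le_max_left _ _)) 2

/-- Pairings of a continuous curve in `L²` with continuous functions are continuous. -/
lemma IsContL2.continuousOn_integral_mul {T : ℝ} {f : ℝ → E → ℝ} (hf : IsContL2 T f) {ψ : E → ℝ}
    (hψ : Continuous ψ) : ContinuousOn (fun t => ∫ ξ in Υ, f t ξ * ψ ξ) (Icc 0 T) := by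
  have h : ContinuousOn (fun t => inner ℝ (contL2 ψ hψ) (toL2 f t)) (Icc 0 T) :=
    continuousOn_const.inner hf.continuousOn_toL2
  refine h.congr fun t ht => ?_
  simp only [L2.inner_def]
  refine integral_congr_ae ?_
  filter_upwards [coeFn_toL2 (hf.memLp ht), coeFn_contL2 ψ hψ] with ξ h1 h2
  simp [h1, h2]

/-- A bound in `L²` controls the pairing with a bounded function. -/
lemma abs_integral_mul_le {g ψ : E → ℝ} {R B : ℝ} (hg : MemLp g 2 (volume.restrict Υ))
    (hR : ∫ ξ in Υ, g ξ ^ 2 ≤ R ^ 2) (hB : ∀ ξ, |ψ ξ| ≤ B) :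
    |∫ ξ in Υ, g ξ * ψ ξ| ≤ B * (R ^ 2 + (2 * Real.pi) ^ 3) := by
  have hB0 : 0 ≤ B := (abs_nonneg _).trans (hB 0)
  have hi : Integrable (fun ξ => B * (g ξ ^ 2 + 1)) (volume.restrict Υ) :=
    ((integrable_sq hg).add (integrable_const 1)).const_mul B
  have h1 := norm_integral_le_of_norm_le hi (f := fun ξ => g ξ * ψ ξ)
    (Eventually.of_forall fun ξ => by
      rw [norm_mul, mul_comm, Real.norm_eq_abs, Real.norm_eq_abs]
      refine mul_le_mul (hB ξ) ?_ (abs_nonneg _) hB0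
      nlinarith [sq_abs (g ξ), sq_nonneg (|g ξ| - 1)])
  rw [integral_const_mul, integral_add (integrable_sq hg) (integrable_const 1)] at h1
  simp only [integral_const, volume_real_Υ, smul_eq_mul, mul_one] at h1
  rw [← Real.norm_eq_abs]
  exact h1.trans (by gcongr)

section Weak

variable {Pe De T : ℝ} {f₀ : E → ℝ} {f : ℝ → E → ℝ}

lemma prod_restrict_time (T : ℝ) (s : Set E) : (volume.restrict (Ioo (0 : ℝ) T ×ˢ s))
    = (volume.restrict (Ioo 0 T)).prod (volume.restrict s) := by
  rw [Measure.prod_restrict]; rfl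

lemma IsWeakSolution.ae_density (W : IsWeakSolution Pe De T f₀ f) :
    ∀ᵐ t ∂(volume.restrict (Ioo 0 T)), ∀ᵐ x ∂(volume.restrict Ω),
      density (f t) x ∈ Icc (0 : ℝ) 1 := by
  have h := W.density_mem
  rw [Measure.volume_eq_prod, ← Measure.prod_restrict] at h
  exact Measure.ae_ae_of_ae_prod h

/-- A property of almost every `x ∈ Ω` holds for almost every `(x, θ) ∈ Υ`. -/
lemma ae_Υ_of_ae_Ω {p : ℝ × ℝ → Prop} (h : ∀ᵐ x ∂(volume.restrict Ω), p x) :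
    ∀ᵐ ξ ∂(volume.restrict Υ), p ξ.1 := by
  rw [restrict_Υ]
  exact Measure.quasiMeasurePreserving_fst.ae h

lemma IsContL2.aestronglyMeasurable_density (hf : IsContL2 T f) :
    AEStronglyMeasurable (fun p : ℝ × E => density (f p.1) p.2.1)
      ((volume.restrict (Ioo 0 T)).prod (volume.restrict Υ)) := by
  have h1 := hf.aestronglyMeasurable
  rw [prod_restrict_time, restrict_Υ] at h1
  have h2 := (h1.comp_measurePreserving (measurePreserving_prodAssoc (volume.restrict (Ioo 0 T))
    (volume.restrict Ω) (volume.restrict I₀))).integral_prod_right'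
  have h3 : Measure.QuasiMeasurePreserving (fun p : ℝ × E => (p.1, p.2.1))
      ((volume.restrict (Ioo 0 T)).prod (volume.restrict Υ))
      ((volume.restrict (Ioo 0 T)).prod (volume.restrict Ω)) := by
    rw [restrict_Υ]
    exact (Measure.quasiMeasurePreserving_fst (ν := volume.restrict I₀)).comp
      (measurePreserving_prodAssoc (volume.restrict (Ioo 0 T))
        (volume.restrict Ω) (volume.restrict I₀)).symm.quasiMeasurePreserving
  exact h2.comp_quasiMeasurePreserving h3

lemma IsContL2.aestronglyMeasurable_flux (hf : IsContL2 T f) (i : Fin 3) :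
    AEStronglyMeasurable (fun p : ℝ × E => flux f i p.1 p.2)
      ((volume.restrict (Ioo 0 T)).prod (volume.restrict Υ)) := by
  have h1 := hf.aestronglyMeasurable
  rw [prod_restrict_time] at h1
  have h3 : Continuous fun p : ℝ × E => ang i p.2.2 := by fun_prop
  exact ((aestronglyMeasurable_const.sub hf.aestronglyMeasurable_density).mul h1).mul
    h3.aestronglyMeasurable

/-- The flux is pointwise dominated by the solution. -/
lemma IsWeakSolution.ae_flux (W : IsWeakSolution Pe De T f₀ f) :
    ∀ᵐ t ∂(volume.restrict (Ioo 0 T)),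
      (∀ᵐ ξ ∂(volume.restrict Υ), ∀ i, |flux f i t ξ| ≤ |f t ξ|) ∧
      (∀ᵐ ξ ∂(volume.restrict Υ), ∑ i, flux f i t ξ ^ 2 ≤ f t ξ ^ 2) ∧
      ∀ i, MemLp (flux f i t) 2 (volume.restrict Υ) := by
  have hm : ∀ᵐ t ∂(volume.restrict (Ioo 0 T)), ∀ i,
      AEStronglyMeasurable (flux f i t) (volume.restrict Υ) :=
    ae_all_iff.2 fun i => (W.contL2.aestronglyMeasurable_flux i).prodMk_left
  filter_upwards [W.ae_density, hm, ae_restrict_mem measurableSet_Ioo] with t h1 h2 ht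
  have h3 : ∀ᵐ ξ ∂(volume.restrict Υ), ∀ i, |flux f i t ξ| ≤ |f t ξ| := by
    filter_upwards [ae_Υ_of_ae_Ω h1] with ξ hξ i
    rw [flux, abs_mul, abs_mul, mul_right_comm]
    have a1 : |1 - density (f t) ξ.1| ≤ 1 := abs_le.2 ⟨by linarith [hξ.2], by linarith [hξ.1]⟩
    exact mul_le_of_le_one_left (abs_nonneg _)
      (mul_le_one₀ a1 (abs_nonneg _) (abs_ang_le _ _))
  refine ⟨h3, ?_, fun i => ?_⟩
  · filter_upwards [ae_Υ_of_ae_Ω h1] with ξ hξ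
    have e : ∑ i, flux f i t ξ ^ 2 = (1 - density (f t) ξ.1) ^ 2 * f t ξ ^ 2 := by
      have : ∀ i, flux f i t ξ ^ 2
          = (1 - density (f t) ξ.1) ^ 2 * f t ξ ^ 2 * ang i ξ.2 ^ 2 := fun i => by
        rw [flux]; ring
      rw [Finset.sum_congr rfl fun i _ => this i, ← Finset.mul_sum, sum_ang_sq, mul_one]
    rw [e]
    exact mul_le_of_le_one_left (sq_nonneg _) (pow_le_one₀ (by linarith [hξ.2])
      (by linarith [hξ.1]))
  · refine (W.contL2.memLp ⟨ht.1.le, ht.2.le⟩).mono (h2 i) ?_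
    filter_upwards [h3] with ξ h using h i

lemma integral_sq_flux_le {t R : ℝ} {i : Fin 3}
    (hf : MemLp (f t) 2 (volume.restrict Υ)) (hR : ∫ ξ in Υ, f t ξ ^ 2 ≤ R ^ 2)
    (h3 : ∀ᵐ ξ ∂(volume.restrict Υ), ∀ i, |flux f i t ξ| ≤ |f t ξ|)
    (h : MemLp (flux f i t) 2 (volume.restrict Υ)) :
    ∫ ξ in Υ, flux f i t ξ ^ 2 ≤ R ^ 2 := by
  refine le_trans (integral_mono_ae (integrable_sq h) (integrable_sq hf) ?_) hR
  filter_upwards [h3] with ξ hξ using sq_le_sq.2 (hξ i)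

lemma IsWeakSolution.integrableOn_integral_flux_mul (W : IsWeakSolution Pe De T f₀ f) (i : Fin 3)
    {ψ : E → ℝ} (hψ : Continuous ψ) {B : ℝ} (hB : ∀ ξ, |ψ ξ| ≤ B) :
    (∃ K, ∀ᵐ t ∂(volume.restrict (Ioo 0 T)), |∫ ξ in Υ, flux f i t ξ * ψ ξ| ≤ K) ∧
      IntegrableOn (fun t => ∫ ξ in Υ, flux f i t ξ * ψ ξ) (Ioo 0 T) := by
  obtain ⟨R, hR0, hR⟩ := W.contL2.exists_bound
  have hm : AEStronglyMeasurable (fun t => ∫ ξ in Υ, flux f i t ξ * ψ ξ)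
      (volume.restrict (Ioo 0 T)) :=
    ((W.contL2.aestronglyMeasurable_flux i).mul
      ((hψ.comp continuous_snd).aestronglyMeasurable)).integral_prod_right'
  have hb : ∀ᵐ t ∂(volume.restrict (Ioo 0 T)), |∫ ξ in Υ, flux f i t ξ * ψ ξ|
      ≤ B * (R ^ 2 + (2 * Real.pi) ^ 3) := by
    filter_upwards [W.ae_flux, ae_restrict_mem measurableSet_Ioo] with t ⟨h1, _, h2⟩ ht
    have ht' : t ∈ Icc 0 T := ⟨ht.1.le, ht.2.le⟩
    exact abs_integral_mul_le (h2 i)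
      (integral_sq_flux_le (W.contL2.memLp ht') (hR t ht') h1 (h2 i)) hB
  exact ⟨⟨_, hb⟩, Integrable.of_bound hm _ hb⟩

lemma IsWeakSolution.integrableOn_drift (W : IsWeakSolution Pe De T f₀ f) (n : Fin 3 → ℤ) :
    IntegrableOn (drift f n) (Ioo 0 T) := by
  unfold drift
  exact integrable_finsetSum _ fun i _ =>
    ((W.integrableOn_integral_flux_mul i (continuous_hart _) (abs_hart_le _)).2).const_mul _

lemma IsWeakSolution.exists_bound_drift (W : IsWeakSolution Pe De T f₀ f) (n : Fin 3 → ℤ) :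
    ∃ K, ∀ᵐ t ∂(volume.restrict (Ioo 0 T)), |drift f n t| ≤ K := by
  choose K hK using fun i =>
    (W.integrableOn_integral_flux_mul i (continuous_hart (-n)) (abs_hart_le _)).1
  refine ⟨∑ i, |(n i : ℝ)| * K i, ?_⟩
  filter_upwards [ae_all_iff.2 hK] with t ht
  refine (Finset.abs_sum_le_sum_abs _ _).trans (Finset.sum_le_sum fun i _ => ?_)
  rw [abs_mul]
  exact mul_le_mul_of_nonneg_left (ht i) (abs_nonneg _)

lemma IsContL2.continuousOn_hmoment (hf : IsContL2 T f) (n : Fin 3 → ℤ) :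
    ContinuousOn (hmoment f n) (Icc 0 T) := hf.continuousOn_integral_mul (continuous_hart n)

lemma pderiv_smul (c : ℝ) (i : Fin 3) (u : H1per) :
    pderiv i (c • u) =ᵐ[volume.restrict Υ] fun ξ => c * pderiv i u ξ :=
  (Lp.coeFn_smul c (pderiv i u)).trans (Eventually.of_forall fun ξ => by simp)

/-- The weak gradient of an element of `H¹`, tested against a Hartley function. -/
lemma integral_pderiv_mul_hart (u : H1per) (i : Fin 3) (n : Fin 3 → ℤ) :
    ∫ ξ in Υ, pderiv i u ξ * hart (-n) ξ = n i * ∫ ξ in Υ, val u ξ * hart n ξ := by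
  have h := u.2 (hart (-n)) (isSmoothPer_hart _) i
  simp only [fderiv_hart, neg_neg] at h
  have h2 : ∫ ξ in Υ, pderiv i u ξ * hart (-n) ξ
      = -∫ ξ in Υ, val u ξ * (((-n) i : ℤ) * hart n ξ) := by
    rw [show (∫ ξ in Υ, val u ξ * (((-n) i : ℤ) * hart n ξ))
      = -∫ ξ in Υ, pderiv i u ξ * hart (-n) ξ from h, neg_neg]
  rw [h2, ← integral_const_mul, ← integral_neg]
  refine integral_congr_ae (Eventually.of_forall fun ξ => ?_)
  simp only [Pi.neg_apply, Int.cast_neg]; ring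

lemma memL2Time_smul {η : ℝ → ℝ} (hη : Continuous η) (u : H1per) :
    MemL2Time T (fun t => η t • u) := by
  have hc : Continuous fun t => η t • u := by fun_prop
  obtain ⟨K, hK⟩ := (isCompact_Icc (a := (0 : ℝ)) (b := T)).exists_bound_of_continuousOn
    hc.continuousOn
  refine MemLp.of_bound (hη.aestronglyMeasurable.smul_const u) K ?_
  filter_upwards [ae_restrict_mem measurableSet_Ioo] with t ht using hK t ⟨ht.1.le, ht.2.le⟩

lemma integral_flux_pderiv (c t : ℝ) (n : Fin 3 → ℤ)
    (h : ∀ i, MemLp (flux f i t) 2 (volume.restrict Υ)) :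
    ∫ ξ in Υ, (1 - density (f t) ξ.1) * f t ξ *
      (Real.cos ξ.2 * pderiv 0 (c • hartH1 n) ξ + Real.sin ξ.2 * pderiv 1 (c • hartH1 n) ξ)
      = drift f n t * c := by
  have hi : ∀ i, Integrable (fun ξ => flux f i t ξ * hart (-n) ξ) (volume.restrict Υ) := fun i =>
    (h i).integrable_mul (memLp_of_continuous (continuous_hart _))
  have e : drift f n t * c = ∫ ξ in Υ, ∑ i, (c * n i) * (flux f i t ξ * hart (-n) ξ) := by
    rw [integral_finsetSum _ fun i _ => (hi i).const_mul _, drift, Finset.sum_mul]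
    refine Finset.sum_congr rfl fun i _ => ?_
    rw [integral_const_mul]; ring
  rw [e]
  refine integral_congr_ae ?_
  filter_upwards [pderiv_smul c 0 (hartH1 n), pderiv_smul c 1 (hartH1 n), pderiv_hartH1 n 0,
    pderiv_hartH1 n 1] with ξ h1 h2 h3 h4
  rw [h1, h2, h3, h4, Fin.sum_univ_three]
  simp [flux, ang]
  ring

lemma integral_pderiv_mul_pderiv (c t : ℝ) (n : Fin 3 → ℤ) (i : Fin 3) (u : H1per)
    (hu : val u =ᵐ[volume.restrict Υ] f t) :
    Integrable (fun ξ => pderiv i u ξ * pderiv i (c • hartH1 n) ξ) (volume.restrict Υ) ∧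
    ∫ ξ in Υ, pderiv i u ξ * pderiv i (c • hartH1 n) ξ = (n i : ℝ) ^ 2 * hmoment f n t * c := by
  have e1 : (fun ξ => pderiv i u ξ * pderiv i (c • hartH1 n) ξ)
      =ᵐ[volume.restrict Υ] fun ξ => (c * n i) * (pderiv i u ξ * hart (-n) ξ) := by
    filter_upwards [pderiv_smul c i (hartH1 n), pderiv_hartH1 n i] with ξ h1 h2
    rw [h1, h2]; ring
  have e2 : ∫ ξ in Υ, val u ξ * hart n ξ = hmoment f n t := by
    refine integral_congr_ae ?_
    filter_upwards [hu] with ξ h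
    rw [h]
  refine ⟨(integrable_congr e1).2 ((integrable_L2_mul _ (continuous_hart _)).const_mul _), ?_⟩
  rw [integral_congr_ae e1, integral_const_mul, integral_pderiv_mul_hart, e2]
  ring

/-- The evolution of a Hartley coefficient, in weak form. -/
lemma IsWeakSolution.weak_hmoment (W : IsWeakSolution Pe De T f₀ f) (n : Fin 3 → ℤ)
    {η : ℝ → ℝ} (hη : IsTimeTest T η) :
    ∫ t in Ioo 0 T, (-decay De n * hmoment f n t + Pe * drift f n t) * η t
      = -∫ t in Ioo 0 T, hmoment f n t * deriv η t := by
  obtain ⟨F, g, _, hFf, ⟨_, hg⟩, hweak⟩ := W.weak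
  have hw := hweak (fun t => η t • hartH1 n) (memL2Time_smul hη.continuous _)
  have hl : ∫ t in Ioo 0 T, g t (η t • hartH1 n)
      = -∫ t in Ioo 0 T, hmoment f n t * deriv η t := by
    have h1 := hg (hartH1 n) η hη.1 hη.2.1 hη.2.2
    have h2 : ∀ t, ∫ ξ in Υ, f t ξ * val (hartH1 n) ξ = hmoment f n t := fun t => by
      refine integral_congr_ae ?_
      filter_upwards [val_hartH1 n] with ξ h
      rw [h]
    simp only [h2] at h1
    rw [← h1]
    refine integral_congr_ae (Eventually.of_forall fun t => ?_)
    simp only [map_smul, smul_eq_mul]; ring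
  have hdrift : ∫ t in Ioo 0 T, ∫ ξ in Υ, (1 - density (f t) ξ.1) * f t ξ *
      (Real.cos ξ.2 * pderiv 0 (η t • hartH1 n) ξ + Real.sin ξ.2 * pderiv 1 (η t • hartH1 n) ξ)
      = ∫ t in Ioo 0 T, drift f n t * η t := by
    refine integral_congr_ae ?_
    filter_upwards [W.ae_flux] with t ht using integral_flux_pderiv _ _ _ ht.2.2
  have hspace : ∫ t in Ioo 0 T, ∫ ξ in Υ, (pderiv 0 (F t) ξ * pderiv 0 (η t • hartH1 n) ξ
      + pderiv 1 (F t) ξ * pderiv 1 (η t • hartH1 n) ξ)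
      = ((n 0 : ℝ) ^ 2 + (n 1 : ℝ) ^ 2) * ∫ t in Ioo 0 T, hmoment f n t * η t := by
    rw [← integral_const_mul]
    refine integral_congr_ae ?_
    filter_upwards [hFf] with t ht
    have h0 := integral_pderiv_mul_pderiv (f := f) (η t) t n 0 (F t) ht
    have h1 := integral_pderiv_mul_pderiv (f := f) (η t) t n 1 (F t) ht
    rw [integral_add h0.1 h1.1, h0.2, h1.2]
    ring
  have hangle : ∫ t in Ioo 0 T, ∫ ξ in Υ, pderiv 2 (F t) ξ * pderiv 2 (η t • hartH1 n) ξ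
      = (n 2 : ℝ) ^ 2 * ∫ t in Ioo 0 T, hmoment f n t * η t := by
    rw [← integral_const_mul]
    refine integral_congr_ae ?_
    filter_upwards [hFf] with t ht
    have h0 := integral_pderiv_mul_pderiv (f := f) (η t) t n 2 (F t) ht
    rw [h0.2]
    ring
  rw [hl, hdrift, hspace, hangle] at hw
  rw [hw]
  have e : ∀ t, (-decay De n * hmoment f n t + Pe * drift f n t) * η t
      = -decay De n * (hmoment f n t * η t) + Pe * (drift f n t * η t) := fun t => by ring
  simp only [e]
  rw [integral_add ((IsTimeTest.integrable_mul hη.continuous (integrableOn_Ioo_of_continuousOn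
      (W.contL2.continuousOn_hmoment n))).const_mul _)
    ((IsTimeTest.integrable_mul hη.continuous (W.integrableOn_drift n)).const_mul _),
    integral_const_mul, integral_const_mul]
  simp only [decay, diffusivity, Fin.sum_univ_three, Matrix.cons_val]
  ring

/-- The evolution of a Hartley coefficient, in integrated form. -/
lemma IsWeakSolution.hmoment_sub (W : IsWeakSolution Pe De T f₀ f) (hT : 0 < T) (n : Fin 3 → ℤ)
    {s t : ℝ} (hs : s ∈ Icc 0 T) (ht : t ∈ Icc 0 T) :
    hmoment f n t - hmoment f n s
      = ∫ r in s..t, (-decay De n * hmoment f n r + Pe * drift f n r) :=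
  sub_eq_integral_of_weak_deriv hT (W.contL2.continuousOn_hmoment n)
    (((integrableOn_Ioo_of_continuousOn (W.contL2.continuousOn_hmoment n)).const_mul _).add
      ((W.integrableOn_drift n).const_mul _)) (fun _ hη => W.weak_hmoment n hη) hs ht

/-- Duhamel's formula for a Hartley coefficient. -/
lemma IsWeakSolution.hmoment_duhamel (W : IsWeakSolution Pe De T f₀ f) (hT : 0 < T)
    (n : Fin 3 → ℤ) {s t : ℝ} (hs : s ∈ Icc 0 T) (ht : t ∈ Icc 0 T) :
    Real.exp (decay De n * t) * hmoment f n t - Real.exp (decay De n * s) * hmoment f n s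
      = ∫ r in s..t, Real.exp (decay De n * r) * (Pe * drift f n r) := by
  have hc : Continuous fun t => Real.exp (decay De n * t) := by fun_prop
  have hk := IsTimeTest.integrable_mul hc ((W.integrableOn_drift n).const_mul Pe)
  simp only [mul_comm _ (Real.exp _)] at hk
  refine sub_eq_integral_of_weak_deriv (u := fun t => Real.exp (decay De n * t) * hmoment f n t) hT
    (hc.continuousOn.mul (W.contL2.continuousOn_hmoment n)) hk (fun η hη => ?_) hs ht
  -- the weak form, tested with `exp (λ t) η(t)`
  have h1 := W.weak_hmoment n (hη.mul_left (ζ := fun t => Real.exp (decay De n * t))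
    (by fun_prop))
  have hd : ∀ t, deriv (fun t => Real.exp (decay De n * t) * η t) t
      = decay De n * Real.exp (decay De n * t) * η t
        + Real.exp (decay De n * t) * deriv η t := fun t => by
    have h2 : HasDerivAt (fun t => Real.exp (decay De n * t))
        (decay De n * Real.exp (decay De n * t)) t := by
      have := ((hasDerivAt_id t).const_mul (decay De n)).exp
      simpa [mul_comm] using this
    exact (h2.mul (hη.hasDerivAt t)).deriv
  simp only [hd] at h1
  have hmi := integrableOn_Ioo_of_continuousOn (W.contL2.continuousOn_hmoment n)
  have i1 : IntegrableOn (fun t => hmoment f n t * (decay De n * Real.exp (decay De n * t) * η t))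
      (Ioo 0 T) := IsTimeTest.integrable_mul (by have := hη.continuous; fun_prop) hmi
  have i2 : IntegrableOn (fun t => hmoment f n t * (Real.exp (decay De n * t) * deriv η t))
      (Ioo 0 T) := IsTimeTest.integrable_mul (by have := hη.continuous_deriv; fun_prop) hmi
  have i3 : IntegrableOn (fun t => Real.exp (decay De n * t) * (Pe * drift f n t) * η t)
      (Ioo 0 T) := IsTimeTest.integrable_mul hη.continuous hk
  have e1 : ∀ t, (-decay De n * hmoment f n t + Pe * drift f n t) *
      (Real.exp (decay De n * t) * η t)
      = Real.exp (decay De n * t) * (Pe * drift f n t) * η t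
        - hmoment f n t * (decay De n * Real.exp (decay De n * t) * η t) := fun t => by ring
  simp only [e1, mul_add] at h1
  rw [integral_sub i3 i1, integral_add i1 i2] at h1
  have e2 : ∀ t, Real.exp (decay De n * t) * hmoment f n t * deriv η t
      = hmoment f n t * (Real.exp (decay De n * t) * deriv η t) := fun t => by ring
  simp only [e2]
  linarith

end Weak

/-! ### A convex penalization of the negative part -/

/-- The negative part. -/
def npart (r : ℝ) : ℝ := max (-r) 0

/-- A `C²` convex function that is positive exactly on the negative half-line, with bounded second
derivative `negPen''` such that `r² negPen'' r` is controlled by `negPen r`. -/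
def negPen (r : ℝ) : ℝ := npart r ^ 3 / (1 + npart r)

/-- The derivative of `negPen`. -/
def negPen' (r : ℝ) : ℝ := -((3 * npart r ^ 2 + 2 * npart r ^ 3) / (1 + npart r) ^ 2)

/-- The second derivative of `negPen`. -/
def negPen'' (r : ℝ) : ℝ :=
  (6 * npart r + 6 * npart r ^ 2 + 2 * npart r ^ 3) / (1 + npart r) ^ 3

lemma npart_nonneg (r : ℝ) : 0 ≤ npart r := le_max_right _ _

lemma npart_le_abs (r : ℝ) : npart r ≤ |r| := max_le (neg_le_abs r) (abs_nonneg r)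

@[fun_prop]
lemma continuous_npart : Continuous npart := by unfold npart; fun_prop

lemma one_add_npart_ne_zero (r : ℝ) : 1 + npart r ≠ 0 := by linarith [npart_nonneg r]

@[fun_prop]
lemma continuous_negPen : Continuous negPen :=
  (continuous_npart.pow 3).div₀ (by fun_prop) one_add_npart_ne_zero

@[fun_prop]
lemma continuous_negPen' : Continuous negPen' :=
  ((((continuous_npart.pow 2).const_mul 3).add ((continuous_npart.pow 3).const_mul 2)).div₀
    (by fun_prop) fun r => pow_ne_zero 2 (one_add_npart_ne_zero r)).neg

@[fun_prop]
lemma continuous_negPen'' : Continuous negPen'' := by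
  unfold negPen''
  exact Continuous.div₀ (by fun_prop) (by fun_prop)
    fun r => pow_ne_zero 3 (one_add_npart_ne_zero r)

/-- At `0`, where `npart` is not differentiable, the chain rule holds because `γ' 0 = 0`. -/
lemma hasDerivAt_comp_npart {γ γ' : ℝ → ℝ} (h : ∀ s, 0 ≤ s → HasDerivAt γ (γ' s) s)
    (h0 : γ' 0 = 0) (r : ℝ) : HasDerivAt (fun r => γ (npart r)) (-γ' (npart r)) r := by
  rcases lt_trichotomy r 0 with hr | rfl | hr
  · have e : npart r = -r := max_eq_left (by linarith)
    have h1 : HasDerivAt (fun r => γ (-r)) (-γ' (-r)) r := by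
      have := HasDerivAt.comp (h₂ := γ) (h := fun r : ℝ => -r) r (h (-r) (by linarith))
        (hasDerivAt_neg r)
      simpa [Function.comp_def] using this
    rw [e]
    refine h1.congr_of_eventuallyEq ?_
    filter_upwards [Iio_mem_nhds hr] with s hs
    rw [npart, max_eq_left (by linarith [mem_Iio.1 hs])]
  · have e : npart 0 = 0 := by simp [npart]
    have h1 := h 0 le_rfl
    rw [h0] at h1
    rw [e, h0, neg_zero]
    rw [hasDerivAt_iff_isLittleO] at h1 ⊢
    have ht : Tendsto npart (𝓝 0) (𝓝 0) := by
      have := continuous_npart.tendsto 0; rwa [e] at this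
    have h2 := h1.comp_tendsto ht
    simp only [Function.comp_def, smul_zero, sub_zero, e] at h2 ⊢
    refine h2.trans_isBigO (Asymptotics.IsBigO.of_bound 1 (Eventually.of_forall fun s => ?_))
    rw [Real.norm_of_nonneg (npart_nonneg s), one_mul]
    exact npart_le_abs s
  · have e : npart r = 0 := max_eq_right (by linarith)
    rw [e, h0, neg_zero]
    refine (hasDerivAt_const r (γ 0)).congr_of_eventuallyEq ?_
    filter_upwards [Ioi_mem_nhds hr] with s hs
    rw [npart, max_eq_right (by linarith [mem_Ioi.1 hs])]

lemma hasDerivAt_negPen (r : ℝ) : HasDerivAt negPen (negPen' r) r := by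
  refine hasDerivAt_comp_npart (γ := fun s => s ^ 3 / (1 + s))
    (γ' := fun s => (3 * s ^ 2 + 2 * s ^ 3) / (1 + s) ^ 2) (fun s hs => ?_) (by simp) r
  have h1 : (1 + s) ≠ 0 := by linarith
  convert! (hasDerivAt_pow 3 s).div ((hasDerivAt_id s).const_add 1) h1 using 1
  simp; ring

lemma hasDerivAt_negPen' (r : ℝ) : HasDerivAt negPen' (negPen'' r) r := by
  have h := hasDerivAt_comp_npart (γ := fun s => -((3 * s ^ 2 + 2 * s ^ 3) / (1 + s) ^ 2))
    (γ' := fun s => -((6 * s + 6 * s ^ 2 + 2 * s ^ 3) / (1 + s) ^ 3)) (fun s hs => ?_) (by simp) r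
  · rw [neg_neg] at h; exact h
  have h1 : (1 + s) ≠ 0 := by linarith
  have h2 : HasDerivAt (fun s : ℝ => 3 * s ^ 2 + 2 * s ^ 3) (6 * s + 6 * s ^ 2) s := by
    convert! ((hasDerivAt_pow 2 s).const_mul 3).add ((hasDerivAt_pow 3 s).const_mul 2) using 1
    simp; ring
  have h3 : HasDerivAt (fun s : ℝ => (1 + s) ^ 2) (2 * (1 + s)) s := by
    convert! ((hasDerivAt_id s).const_add 1).pow 2 using 1
    simp
  convert! (h2.div h3 (pow_ne_zero 2 h1)).neg using 1
  field_simp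
  ring

lemma negPen_nonneg (r : ℝ) : 0 ≤ negPen r := by
  have := npart_nonneg r; unfold negPen; positivity

lemma negPen_le (r : ℝ) : negPen r ≤ npart r ^ 2 := by
  have := npart_nonneg r
  rw [negPen, div_le_iff₀ (by positivity)]
  nlinarith [pow_nonneg this 2, pow_nonneg this 3]

lemma abs_negPen'_le (r : ℝ) : |negPen' r| ≤ 2 * |r| := by
  have h := npart_nonneg r
  refine le_trans ?_ (mul_le_mul_of_nonneg_left (npart_le_abs r) zero_le_two)
  rw [negPen', abs_neg, abs_of_nonneg (by positivity), div_le_iff₀ (by positivity)]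
  nlinarith [pow_nonneg h 2, pow_nonneg h 3]

lemma negPen''_nonneg (r : ℝ) : 0 ≤ negPen'' r := by
  have := npart_nonneg r; unfold negPen''; positivity

lemma negPen''_le (r : ℝ) : negPen'' r ≤ 2 := by
  have := npart_nonneg r
  rw [negPen'', div_le_iff₀ (by positivity)]
  nlinarith [pow_nonneg this 2, pow_nonneg this 3]

lemma negPen''_mul_sq_le (r : ℝ) : negPen'' r * r ^ 2 ≤ 6 * negPen r := by
  have h := npart_nonneg r
  rcases le_total 0 r with hr | hr
  · have e : npart r = 0 := max_eq_right (by linarith)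
    simp [negPen'', negPen, e]
  · have e : npart r = -r := max_eq_left (by linarith)
    have e2 : r ^ 2 = npart r ^ 2 := by rw [e]; ring
    rw [e2, negPen'', negPen, div_mul_eq_mul_div, mul_div_assoc', div_le_div_iff₀ (by positivity)
      (by positivity)]
    have : 6 * npart r ^ 3 * (1 + npart r) ^ 3
        - (6 * npart r + 6 * npart r ^ 2 + 2 * npart r ^ 3) * npart r ^ 2 * (1 + npart r)
        = npart r ^ 3 * (1 + npart r) * (6 * npart r + 4 * npart r ^ 2) := by ring
    have h2 : 0 ≤ npart r ^ 3 * (1 + npart r) * (6 * npart r + 4 * npart r ^ 2) := by positivity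
    linarith

lemma npart_sub_le (a b : ℝ) : npart a ≤ npart b + |a - b| := by
  unfold npart
  refine max_le ?_ (by positivity)
  have := neg_abs_le (a - b)
  have := le_max_left (-b) 0
  linarith

lemma cube_div_mono {s t : ℝ} (hs : 0 ≤ s) (h : s ≤ t) : s ^ 3 / (1 + s) ≤ t ^ 3 / (1 + t) := by
  have ht : 0 ≤ t := hs.trans h
  rw [div_le_div_iff₀ (by positivity) (by positivity)]
  have h1 := pow_le_pow_left₀ hs h 3
  nlinarith [mul_le_mul_of_nonneg_right (pow_le_pow_left₀ hs h 2) (mul_nonneg hs ht)]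

/-- The penalization is stable under perturbations that are small in `L²`. -/
lemma negPen_le_add (a b : ℝ) : negPen a ≤ 8 * negPen b + 4 * (a - b) ^ 2 := by
  have ha := npart_nonneg a
  have hb := npart_nonneg b
  have hab := npart_sub_le a b
  rcases le_total |a - b| (npart b) with h | h
  · -- the negative part at most doubles
    have h1 : negPen a ≤ (2 * npart b) ^ 3 / (1 + 2 * npart b) :=
      cube_div_mono ha (by linarith)
    have h2 : (2 * npart b) ^ 3 / (1 + 2 * npart b) ≤ 8 * negPen b := by
      rw [negPen, mul_pow, mul_div_assoc', show (2 : ℝ) ^ 3 = 8 by norm_num]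
      exact div_le_div_of_nonneg_left (by positivity) (by positivity) (by linarith)
    nlinarith [sq_nonneg (a - b)]
  · have h1 : npart a ≤ 2 * |a - b| := by linarith
    have h2 := pow_le_pow_left₀ ha h1 2
    have h3 := negPen_le a
    have h4 := negPen_nonneg b
    rw [mul_pow, sq_abs] at h2
    linarith

lemma nonneg_of_negPen_eq_zero {r : ℝ} (h : negPen r = 0) : 0 ≤ r := by
  rw [negPen, div_eq_zero_iff] at h
  have h1 : npart r = 0 := by
    rcases h with h | h
    · exact pow_eq_zero_iff (by norm_num) |>.1 h
    · exact absurd h (one_add_npart_ne_zero r)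
  have := le_max_left (-r) 0
  rw [npart] at h1
  linarith

lemma abs_negPen_sub_le {a b B : ℝ} (ha : |a| ≤ B) (hb : |b| ≤ B) :
    |negPen a - negPen b| ≤ 2 * B * |a - b| := by
  refine (convex_Icc (-B) B).norm_image_sub_le_of_norm_hasDerivWithin_le (f := negPen)
    (f' := negPen') (fun x _ => (hasDerivAt_negPen x).hasDerivWithinAt) (fun x hx => ?_)
    (abs_le.1 hb) (abs_le.1 ha)
  exact (abs_negPen'_le x).trans (by linarith [abs_le.2 hx])

/-! ### Gronwall's inequality in integral form -/

/-- The continuous function `y` need not be non-negative or differentiable: the quantity that is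
monotone is `exp (-K t) (A + K ∫₀ᵗ y)`. -/
lemma le_mul_exp_of_le_add_integral {T A K : ℝ} (hK : 0 ≤ K) {y : ℝ → ℝ}
    (hy : ContinuousOn y (Icc 0 T)) (h : ∀ t ∈ Icc 0 T, y t ≤ A + K * ∫ r in (0 : ℝ)..t, y r)
    {t : ℝ} (ht : t ∈ Icc 0 T) : y t ≤ A * Real.exp (K * t) := by
  have hT : 0 ≤ T := ht.1.trans ht.2
  set Y : ℝ → ℝ := fun t => ∫ r in (0 : ℝ)..t, y r with hY
  have hyi : IntervalIntegrable y volume 0 T := by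
    refine ContinuousOn.intervalIntegrable ?_
    rwa [uIcc_of_le hT]
  have hYc : ContinuousOn Y (Icc 0 T) := by
    have := intervalIntegral.continuousOn_primitive_interval' (a := 0) hyi (by simp)
    rwa [uIcc_of_le hT] at this
  have hYd : ∀ s ∈ Ioo 0 T, HasDerivAt Y (y s) s := fun s hs => by
    refine intervalIntegral.integral_hasDerivAt_right (hyi.mono_set ?_) ?_
      (hy.continuousAt (Icc_mem_nhds hs.1 hs.2))
    · rw [uIcc_of_le hs.1.le, uIcc_of_le hT]; exact Icc_subset_Icc_right hs.2.le
    · exact ContinuousOn.stronglyMeasurableAtFilter_nhdsWithin (s := Ioo 0 T)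
        (hy.mono Ioo_subset_Icc_self) measurableSet_Ioo s |>.filter_mono (by
          rw [isOpen_Ioo.nhdsWithin_eq hs])
  have hd : ∀ s ∈ Ioo 0 T, HasDerivAt (fun t => Real.exp (-K * t) * (A + K * Y t))
      (Real.exp (-K * s) * (K * (y s - (A + K * Y s)))) s := fun s hs => by
    have h1 : HasDerivAt (fun t => Real.exp (-K * t)) (Real.exp (-K * s) * -K) s := by
      simpa using ((hasDerivAt_id s).const_mul (-K)).exp
    convert! h1.mul (((hYd s hs).const_mul K).const_add A) using 1
    ring
  have hanti : AntitoneOn (fun t => Real.exp (-K * t) * (A + K * Y t)) (Icc 0 T) := by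
    refine antitoneOn_of_deriv_nonpos (convex_Icc 0 T) ?_ ?_ ?_
    · exact (by fun_prop : Continuous fun t => Real.exp (-K * t)).continuousOn.mul
        (continuousOn_const.add (continuousOn_const.mul hYc))
    · rw [interior_Icc]
      exact fun s hs => (hd s hs).differentiableAt.differentiableWithinAt
    · rw [interior_Icc]
      intro s hs
      rw [(hd s hs).deriv]
      refine mul_nonpos_of_nonneg_of_nonpos (Real.exp_pos _).le
        (mul_nonpos_of_nonneg_of_nonpos hK ?_)
      linarith [h s ⟨hs.1.le, hs.2.le⟩]
  have h1 := hanti ⟨le_rfl, hT⟩ ht ht.1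
  have h0 : Y 0 = 0 := by simp [hY]
  simp only [mul_zero, Real.exp_zero, h0, add_zero, one_mul] at h1
  have h2 : A + K * Y t ≤ A * Real.exp (K * t) := by
    have h3 := mul_le_mul_of_nonneg_right h1 (Real.exp_pos (K * t)).le
    rwa [mul_right_comm, ← Real.exp_add, neg_mul, neg_add_cancel, Real.exp_zero, one_mul] at h3
  exact (h t ht).trans h2

/-! ### The energy inequality for the negative part -/

/-- The reflection of a set of frequencies. -/
def reflect (S : Finset (Fin 3 → ℤ)) : Finset (Fin 3 → ℤ) := S.map (Equiv.neg _).toEmbedding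

lemma tendsto_reflect : Tendsto reflect atTop atTop := by
  refine tendsto_atTop.2 fun S => eventually_atTop.2 ⟨reflect S, fun S' h n hn => ?_⟩
  have h1 : -n ∈ S' := h (by simpa [reflect] using hn)
  simpa [reflect] using h1

lemma hasLineDerivAt_comp {g g' : ℝ → ℝ} (hg : ∀ r, HasDerivAt g (g' r) r) {w : E → ℝ} {a : ℝ}
    {ξ e : E} (hw : HasLineDerivAt ℝ w a ξ e) :
    HasLineDerivAt ℝ (fun ξ => g (w ξ)) (g' (w ξ) * a) ξ e := by
  rw [HasLineDerivAt] at *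
  have h := HasDerivAt.comp (h₂ := g) (h := fun t : ℝ => w (ξ + t • e)) 0 (hg _) hw
  simpa [Function.comp_def] using! h

/-- The velocity of the `n`-th Hartley coefficient (unnormalized). -/
def hvel (Pe De : ℝ) (f : ℝ → E → ℝ) (n : Fin 3 → ℤ) (t : ℝ) : ℝ :=
  -decay De n * hmoment f n t + Pe * drift f n t

/-- The truncated solution moves with a velocity in divergence form. The flux is truncated to the
reflected frequencies, since differentiation maps `hart n` to a multiple of `hart (-n)`. -/
lemma trig_hvel (Pe De : ℝ) (f : ℝ → E → ℝ) (S : Finset (Fin 3 → ℤ)) (t : ℝ) (ξ : E) :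
    trig S (fun n => hvel Pe De f n t / (2 * Real.pi) ^ 3) ξ
      = ∑ i, (diffusivity De i * trig S (fun n => -(n i : ℝ) ^ 2 * hcoef (f t) n) ξ
          - Pe * trigD i (reflect S) (hcoef (flux f i t)) ξ) := by
  simp only [trig, trigD, reflect, Finset.sum_map, Equiv.coe_toEmbedding, Equiv.neg_apply, neg_neg,
    Finset.mul_sum]
  simp only [← Finset.sum_sub_distrib]
  rw [Finset.sum_comm]
  refine Finset.sum_congr rfl fun n _ => ?_
  have e1 : hmoment f n t / (2 * Real.pi) ^ 3 = hcoef (f t) n := rfl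
  have e2 : ∀ i, (∫ ξ in Υ, flux f i t ξ * hart (-n) ξ) / (2 * Real.pi) ^ 3
      = hcoef (flux f i t) (-n) := fun i => rfl
  rw [hvel, decay, drift, add_div, mul_div_assoc, mul_div_assoc, e1, Finset.sum_div,
    Finset.mul_sum, neg_mul, Finset.sum_mul, ← Finset.sum_neg_distrib, ← Finset.sum_add_distrib,
    Finset.sum_mul]
  refine Finset.sum_congr rfl fun i _ => ?_
  rw [mul_div_assoc, e2]
  simp only [Pi.neg_apply, Int.cast_neg]
  ring

/-- The constant in the energy inequality. -/
def energyConst (Pe De : ℝ) : ℝ := Pe ^ 2 / (4 * min De 1)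

lemma energyConst_nonneg {De : ℝ} (Pe : ℝ) (hDe : 0 < De) : 0 ≤ energyConst Pe De := by
  have : 0 < min De 1 := lt_min hDe one_pos
  unfold energyConst; positivity

/-- Young's inequality: the drift is absorbed by the dissipation. -/
lemma dissipation_le {Pe De : ℝ} (hDe : 0 < De) (i : Fin 3) (u p : ℝ) :
    -diffusivity De i * u ^ 2 + Pe * u * p ≤ energyConst Pe De * p ^ 2 := by
  have hm : 0 < min De 1 := lt_min hDe one_pos
  have hd : min De 1 ≤ diffusivity De i := by
    fin_cases i <;> simp [diffusivity]
  have h1 : energyConst Pe De * p ^ 2 = (Pe * p) ^ 2 / (4 * min De 1) := by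
    rw [energyConst]; ring
  rw [h1, le_div_iff₀ (by positivity)]
  nlinarith [sq_nonneg (2 * min De 1 * u - Pe * p),
    mul_le_mul_of_nonneg_right hd (mul_nonneg hm.le (sq_nonneg u))]

section Energy

variable {Pe De T : ℝ} {f₀ : E → ℝ} {f : ℝ → E → ℝ}

/-- The error made in the energy inequality by truncating the frequencies. -/
def truncErr (f : ℝ → E → ℝ) (S : Finset (Fin 3 → ℤ)) (t : ℝ) : ℝ :=
  8 * (∫ ξ in Υ, (f t ξ - hproj S (f t) ξ) ^ 2)
    + 4 * ∑ i, ∫ ξ in Υ, (flux f i t ξ - hproj (reflect S) (flux f i t) ξ) ^ 2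

/-- The energy inequality at a fixed time: the rate of change of the penalization along the
truncated flow. After integration by parts and Young's inequality the integrand is at most
a constant times `negPen'' (u) ∑ᵢ pᵢ²`, where `u` and `p` are the truncations of `f` and of the
flux. Up to constants and truncation errors `∑ᵢ pᵢ² ≤ u²`, and `negPen'' (u) u² ≤ 6 negPen u`. -/
lemma energy_inequality (hDe : 0 < De) {t : ℝ} (S : Finset (Fin 3 → ℤ))
    (hf : MemLp (f t) 2 (volume.restrict Υ))
    (hflux : ∀ i, MemLp (flux f i t) 2 (volume.restrict Υ))
    (hle : ∀ᵐ ξ ∂(volume.restrict Υ), ∑ i, flux f i t ξ ^ 2 ≤ f t ξ ^ 2) :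
    ∫ ξ in Υ, negPen' (hproj S (f t) ξ) * trig S (fun n => hvel Pe De f n t / (2 * Real.pi) ^ 3) ξ
      ≤ energyConst Pe De * (24 * (∫ ξ in Υ, negPen (hproj S (f t) ξ)) + truncErr f S t) := by
  set c := hcoef (f t) with hc
  set u : E → ℝ := hproj S (f t) with hu
  have hu' : u = trig S c := rfl
  set p : Fin 3 → E → ℝ := fun i => hproj (reflect S) (flux f i t) with hp
  have hcu : Continuous u := continuous_trig _ _
  have hcp : ∀ i, Continuous (p i) := fun i => continuous_trig _ _
  have hup : IsPer u := isPer_trig _ _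
  have hpp : ∀ i, IsPer (p i) := fun i => isPer_trig _ _
  have hbp : IsPer (fun ξ => negPen' (u ξ)) := fun i ξ => by simp only [hup i ξ]
  have hbd : ∀ i ξ, HasLineDerivAt ℝ (fun ξ => negPen' (u ξ))
      (negPen'' (u ξ) * trigD i S c ξ) ξ (dir i) := fun i ξ =>
    hasLineDerivAt_comp hasDerivAt_negPen' (hasLineDerivAt_trig i S c ξ)
  have i1 : ∀ i, ∫ ξ in Υ, negPen' (u ξ) * trig S (fun n => -(n i : ℝ) ^ 2 * c n) ξ
      = -∫ ξ in Υ, negPen'' (u ξ) * trigD i S c ξ * trigD i S c ξ := fun i =>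
    integral_mul_lineDeriv (hbd i) (hasLineDerivAt_trigD i S c) (by fun_prop) (by fun_prop)
      (by fun_prop) (by fun_prop) hbp (isPer_trigD i S c)
  have i2 : ∀ i, ∫ ξ in Υ, negPen' (u ξ) * trigD i (reflect S) (hcoef (flux f i t)) ξ
      = -∫ ξ in Υ, negPen'' (u ξ) * trigD i S c ξ * p i ξ := fun i =>
    integral_mul_lineDeriv (hbd i) (hasLineDerivAt_trig i _ _) (by fun_prop) (hcp i)
      (by fun_prop) (by fun_prop) hbp (hpp i)
  have cint : ∀ {φ : E → ℝ}, Continuous φ → Integrable φ (volume.restrict Υ) :=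
    integrable_Υ_of_continuous
  have e1 : ∫ ξ in Υ, negPen' (u ξ) * trig S (fun n => hvel Pe De f n t / (2 * Real.pi) ^ 3) ξ
      = ∫ ξ in Υ, negPen'' (u ξ) * ∑ i, (-diffusivity De i * trigD i S c ξ ^ 2
          + Pe * trigD i S c ξ * p i ξ) := by
    simp only [trig_hvel, ← hc, Finset.mul_sum, mul_sub]
    rw [integral_finsetSum _ fun i _ => by
        have := hcp i; exact cint (by fun_prop),
      integral_finsetSum _ fun i _ => by
        have := hcp i; exact cint (by fun_prop)]
    refine Finset.sum_congr rfl fun i _ => ?_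
    have a1 : ∀ ξ, negPen' (u ξ) * (diffusivity De i * trig S (fun n => -(n i : ℝ) ^ 2 * c n) ξ)
        - negPen' (u ξ) * (Pe * trigD i (reflect S) (hcoef (flux f i t)) ξ)
        = diffusivity De i * (negPen' (u ξ) * trig S (fun n => -(n i : ℝ) ^ 2 * c n) ξ)
        - Pe * (negPen' (u ξ) * trigD i (reflect S) (hcoef (flux f i t)) ξ) := fun ξ => by ring
    have a2 : ∀ ξ, negPen'' (u ξ) * (-diffusivity De i * trigD i S c ξ ^ 2
          + Pe * trigD i S c ξ * p i ξ)
        = -diffusivity De i * (negPen'' (u ξ) * trigD i S c ξ * trigD i S c ξ)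
          + Pe * (negPen'' (u ξ) * trigD i S c ξ * p i ξ) := fun ξ => by ring
    simp only [a1, a2]
    have := hcp i
    rw [integral_sub (cint (by fun_prop)) (cint (by fun_prop)),
      integral_add (cint (by fun_prop)) (cint (by fun_prop)), integral_const_mul,
      integral_const_mul, integral_const_mul, integral_const_mul, i1, i2]
    ring
  rw [e1]
  have hd : MemLp (fun ξ => f t ξ - u ξ) 2 (volume.restrict Υ) :=
    hf.sub (memLp_of_continuous hcu)
  have hg : ∀ i, MemLp (fun ξ => flux f i t ξ - p i ξ) 2 (volume.restrict Υ) := fun i =>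
    (hflux i).sub (memLp_of_continuous (hcp i))
  have hI0 : Integrable (fun ξ => 24 * negPen (u ξ)) (volume.restrict Υ) := cint (by fun_prop)
  have hI1 : Integrable (fun ξ => 8 * (f t ξ - u ξ) ^ 2) (volume.restrict Υ) :=
    (integrable_sq hd).const_mul 8
  have hI2 : Integrable (fun ξ => ∑ i, 4 * (flux f i t ξ - p i ξ) ^ 2) (volume.restrict Υ) :=
    integrable_finsetSum _ fun i _ => (integrable_sq (hg i)).const_mul 4
  have hI3 : Integrable (fun ξ => 24 * negPen (u ξ) + 8 * (f t ξ - u ξ) ^ 2)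
      (volume.restrict Υ) := hI0.add hI1
  have e2 : energyConst Pe De * (24 * (∫ ξ in Υ, negPen (u ξ)) + truncErr f S t)
      = ∫ ξ in Υ, energyConst Pe De * (24 * negPen (u ξ) + 8 * (f t ξ - u ξ) ^ 2
          + ∑ i, 4 * (flux f i t ξ - p i ξ) ^ 2) := by
    rw [integral_const_mul, integral_add hI3 hI2, integral_add hI0 hI1, integral_const_mul,
      integral_const_mul, integral_finsetSum _ fun i _ => (integrable_sq (hg i)).const_mul 4]
    simp only [integral_const_mul, ← Finset.mul_sum]
    rw [truncErr]
    ring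
  rw [e2]
  refine integral_mono_ae (cint ?_) ((hI3.add hI2).const_mul _) ?_
  · refine Continuous.mul (by fun_prop) (continuous_finsetSum _ fun i _ => ?_)
    have := hcp i
    fun_prop
  filter_upwards [hle] with ξ hξ
  have b0 := negPen''_nonneg (u ξ)
  have b2 := negPen''_le (u ξ)
  have b3 := negPen''_mul_sq_le (u ξ)
  have hK := energyConst_nonneg Pe hDe
  have s1 : ∑ i, (-diffusivity De i * trigD i S c ξ ^ 2 + Pe * trigD i S c ξ * p i ξ)
      ≤ energyConst Pe De * ∑ i, p i ξ ^ 2 := by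
    rw [Finset.mul_sum]
    exact Finset.sum_le_sum fun i _ => dissipation_le hDe i _ _
  have s2 : ∑ i, p i ξ ^ 2
      ≤ 2 * ∑ i, flux f i t ξ ^ 2 + 2 * ∑ i, (flux f i t ξ - p i ξ) ^ 2 := by
    rw [Finset.mul_sum, Finset.mul_sum, ← Finset.sum_add_distrib]
    refine Finset.sum_le_sum fun i _ => ?_
    nlinarith [sq_nonneg (2 * flux f i t ξ - p i ξ)]
  set Q := ∑ i, (flux f i t ξ - p i ξ) ^ 2 with hQ
  have hQ0 : 0 ≤ Q := Finset.sum_nonneg fun i _ => sq_nonneg _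
  have s3 : negPen'' (u ξ) * ∑ i, p i ξ ^ 2
      ≤ 24 * negPen (u ξ) + 8 * (f t ξ - u ξ) ^ 2 + 4 * Q := by
    have c1 : ∑ i, p i ξ ^ 2 ≤ 4 * u ξ ^ 2 + 4 * (f t ξ - u ξ) ^ 2 + 2 * Q := by
      nlinarith [sq_nonneg (f t ξ - 2 * u ξ)]
    have c2 := mul_le_mul_of_nonneg_left c1 b0
    have c3 := mul_le_mul_of_nonneg_right b2 (sq_nonneg (f t ξ - u ξ))
    have c4 := mul_le_mul_of_nonneg_right b2 hQ0
    nlinarith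
  calc negPen'' (u ξ) * ∑ i, (-diffusivity De i * trigD i S c ξ ^ 2 + Pe * trigD i S c ξ * p i ξ)
      ≤ negPen'' (u ξ) * (energyConst Pe De * ∑ i, p i ξ ^ 2) := mul_le_mul_of_nonneg_left s1 b0
    _ = energyConst Pe De * (negPen'' (u ξ) * ∑ i, p i ξ ^ 2) := by ring
    _ ≤ energyConst Pe De * (24 * negPen (u ξ) + 8 * (f t ξ - u ξ) ^ 2 + 4 * Q) :=
        mul_le_mul_of_nonneg_left s3 hK
    _ = _ := by rw [hQ, Finset.mul_sum]

/-! ### Regularity in time of the truncated solution -/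

/-- The coefficients are differentiable almost everywhere by Lebesgue's theorem, since they are
integrals of their velocities. -/
lemma IsWeakSolution.hasDerivAt_hmoment (W : IsWeakSolution Pe De T f₀ f) (hT : 0 < T)
    (n : Fin 3 → ℤ) :
    ∀ᵐ t ∂(volume.restrict (Ioo 0 T)), HasDerivAt (hmoment f n) (hvel Pe De f n t) t := by
  have hv : IntegrableOn (hvel Pe De f n) (Ioo 0 T) :=
    ((integrableOn_Ioo_of_continuousOn (W.contL2.continuousOn_hmoment n)).const_mul _).add
      ((W.integrableOn_drift n).const_mul _)
  have h0 : (0 : ℝ) ∈ Icc 0 T := ⟨le_rfl, hT.le⟩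
  have hi : IntervalIntegrable (hvel Pe De f n) volume 0 T :=
    intervalIntegrable_of_integrableOn_Ioo hT hv h0 ⟨hT.le, le_rfl⟩
  rw [ae_restrict_iff' measurableSet_Ioo]
  filter_upwards [hi.ae_hasDerivAt_integral] with t ht htT
  have h1 := ht (by rw [uIcc_of_le hT.le]; exact ⟨htT.1.le, htT.2.le⟩) 0
    (by rw [uIcc_of_le hT.le]; exact h0)
  refine (h1.const_add (hmoment f n 0)).congr_of_eventuallyEq ?_
  filter_upwards [Ioo_mem_nhds htT.1 htT.2] with s hs
  have h2 := W.hmoment_sub hT n h0 ⟨hs.1.le, hs.2.le⟩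
  change _ = hmoment f n 0 + ∫ r in (0 : ℝ)..s, hvel Pe De f n r
  rw [show (∫ r in (0 : ℝ)..s, hvel Pe De f n r) = hmoment f n s - hmoment f n 0 from h2.symm]
  ring

lemma IsWeakSolution.exists_lipschitz_hmoment (W : IsWeakSolution Pe De T f₀ f) (hT : 0 < T)
    (n : Fin 3 → ℤ) : ∃ L, 0 ≤ L ∧ ∀ s ∈ Icc 0 T, ∀ t ∈ Icc 0 T,
      |hmoment f n t - hmoment f n s| ≤ L * |t - s| := by
  obtain ⟨K₁, h1⟩ := isCompact_Icc.exists_bound_of_continuousOn (W.contL2.continuousOn_hmoment n)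
  obtain ⟨K₂, h2⟩ := W.exists_bound_drift n
  set L := |decay De n| * K₁ + |Pe| * K₂ with hL
  have hb : ∀ᵐ t, t ∈ Ioo 0 T → ‖-decay De n * hmoment f n t + Pe * drift f n t‖ ≤ L := by
    rw [ae_restrict_iff' measurableSet_Ioo] at h2
    filter_upwards [h2] with t ht htT
    refine (norm_add_le _ _).trans ?_
    rw [norm_mul, norm_mul, norm_neg]
    exact add_le_add (mul_le_mul_of_nonneg_left (h1 t ⟨htT.1.le, htT.2.le⟩) (norm_nonneg _))
      (mul_le_mul_of_nonneg_left (ht htT) (norm_nonneg _))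
  refine ⟨max L 0, le_max_right _ _, fun s hs t ht => ?_⟩
  rw [W.hmoment_sub hT n hs ht, ← Real.norm_eq_abs]
  have hne : ∀ᵐ r : ℝ, r ≠ T := by simp [ae_iff, measure_singleton]
  refine (intervalIntegral.norm_integral_le_of_norm_le_const_ae (C := L) ?_).trans
    (mul_le_mul_of_nonneg_right (le_max_left _ _) (abs_nonneg _))
  filter_upwards [hb, hne] with r hr hrT hr'
  have h3 : min s t < r ∧ r ≤ max s t := hr'
  refine hr ⟨(le_min hs.1 ht.1).trans_lt h3.1, lt_of_le_of_ne ?_ hrT⟩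
  exact h3.2.trans (max_le hs.2 ht.2)

lemma IsWeakSolution.exists_bound_hproj (W : IsWeakSolution Pe De T f₀ f)
    (S : Finset (Fin 3 → ℤ)) : ∃ B, 0 ≤ B ∧ ∀ t ∈ Icc 0 T, ∀ ξ, |hproj S (f t) ξ| ≤ B := by
  choose K hK using fun n =>
    isCompact_Icc.exists_bound_of_continuousOn (W.contL2.continuousOn_hmoment n)
  refine ⟨∑ n ∈ S, |K n / (2 * Real.pi) ^ 3| * 2, Finset.sum_nonneg fun n _ => by positivity,
    fun t ht ξ => (abs_trig_le _ _ _).trans (Finset.sum_le_sum fun n _ => ?_)⟩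
  refine mul_le_mul_of_nonneg_right ?_ zero_le_two
  have h1 : hcoef (f t) n = hmoment f n t / (2 * Real.pi) ^ 3 := rfl
  rw [h1, abs_div, abs_div]
  exact div_le_div_of_nonneg_right ((hK n t ht).trans (le_abs_self _)) (abs_nonneg _)

lemma IsWeakSolution.exists_lipschitz_hproj (W : IsWeakSolution Pe De T f₀ f) (hT : 0 < T)
    (S : Finset (Fin 3 → ℤ)) : ∃ L, 0 ≤ L ∧ ∀ s ∈ Icc 0 T, ∀ t ∈ Icc 0 T, ∀ ξ,
      |hproj S (f t) ξ - hproj S (f s) ξ| ≤ L * |t - s| := by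
  choose L hL0 hL using fun n => W.exists_lipschitz_hmoment hT n
  have hp : (0 : ℝ) < (2 * Real.pi) ^ 3 := by positivity
  refine ⟨∑ n ∈ S, L n / (2 * Real.pi) ^ 3 * 2,
    Finset.sum_nonneg fun n _ => mul_nonneg (div_nonneg (hL0 n) hp.le) zero_le_two,
    fun s hs t ht ξ => ?_⟩
  rw [hproj, hproj, trig, trig, ← Finset.sum_sub_distrib, Finset.sum_mul]
  refine (Finset.abs_sum_le_sum_abs _ _).trans (Finset.sum_le_sum fun n _ => ?_)
  have h1 : hcoef (f t) n * hart n ξ - hcoef (f s) n * hart n ξ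
      = (hmoment f n t - hmoment f n s) / (2 * Real.pi) ^ 3 * hart n ξ := by
    rw [hcoef, hcoef, hmoment, hmoment]; ring
  rw [h1, abs_mul, abs_div, abs_of_pos hp]
  calc |hmoment f n t - hmoment f n s| / (2 * Real.pi) ^ 3 * |hart n ξ|
      ≤ L n * |t - s| / (2 * Real.pi) ^ 3 * 2 := by
        gcongr
        · exact div_nonneg (mul_nonneg (hL0 n) (abs_nonneg _)) hp.le
        · exact hL n s hs t ht
        · exact abs_hart_le n ξ
    _ = _ := by ring

/-- The penalization of the truncated solution. -/
def penEnergy (f : ℝ → E → ℝ) (S : Finset (Fin 3 → ℤ)) (t : ℝ) : ℝ :=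
  ∫ ξ in Υ, negPen (hproj S (f t) ξ)

lemma continuous_hproj (S : Finset (Fin 3 → ℤ)) (g : E → ℝ) : Continuous (hproj S g) :=
  continuous_trig _ _

lemma integrable_negPen_hproj (S : Finset (Fin 3 → ℤ)) (g : E → ℝ) :
    Integrable (fun ξ => negPen (hproj S g ξ)) (volume.restrict Υ) :=
  integrable_Υ_of_continuous (continuous_negPen.comp (continuous_hproj S g))

lemma IsWeakSolution.exists_lipschitz_negPen (W : IsWeakSolution Pe De T f₀ f) (hT : 0 < T)
    (S : Finset (Fin 3 → ℤ)) : ∃ L, 0 ≤ L ∧ ∀ s ∈ Icc 0 T, ∀ t ∈ Icc 0 T, ∀ ξ,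
      |negPen (hproj S (f t) ξ) - negPen (hproj S (f s) ξ)| ≤ L * |t - s| := by
  obtain ⟨B, hB0, hB⟩ := W.exists_bound_hproj S
  obtain ⟨L, hL0, hL⟩ := W.exists_lipschitz_hproj hT S
  refine ⟨2 * B * L, by positivity, fun s hs t ht ξ => ?_⟩
  refine (abs_negPen_sub_le (hB t ht ξ) (hB s hs ξ)).trans ?_
  rw [mul_assoc (2 * B)]
  exact mul_le_mul_of_nonneg_left (hL s hs t ht ξ) (by positivity)

lemma IsWeakSolution.exists_lipschitz_penEnergy (W : IsWeakSolution Pe De T f₀ f) (hT : 0 < T)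
    (S : Finset (Fin 3 → ℤ)) : ∃ L : NNReal, LipschitzOnWith L (penEnergy f S) (Icc 0 T) := by
  obtain ⟨L, hL0, hL⟩ := W.exists_lipschitz_negPen hT S
  refine ⟨(L * (2 * Real.pi) ^ 3).toNNReal, LipschitzOnWith.of_dist_le_mul fun t ht s hs => ?_⟩
  rw [Real.coe_toNNReal _ (by positivity), Real.dist_eq, Real.dist_eq, penEnergy, penEnergy,
    ← integral_sub (integrable_negPen_hproj _ _) (integrable_negPen_hproj _ _),
    ← Real.norm_eq_abs]
  refine (norm_integral_le_of_norm_le_const (C := L * |t - s|)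
    (Eventually.of_forall fun ξ => hL s hs t ht ξ)).trans (le_of_eq ?_)
  rw [volume_real_Υ]; ring

lemma IsWeakSolution.hasDerivAt_penEnergy (W : IsWeakSolution Pe De T f₀ f) (hT : 0 < T)
    (S : Finset (Fin 3 → ℤ)) :
    ∀ᵐ t ∂(volume.restrict (Ioo 0 T)), HasDerivAt (penEnergy f S)
      (∫ ξ in Υ, negPen' (hproj S (f t) ξ)
        * trig S (fun n => hvel Pe De f n t / (2 * Real.pi) ^ 3) ξ) t := by
  obtain ⟨L, hL0, hL⟩ := W.exists_lipschitz_negPen hT S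
  filter_upwards [ae_all_iff.2 fun n => W.hasDerivAt_hmoment hT n,
    ae_restrict_mem measurableSet_Ioo] with t ht htT
  refine (hasDerivAt_integral_of_dominated_loc_of_lip (bound := fun _ => L)
    (F := fun s ξ => negPen (hproj S (f s) ξ)) (Ioo_mem_nhds htT.1 htT.2)
    (Eventually.of_forall fun s => (integrable_negPen_hproj S (f s)).aestronglyMeasurable)
    (integrable_negPen_hproj S (f t)) ?_ (Eventually.of_forall fun ξ => ?_)
    (integrable_const _) (Eventually.of_forall fun ξ => ?_)).2
  · exact ((continuous_negPen'.comp (continuous_hproj S (f t))).mul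
      (continuous_trig _ _)).aestronglyMeasurable
  · refine LipschitzOnWith.of_dist_le_mul fun a ha b hb => ?_
    rw [Real.coe_nnabs, abs_of_nonneg hL0, Real.dist_eq, Real.dist_eq]
    exact hL b ⟨hb.1.le, hb.2.le⟩ a ⟨ha.1.le, ha.2.le⟩ ξ
  · have h1 : HasDerivAt (fun s => hproj S (f s) ξ)
        (trig S (fun n => hvel Pe De f n t / (2 * Real.pi) ^ 3) ξ) t :=
      HasDerivAt.fun_sum fun n _ => ((ht n).div_const ((2 * Real.pi) ^ 3)).mul_const (hart n ξ)
    exact HasDerivAt.comp (h₂ := negPen) t (hasDerivAt_negPen _) h1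

/-! ### Positivity of weak solutions -/

lemma truncErr_nonneg (f : ℝ → E → ℝ) (S : Finset (Fin 3 → ℤ)) (t : ℝ) : 0 ≤ truncErr f S t := by
  refine add_nonneg (mul_nonneg (by norm_num) (integral_nonneg fun ξ => sq_nonneg _))
    (mul_nonneg (by norm_num) (Finset.sum_nonneg fun i _ => integral_nonneg fun ξ => sq_nonneg _))

lemma IsWeakSolution.exists_bound_truncErr (W : IsWeakSolution Pe De T f₀ f) :
    ∃ K, ∀ S, ∀ᵐ t ∂(volume.restrict (Ioo 0 T)), ‖truncErr f S t‖ ≤ K := by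
  obtain ⟨R, hR0, hR⟩ := W.contL2.exists_bound
  refine ⟨8 * R ^ 2 + 4 * ∑ _i : Fin 3, R ^ 2, fun S => ?_⟩
  filter_upwards [W.ae_flux, ae_restrict_mem measurableSet_Ioo] with t ⟨h1, _, h2⟩ ht
  have ht' : t ∈ Icc 0 T := ⟨ht.1.le, ht.2.le⟩
  have hm := W.contL2.memLp ht'
  rw [Real.norm_of_nonneg (truncErr_nonneg f S t), truncErr]
  refine add_le_add (mul_le_mul_of_nonneg_left ((integral_sub_hproj_sq_le hm S).trans (hR t ht'))
    (by norm_num)) (mul_le_mul_of_nonneg_left (Finset.sum_le_sum fun i _ => ?_) (by norm_num))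
  exact (integral_sub_hproj_sq_le (h2 i) _).trans (integral_sq_flux_le hm (hR t ht') h1 (h2 i))

/-- By Parseval's identity the truncation error is a finite combination of integrals that depend
measurably on time. -/
lemma IsWeakSolution.aestronglyMeasurable_truncErr (W : IsWeakSolution Pe De T f₀ f)
    (S : Finset (Fin 3 → ℤ)) :
    AEStronglyMeasurable (truncErr f S) (volume.restrict (Ioo 0 T)) := by
  have h1 := W.contL2.aestronglyMeasurable
  rw [prod_restrict_time] at h1
  have hgen : ∀ g : ℝ → E → ℝ, AEStronglyMeasurable (fun p : ℝ × E => g p.1 p.2)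
      ((volume.restrict (Ioo 0 T)).prod (volume.restrict Υ)) → ∀ S : Finset (Fin 3 → ℤ),
      AEStronglyMeasurable (fun t => (∫ ξ in Υ, g t ξ ^ 2)
        - (2 * Real.pi) ^ 3 * ∑ n ∈ S, hcoef (g t) n ^ 2) (volume.restrict (Ioo 0 T)) := by
    intro g hg S
    refine (hg.pow 2).integral_prod_right'.sub (AEStronglyMeasurable.const_mul ?_ _)
    refine Finset.aestronglyMeasurable_fun_sum _ fun n _ => ?_
    have h2 : AEStronglyMeasurable (fun t => ∫ ξ in Υ, g t ξ * hart n ξ)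
        (volume.restrict (Ioo 0 T)) := (hg.mul
      (((continuous_hart n).comp continuous_snd).aestronglyMeasurable)).integral_prod_right'
    have h3 := (h2.mul_const ((2 * Real.pi) ^ 3)⁻¹).pow 2
    refine h3.congr (Eventually.of_forall fun t => ?_)
    simp only [Pi.pow_apply, hcoef, div_eq_mul_inv]
  have h2 := ((hgen f h1 S).const_mul 8).add (AEStronglyMeasurable.const_mul
    (Finset.aestronglyMeasurable_fun_sum Finset.univ fun i _ =>
      hgen (flux f i) (W.contL2.aestronglyMeasurable_flux i) (reflect S)) 4)
  refine h2.congr ?_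
  filter_upwards [W.ae_flux, ae_restrict_mem measurableSet_Ioo] with t ⟨_, _, h4⟩ ht
  simp only [Pi.add_apply, truncErr]
  rw [integral_sub_hproj_sq (W.contL2.memLp ⟨ht.1.le, ht.2.le⟩)]
  simp only [integral_sub_hproj_sq (h4 _)]

lemma IsWeakSolution.integrableOn_truncErr (W : IsWeakSolution Pe De T f₀ f)
    (S : Finset (Fin 3 → ℤ)) : IntegrableOn (truncErr f S) (Ioo 0 T) := by
  obtain ⟨K, hK⟩ := W.exists_bound_truncErr
  exact Integrable.of_bound (W.aestronglyMeasurable_truncErr S) K (hK S)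

lemma IsWeakSolution.tendsto_integral_truncErr (W : IsWeakSolution Pe De T f₀ f) :
    Tendsto (fun S => ∫ t in Ioo 0 T, truncErr f S t) atTop (𝓝 0) := by
  obtain ⟨K, hK⟩ := W.exists_bound_truncErr
  suffices h : Tendsto (fun S => ∫ t in Ioo 0 T, truncErr f S t) atTop
      (𝓝 (∫ _t in Ioo 0 T, (0 : ℝ))) by simpa using h
  refine tendsto_integral_filter_of_dominated_convergence (l := atTop)
    (F := fun S t => truncErr f S t) (fun _ => K)
    (Eventually.of_forall fun S => W.aestronglyMeasurable_truncErr S)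
    (Eventually.of_forall hK) (integrable_const _) ?_
  filter_upwards [W.ae_flux, ae_restrict_mem measurableSet_Ioo] with t ⟨_, _, h2⟩ ht
  have h3 := ((tendsto_integral_sub_hproj (W.contL2.memLp ⟨ht.1.le, ht.2.le⟩)).const_mul 8).add
    ((tendsto_finsetSum Finset.univ fun i _ =>
      (tendsto_integral_sub_hproj (h2 i)).comp tendsto_reflect).const_mul 4)
  simpa using! h3

/-- Gronwall's inequality for the penalization of the truncated solution. -/
lemma IsWeakSolution.penEnergy_le (W : IsWeakSolution Pe De T f₀ f) (hDe : 0 < De) (hT : 0 < T)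
    (S : Finset (Fin 3 → ℤ)) {t : ℝ} (ht : t ∈ Icc 0 T) :
    penEnergy f S t ≤ (penEnergy f S 0 + energyConst Pe De * ∫ r in Ioo 0 T, truncErr f S r)
      * Real.exp (energyConst Pe De * 24 * t) := by
  obtain ⟨L, hL⟩ := W.exists_lipschitz_penEnergy hT S
  have hK := energyConst_nonneg Pe hDe
  refine le_mul_exp_of_le_add_integral (by positivity) hL.continuousOn (fun s hs => ?_) ht
  have hLs : LipschitzOnWith L (penEnergy f S) (uIcc 0 s) := by
    rw [uIcc_of_le hs.1]; exact hL.mono (Icc_subset_Icc_right hs.2)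
  have hac := hLs.absolutelyContinuousOnInterval
  have h1 := hac.integral_deriv_eq_sub
  have h0T : (0 : ℝ) ∈ Icc 0 T := ⟨le_rfl, hT.le⟩
  have hye : IntervalIntegrable (fun r => energyConst Pe De * 24 * penEnergy f S r) volume 0 s :=
    (hLs.continuousOn.intervalIntegrable).const_mul _
  have hee : IntervalIntegrable (fun r => energyConst Pe De * truncErr f S r) volume 0 s :=
    intervalIntegrable_of_integrableOn_Ioo hT ((W.integrableOn_truncErr S).const_mul _) h0T hs
  have h2 : ∫ r in (0 : ℝ)..s, deriv (penEnergy f S) r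
      ≤ ∫ r in (0 : ℝ)..s, (energyConst Pe De * 24 * penEnergy f S r
        + energyConst Pe De * truncErr f S r) := by
    refine intervalIntegral.integral_mono_ae_restrict hs.1 hac.intervalIntegrable_deriv
      (hye.add hee) ?_
    rw [← restrict_Ioo_eq_restrict_Icc]
    have h3 := (W.hasDerivAt_penEnergy hT S).and (W.ae_flux.and
      (ae_restrict_mem (μ := volume) measurableSet_Ioo))
    filter_upwards [ae_restrict_of_ae_restrict_of_subset (Ioo_subset_Ioo_right hs.2) h3]
      with r ⟨h4, ⟨_, h5, h6⟩, hr⟩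
    rw [h4.deriv]
    have h7 := energy_inequality (Pe := Pe) hDe S (W.contL2.memLp ⟨hr.1.le, hr.2.le⟩) h6 h5
    refine h7.trans (le_of_eq ?_)
    simp only [penEnergy]; ring
  rw [intervalIntegral.integral_add hye hee, intervalIntegral.integral_const_mul,
    intervalIntegral.integral_const_mul, h1] at h2
  have h8 : ∫ r in (0 : ℝ)..s, truncErr f S r ≤ ∫ r in Ioo 0 T, truncErr f S r := by
    rw [intervalIntegral.integral_of_le hs.1, integral_Ioc_eq_integral_Ioo]
    exact setIntegral_mono_set (W.integrableOn_truncErr S)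
      (Eventually.of_forall fun r => truncErr_nonneg f S r)
      (Ioo_subset_Ioo_right hs.2).eventuallyLE
  have h9 := mul_le_mul_of_nonneg_left h8 hK
  linarith

/-- Continuity on the closed interval identifies the value at time `0` with the limit from the
right. -/
lemma IsWeakSolution.ae_eq_initial (W : IsWeakSolution Pe De T f₀ f) (hT : 0 < T)
    (hf₀ : MemLp f₀ 2 (volume.restrict Υ)) : f 0 =ᵐ[volume.restrict Υ] f₀ := by
  have h0T : (0 : ℝ) ∈ Icc 0 T := ⟨le_rfl, hT.le⟩
  have h1 : Tendsto (fun s => eLpNorm (f s - f 0) 2 (volume.restrict Υ)) (𝓝[>] 0) (𝓝 0) := by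
    refine (W.contL2.continuous 0 h0T).mono_left ?_
    rw [← nhdsWithin_Ioo_eq_nhdsGT hT]
    exact nhdsWithin_mono _ Ioo_subset_Icc_self
  have h2 := h1.add W.initial
  rw [add_zero] at h2
  have h3 : eLpNorm (f 0 - f₀) 2 (volume.restrict Υ) ≤ 0 := by
    refine ge_of_tendsto h2 ?_
    filter_upwards [Ioo_mem_nhdsGT hT] with s hs
    have ms := (W.contL2.memLp ⟨hs.1.le, hs.2.le⟩).aestronglyMeasurable
    have m0 := (W.contL2.memLp h0T).aestronglyMeasurable
    have e : f 0 - f₀ = (f s - f₀) - (f s - f 0) := by abel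
    rw [e, add_comm]
    exact eLpNorm_sub_le (ms.sub hf₀.aestronglyMeasurable) (ms.sub m0) (by norm_num)
  have h4 := (eLpNorm_eq_zero_iff ((W.contL2.memLp h0T).aestronglyMeasurable.sub
    hf₀.aestronglyMeasurable) (by norm_num)).1 (le_antisymm h3 bot_le)
  filter_upwards [h4] with ξ h
  simpa [sub_eq_zero] using h

/-- A weak solution with non-negative initial data is non-negative: in the bound for the
penalization of the truncated solution, the initial value and the truncation errors vanish as the set
of frequencies grows. -/
lemma IsWeakSolution.ae_nonneg (W : IsWeakSolution Pe De T f₀ f) (hDe : 0 < De) (hT : 0 < T)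
    (hf₀ : IsAdmissible f₀) {t : ℝ} (ht : t ∈ Icc 0 T) :
    ∀ᵐ ξ ∂(volume.restrict Υ), 0 ≤ f t ξ := by
  have h0T : (0 : ℝ) ∈ Icc 0 T := ⟨le_rfl, hT.le⟩
  have hm := W.contL2.memLp ht
  have hm0 := W.contL2.memLp h0T
  have hdiff : ∀ {g : E → ℝ}, MemLp g 2 (volume.restrict Υ) → ∀ S,
      Integrable (fun ξ => (g ξ - hproj S g ξ) ^ 2) (volume.restrict Υ) := fun hg S =>
    integrable_sq (hg.sub (memLp_hproj S _))
  -- the truncation of non-negative data is negative only by its truncation error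
  have hinit : ∀ S, penEnergy f S 0 ≤ ∫ ξ in Υ, (f 0 ξ - hproj S (f 0) ξ) ^ 2 := fun S => by
    refine integral_mono_ae (integrable_negPen_hproj _ _) (hdiff hm0 S) ?_
    filter_upwards [W.ae_eq_initial hT hf₀.memLpPer.2, hf₀.nonneg] with ξ h1 h2
    refine (negPen_le _).trans ?_
    have h3 := npart_sub_le (hproj S (f 0) ξ) (f 0 ξ)
    have h4 : npart (f 0 ξ) = 0 := max_eq_right (by rw [h1]; linarith)
    rw [h4, zero_add, abs_sub_comm] at h3
    have := pow_le_pow_left₀ (npart_nonneg _) h3 2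
    rwa [sq_abs] at this
  have hint : Integrable (fun ξ => negPen (f t ξ)) (volume.restrict Υ) := by
    refine (integrable_sq hm).mono'
      (continuous_negPen.comp_aestronglyMeasurable hm.aestronglyMeasurable)
      (Eventually.of_forall fun ξ => ?_)
    rw [Real.norm_of_nonneg (negPen_nonneg _)]
    refine (negPen_le _).trans ?_
    have := pow_le_pow_left₀ (npart_nonneg _) (npart_le_abs (f t ξ)) 2
    rwa [sq_abs] at this
  have hle : ∀ S, ∫ ξ in Υ, negPen (f t ξ)
      ≤ 8 * (((∫ ξ in Υ, (f 0 ξ - hproj S (f 0) ξ) ^ 2)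
          + energyConst Pe De * ∫ r in Ioo 0 T, truncErr f S r)
          * Real.exp (energyConst Pe De * 24 * t))
        + 4 * ∫ ξ in Υ, (f t ξ - hproj S (f t) ξ) ^ 2 := fun S => by
    have h1 : ∫ ξ in Υ, negPen (f t ξ)
        ≤ ∫ ξ in Υ, (8 * negPen (hproj S (f t) ξ) + 4 * (f t ξ - hproj S (f t) ξ) ^ 2) :=
      integral_mono hint (((integrable_negPen_hproj _ _).const_mul 8).add
        ((hdiff hm S).const_mul 4)) fun ξ => negPen_le_add _ _
    rw [integral_add ((integrable_negPen_hproj _ _).const_mul 8) ((hdiff hm S).const_mul 4),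
      integral_const_mul, integral_const_mul] at h1
    have h2 := W.penEnergy_le hDe hT S ht
    have h3 := mul_le_mul_of_nonneg_right (add_le_add_left (hinit S)
      (energyConst Pe De * ∫ r in Ioo 0 T, truncErr f S r))
      (Real.exp_pos (energyConst Pe De * 24 * t)).le
    have h4 : ∫ ξ in Υ, negPen (hproj S (f t) ξ) = penEnergy f S t := rfl
    rw [h4] at h1
    linarith
  have hlim := ((((tendsto_integral_sub_hproj hm0).add
    (W.tendsto_integral_truncErr.const_mul (energyConst Pe De))).mul_const
      (Real.exp (energyConst Pe De * 24 * t))).const_mul 8).add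
    ((tendsto_integral_sub_hproj hm).const_mul 4)
  simp only [mul_zero, add_zero, zero_mul] at hlim
  have h0 : ∫ ξ in Υ, negPen (f t ξ) = 0 :=
    le_antisymm (ge_of_tendsto hlim (Eventually.of_forall hle))
      (integral_nonneg fun ξ => negPen_nonneg _)
  have h1 := (integral_eq_zero_iff_of_nonneg (fun ξ => negPen_nonneg _) hint).1 h0
  filter_upwards [h1] with ξ h using nonneg_of_negPen_eq_zero h

end Energy

/-! ### The mild formulation -/

/-- The parameters for which `heat` is the diffusion semigroup at time `τ`: `heat v` averages
against Gaussians of variance `v i`, and diffusion with coefficient `d` over time `τ` has variance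
`2 τ d`. -/
def heatTime (De τ : ℝ) (i : Fin 3) : ℝ := 2 * τ * diffusivity De i

lemma heat_heatTime (De τ : ℝ) (a : (Fin 3 → ℤ) → ℝ) (n : Fin 3 → ℤ) :
    heat (heatTime De τ) a n = Real.exp (-(τ * decay De n)) * a n := by
  rw [heat, decay]
  congr 2
  simp only [heatTime, Finset.mul_sum]
  rw [← Finset.sum_neg_distrib, ← Finset.sum_neg_distrib, Finset.sum_div]
  exact Finset.sum_congr rfl fun i _ => by ring

lemma two_smul_heatTime (De τ : ℝ) : (2 : ℝ) • heatTime De τ = heatTime De (2 * τ) := by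
  funext i; simp [heatTime]; ring

lemma min_le_diffusivity (De : ℝ) (i : Fin 3) : min De 1 ≤ diffusivity De i := by
  fin_cases i <;> simp [diffusivity]

lemma diffusivity_pos {De : ℝ} (hDe : 0 < De) (i : Fin 3) : 0 < diffusivity De i :=
  (lt_min hDe one_pos).trans_le (min_le_diffusivity De i)

lemma heatTime_pos {De τ : ℝ} (hDe : 0 < De) (hτ : 0 < τ) (i : Fin 3) : 0 < heatTime De τ i := by
  have := diffusivity_pos hDe i
  unfold heatTime; positivity

/-- The pairing of `f(t)` with the diffusion semigroup at time `τ` applied to a trigonometric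
polynomial. -/
def heatPair (De : ℝ) (f : ℝ → E → ℝ) (S : Finset (Fin 3 → ℤ)) (a : (Fin 3 → ℤ) → ℝ)
    (t τ : ℝ) : ℝ :=
  ∫ ξ in Υ, f t ξ * trig S (heat (heatTime De τ) a) ξ

/-- The constant in the gradient estimate for the source term: the factor `8` of
`abs_trigD_heat_le`, once for each of the three directions, times `|Pe|`. -/
def gradConst (Pe De : ℝ) : ℝ := 24 * |Pe| / √(min De 1)

lemma gradConst_nonneg (Pe De : ℝ) : 0 ≤ gradConst Pe De := by unfold gradConst; positivity

section Mild

variable {Pe De T : ℝ} {f₀ : E → ℝ} {f : ℝ → E → ℝ} {S : Finset (Fin 3 → ℤ)}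
  {a : (Fin 3 → ℤ) → ℝ}

lemma heatPair_eq_sum {t : ℝ} (hf : MemLp (f t) 2 (volume.restrict Υ)) (τ : ℝ) :
    heatPair De f S a t τ
      = ∑ n ∈ S, Real.exp (-(τ * decay De n)) * a n * hmoment f n t := by
  rw [heatPair, integral_mul_trig hf]
  exact Finset.sum_congr rfl fun n _ => by rw [heat_heatTime, hmoment]

lemma IsWeakSolution.continuousOn_heatPair (W : IsWeakSolution Pe De T f₀ f) (τ : ℝ) :
    ContinuousOn (fun t => heatPair De f S a t τ) (Icc 0 T) :=
  W.contL2.continuousOn_integral_mul (by fun_prop)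

/-- Duhamel's formula, tested against a trigonometric polynomial. -/
lemma IsWeakSolution.heatPair_duhamel (W : IsWeakSolution Pe De T f₀ f) (hT : 0 < T) {s t : ℝ}
    (hs : s ∈ Icc 0 T) (ht : t ∈ Icc 0 T) (ε : ℝ) :
    heatPair De f S a t ε = heatPair De f S a s (t - s + ε)
      + ∫ r in s..t, Pe * ∑ n ∈ S, heat (heatTime De (t - r + ε)) a n * drift f n r := by
  have hi : ∀ n ∈ S, IntervalIntegrable (fun r => Real.exp (-((t + ε) * decay De n)) * a n
      * (Real.exp (decay De n * r) * (Pe * drift f n r))) volume s t := fun n _ => by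
    refine IntervalIntegrable.const_mul ?_ _
    have hc : Continuous fun t => Real.exp (decay De n * t) := by fun_prop
    have hk := IsTimeTest.integrable_mul hc ((W.integrableOn_drift n).const_mul Pe)
    simp only [mul_comm _ (Real.exp _)] at hk
    exact intervalIntegrable_of_integrableOn_Ioo hT hk hs ht
  have e1 : ∀ r, Pe * ∑ n ∈ S, heat (heatTime De (t - r + ε)) a n * drift f n r
      = ∑ n ∈ S, Real.exp (-((t + ε) * decay De n)) * a n
        * (Real.exp (decay De n * r) * (Pe * drift f n r)) := fun r => by
    rw [Finset.mul_sum]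
    refine Finset.sum_congr rfl fun n _ => ?_
    have : Real.exp (-((t - r + ε) * decay De n))
        = Real.exp (-((t + ε) * decay De n)) * Real.exp (decay De n * r) := by
      rw [← Real.exp_add]; congr 1; ring
    rw [heat_heatTime, this]; ring
  simp only [e1]
  rw [intervalIntegral.integral_finsetSum hi, heatPair_eq_sum (W.contL2.memLp ht),
    heatPair_eq_sum (W.contL2.memLp hs), ← Finset.sum_add_distrib]
  refine Finset.sum_congr rfl fun n _ => ?_
  rw [intervalIntegral.integral_const_mul, ← W.hmoment_duhamel hT n hs ht]
  have e2 : Real.exp (-(ε * decay De n))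
      = Real.exp (-((t + ε) * decay De n)) * Real.exp (decay De n * t) := by
    rw [← Real.exp_add]; congr 1; ring
  have e3 : Real.exp (-((t - s + ε) * decay De n))
      = Real.exp (-((t + ε) * decay De n)) * Real.exp (decay De n * s) := by
    rw [← Real.exp_add]; congr 1; ring
  rw [e2, e3]; ring

lemma sum_heat_mul_drift {t : ℝ} (h : ∀ i, MemLp (flux f i t) 2 (volume.restrict Υ))
    (b : (Fin 3 → ℤ) → ℝ) :
    ∑ n ∈ S, b n * drift f n t = ∑ i, ∫ ξ in Υ, flux f i t ξ * trigD i S b ξ := by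
  have hi : ∀ i n, Integrable (fun ξ => flux f i t ξ * hart (-n) ξ) (volume.restrict Υ) :=
    fun i n => (h i).integrable_mul (memLp_of_continuous (continuous_hart _))
  have e : ∀ i, ∫ ξ in Υ, flux f i t ξ * trigD i S b ξ
      = ∑ n ∈ S, b n * (n i * ∫ ξ in Υ, flux f i t ξ * hart (-n) ξ) := fun i => by
    have e1 : ∀ ξ, flux f i t ξ * trigD i S b ξ
        = ∑ n ∈ S, (b n * n i) * (flux f i t ξ * hart (-n) ξ) := fun ξ => by
      rw [trigD, Finset.mul_sum]
      exact Finset.sum_congr rfl fun n _ => by ring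
    simp only [e1]
    rw [integral_finsetSum _ fun n _ => (hi i n).const_mul _]
    refine Finset.sum_congr rfl fun n _ => ?_
    rw [integral_const_mul]; ring
  simp only [e, drift, Finset.mul_sum]
  exact Finset.sum_comm

/-- The source term in Duhamel's formula is controlled by the solution smoothed over twice the
time. -/
lemma abs_sum_heat_mul_drift_le (hDe : 0 < De) {t τ : ℝ} (hτ : 0 < τ)
    (ha : ∀ ξ, 0 ≤ trig S a ξ) (hf : MemLp (f t) 2 (volume.restrict Υ))
    (h0 : ∀ᵐ ξ ∂(volume.restrict Υ), 0 ≤ f t ξ)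
    (hle : ∀ᵐ ξ ∂(volume.restrict Υ), ∀ i, |flux f i t ξ| ≤ |f t ξ|)
    (h : ∀ i, MemLp (flux f i t) 2 (volume.restrict Υ)) :
    |Pe * ∑ n ∈ S, heat (heatTime De τ) a n * drift f n t|
      ≤ gradConst Pe De / √τ * heatPair De f S a t (2 * τ) := by
  have hm : 0 < min De 1 := lt_min hDe one_pos
  have hd : ∀ i ξ, |trigD i S (heat (heatTime De τ) a) ξ|
      ≤ 8 / (√(min De 1) * √τ) * trig S (heat (heatTime De (2 * τ)) a) ξ := fun i ξ => by
    have h1 := abs_trigD_heat_le (fun i => heatTime_pos hDe hτ i) ha i ξ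
    rw [two_smul_heatTime] at h1
    refine h1.trans (mul_le_mul_of_nonneg_right ?_
      (trig_heat_nonneg (fun i => heatTime_pos hDe (by positivity) i) ha ξ))
    rw [← Real.sqrt_mul hm.le]
    refine div_le_div_of_nonneg_left (by norm_num) (by positivity) (Real.sqrt_le_sqrt ?_)
    have := min_le_diffusivity De i
    unfold heatTime
    nlinarith
  have hi : ∀ i, |∫ ξ in Υ, flux f i t ξ * trigD i S (heat (heatTime De τ) a) ξ|
      ≤ 8 / (√(min De 1) * √τ) * heatPair De f S a t (2 * τ) := fun i => by
    rw [heatPair, ← integral_const_mul, ← Real.norm_eq_abs]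
    refine norm_integral_le_of_norm_le ((hf.integrable_mul (memLp_of_continuous
      (continuous_trig S (heat (heatTime De (2 * τ)) a)))).const_mul _) ?_
    filter_upwards [h0, hle] with ξ h1 h2
    have h3 := h2 i
    rw [abs_of_nonneg h1] at h3
    rw [norm_mul]
    refine (mul_le_mul h3 (hd i ξ) (abs_nonneg _) h1).trans (le_of_eq ?_)
    ring
  rw [sum_heat_mul_drift h, abs_mul]
  have h4 : |∑ i, ∫ ξ in Υ, flux f i t ξ * trigD i S (heat (heatTime De τ) a) ξ|
      ≤ 3 * (8 / (√(min De 1) * √τ) * heatPair De f S a t (2 * τ)) := by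
    refine (Finset.abs_sum_le_sum_abs _ _).trans ((Finset.sum_le_sum fun i _ => hi i).trans ?_)
    simp
  refine (mul_le_mul_of_nonneg_left h4 (abs_nonneg Pe)).trans (le_of_eq ?_)
  rw [gradConst]
  field_simp
  ring

lemma integral_rpow_shift_le {s t ε : ℝ} (hst : s ≤ t) (hts : t ≤ s + 1) (hε : 0 < ε)
    (hε4 : ε ≤ 4) :
    IntervalIntegrable (fun r => (t - r + ε) ^ (-(3 / 4) : ℝ)) volume s t ∧
    ∫ r in s..t, (t - r + ε) ^ (-(3 / 4) : ℝ) ≤ 8 := by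
  have hpos : ∀ r ∈ uIcc s t, 0 < t - r + ε := fun r hr => by
    rw [uIcc_of_le hst] at hr; linarith [hr.2]
  have hc : ContinuousOn (fun r => (t - r + ε) ^ (-(3 / 4) : ℝ)) (uIcc s t) :=
    ContinuousOn.rpow_const (by fun_prop) fun r hr => Or.inl (hpos r hr).ne'
  refine ⟨hc.intervalIntegrable, ?_⟩
  have hd : ∀ r ∈ uIcc s t, HasDerivAt (fun r => -4 * (t - r + ε) ^ (1 / 4 : ℝ))
      ((t - r + ε) ^ (-(3 / 4) : ℝ)) r := fun r hr => by
    have h1 : HasDerivAt (fun r : ℝ => t - r + ε) (-1) r := by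
      simpa using ((hasDerivAt_id r).const_sub t).add_const ε
    have h2 := (h1.rpow_const (p := 1 / 4) (Or.inl (hpos r hr).ne')).const_mul (-4)
    convert! h2 using 1
    rw [show (1 / 4 - 1 : ℝ) = -(3 / 4) by norm_num]
    ring
  rw [intervalIntegral.integral_eq_sub_of_hasDerivAt hd hc.intervalIntegrable]
  have h3 : (t - s + ε) ^ (1 / 4 : ℝ) ≤ 2 := by
    calc (t - s + ε) ^ (1 / 4 : ℝ) ≤ (16 : ℝ) ^ (1 / 4 : ℝ) :=
          Real.rpow_le_rpow (by linarith) (by linarith) (by norm_num)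
      _ = 2 := by
          rw [show (16 : ℝ) = 2 ^ (4 : ℝ) by norm_num, ← Real.rpow_mul (by norm_num)]
          norm_num
  have h4 : 0 ≤ (t - t + ε) ^ (1 / 4 : ℝ) := by
    rw [sub_self, zero_add]; positivity
  linarith

/-- One step of the bootstrap: an integrable bound on the source in Duhamel's formula over a time
window of length at most one. -/
lemma IsWeakSolution.heatPair_le_add (W : IsWeakSolution Pe De T f₀ f) (hDe : 0 < De) (hT : 0 < T)
    (hf₀ : IsAdmissible f₀) (ha : ∀ ξ, 0 ≤ trig S a ξ) {s t ε B : ℝ} (hs : s ∈ Icc 0 T)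
    (ht : t ∈ Icc 0 T) (hst : s ≤ t) (hts : t ≤ s + 1) (hε : 0 < ε) (hε4 : ε ≤ 4) (hB : 0 ≤ B)
    (H : ∀ᵐ r ∂(volume.restrict (Ioo 0 T)), ∀ τ ∈ Icc ε (1 + ε),
      gradConst Pe De / √τ * heatPair De f S a r (2 * τ) ≤ B * τ ^ (-(3 / 4) : ℝ)) :
    heatPair De f S a t ε ≤ heatPair De f S a s (t - s + ε) + 8 * B := by
  rw [W.heatPair_duhamel hT hs ht]
  obtain ⟨hint, hle⟩ := integral_rpow_shift_le hst hts hε hε4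
  -- the estimates hold for almost every `r`, in `(0, T)` only; the endpoint `T` is a null set
  have h1 : ∀ᵐ r ∂(volume.restrict (Ioo 0 T)), r ∈ Ioc s t →
      ‖Pe * ∑ n ∈ S, heat (heatTime De (t - r + ε)) a n * drift f n r‖
        ≤ B * (t - r + ε) ^ (-(3 / 4) : ℝ) := by
    filter_upwards [H, W.ae_flux, ae_restrict_mem measurableSet_Ioo] with r h2 ⟨h3, _, h4⟩ hr hrst
    have hr' : r ∈ Icc 0 T := ⟨hr.1.le, hr.2.le⟩
    refine (abs_sum_heat_mul_drift_le hDe (by linarith [hrst.2]) ha (W.contL2.memLp hr')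
      (W.ae_nonneg hDe hT hf₀ hr') h3 h4).trans (h2 _ ⟨by linarith [hrst.2], ?_⟩)
    linarith [hrst.1]
  have h5 : ∀ᵐ r : ℝ, r ∈ Ioc s t →
      ‖Pe * ∑ n ∈ S, heat (heatTime De (t - r + ε)) a n * drift f n r‖
        ≤ B * (t - r + ε) ^ (-(3 / 4) : ℝ) := by
    rw [ae_restrict_iff' measurableSet_Ioo] at h1
    have hne : ∀ᵐ r : ℝ, r ≠ T := by simp [ae_iff, measure_singleton]
    filter_upwards [h1, hne] with r h6 h7 h8
    exact h6 ⟨hs.1.trans_lt h8.1, lt_of_le_of_ne (h8.2.trans ht.2) h7⟩ h8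
  have h9 := (le_abs_self _).trans
    (intervalIntegral.norm_integral_le_of_norm_le hst h5 (hint.const_mul B))
  have h11 : ∫ r in s..t, B * (t - r + ε) ^ (-(3 / 4) : ℝ)
      = B * ∫ r in s..t, (t - r + ε) ^ (-(3 / 4) : ℝ) := intervalIntegral.integral_const_mul _ _
  rw [h11] at h9
  have h10 := mul_le_mul_of_nonneg_left hle hB
  linarith

/-! ### The bound from the density constraint -/

lemma le_of_ae_le_of_continuousOn {u : ℝ → ℝ} {c : ℝ} (hT : 0 < T) (hu : ContinuousOn u (Icc 0 T))
    (h : ∀ᵐ t ∂(volume.restrict (Ioo 0 T)), u t ≤ c) {t : ℝ} (ht : t ∈ Icc 0 T) : u t ≤ c := by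
  have h1 : EqOn (fun t => max (u t) c) (fun _ => c) (Icc 0 T) := by
    refine Measure.eqOn_Icc_of_ae_eq volume hT.ne ?_ (hu.sup continuousOn_const) continuousOn_const
    rw [← restrict_Ioo_eq_restrict_Icc]
    filter_upwards [h] with t ht using max_eq_right ht
  exact (le_max_left _ _).trans (h1 ht).le

/-- Functions with density at most one pair with a function of `x` alone by at most its integral. -/
lemma integral_mul_comp_fst_le {g : E → ℝ} {q : ℝ × ℝ → ℝ} {B : ℝ}
    (hg : Integrable g (volume.restrict Υ))
    (hρ : ∀ᵐ x ∂(volume.restrict Ω), density g x ∈ Icc (0 : ℝ) 1)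
    (hq : AEStronglyMeasurable q (volume.restrict Ω)) (hq0 : ∀ x, 0 ≤ q x) (hqB : ∀ x, q x ≤ B) :
    Integrable (fun ξ => g ξ * q ξ.1) (volume.restrict Υ) ∧
    ∫ ξ in Υ, g ξ * q ξ.1 ≤ ∫ x in Ω, q x := by
  have hb : ∀ x, ‖q x‖ ≤ B := fun x => by rw [Real.norm_of_nonneg (hq0 x)]; exact hqB x
  have hqi : Integrable q (volume.restrict Ω) := Integrable.of_bound hq B (Eventually.of_forall hb)
  have hq' : AEStronglyMeasurable (fun ξ : E => q ξ.1) (volume.restrict Υ) := by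
    rw [restrict_Υ]; exact hq.comp_fst
  have hi : Integrable (fun ξ => g ξ * q ξ.1) (volume.restrict Υ) :=
    hg.mul_bdd (c := B) hq' (Eventually.of_forall fun ξ => hb ξ.1)
  refine ⟨hi, ?_⟩
  rw [restrict_Υ] at hi ⊢
  rw [integral_prod _ hi]
  refine integral_mono_ae hi.integral_prod_left hqi ?_
  filter_upwards [hρ] with x hx
  rw [integral_mul_const]
  exact mul_le_of_le_one_left (hq0 x) hx.2

/-- The bound on the smoothed solution that follows from the density constraint alone. The semigroup
in the spatial variables is an average; the semigroup in the angle replaces the test function by a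
function of `x` alone, against which `f` integrates like its density `ρ ≤ 1`. -/
lemma IsWeakSolution.heatPair_le_of_density (W : IsWeakSolution Pe De T f₀ f) (hDe : 0 < De)
    (hT : 0 < T) (hf₀ : IsAdmissible f₀) {C : ℝ} (hC0 : 0 ≤ C)
    (hC : IsAngleBound C) (ha : ∀ ξ, 0 ≤ trig S a ξ) {t τ : ℝ}
    (ht : t ∈ Icc 0 T) (hτ : 0 < τ) (hτ10 : τ ≤ 10) :
    heatPair De f S a t τ ≤ C / √τ * ∫ ξ in Υ, trig S a ξ := by
  refine le_of_ae_le_of_continuousOn hT (W.continuousOn_heatPair τ) ?_ ht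
  set v := heatTime De τ with hv
  have hv0 : ∀ i, 0 < v i := heatTime_pos hDe hτ
  have hv2 : v 2 = 2 * τ := by simp [hv, heatTime, diffusivity]
  set b := heat (Pi.single 0 (v 0)) (heat (Pi.single 1 (v 1)) a) with hb
  have hab : heat v a = heat (Pi.single 2 (v 2)) b :=
    heat_eq_single v (by decide) (by decide) (by decide)
  have hb0 : ∀ ξ, 0 ≤ trig S b ξ :=
    trig_heat_single_nonneg (hv0 0) 0 (trig_heat_single_nonneg (hv0 1) 1 ha)
  have hbm : ∫ ξ in Υ, trig S b ξ = ∫ ξ in Υ, trig S a ξ := by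
    rw [hb, integral_trig_heat, integral_trig_heat]
  set q : ℝ × ℝ → ℝ := fun x => C / √(v 2) * ∫ z in I₀, trig S b (x, z) with hq
  have hvs : 0 ≤ C / √(v 2) := by positivity
  have hbi := integrable_Υ_of_continuous (continuous_trig S b)
  have hqm : AEStronglyMeasurable q (volume.restrict Ω) := by
    rw [restrict_Υ] at hbi
    exact hbi.aestronglyMeasurable.integral_prod_right'.const_mul _
  have hqI : ∫ x in Ω, q x = C / √(v 2) * ∫ ξ in Υ, trig S a ξ := by
    rw [hq, integral_const_mul, ← hbm, integral_Υ_of_continuous (continuous_trig S b)]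
  have hq0 : ∀ x, 0 ≤ q x := fun x => mul_nonneg hvs (integral_nonneg fun z => hb0 _)
  have hqB : ∀ x, q x ≤ C / √(v 2) * ((∑ n ∈ S, |b n| * 2) * (volume.restrict I₀).real univ) :=
    fun x => mul_le_mul_of_nonneg_left ((Real.le_norm_self _).trans
      (norm_integral_le_of_norm_le_const (Eventually.of_forall fun z => abs_trig_le S b _))) hvs
  have hm0 : 0 ≤ ∫ ξ in Υ, trig S a ξ := integral_nonneg ha
  filter_upwards [W.ae_density, ae_restrict_mem measurableSet_Ioo] with r hr hrT
  have hr' : r ∈ Icc 0 T := ⟨hrT.1.le, hrT.2.le⟩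
  have hf := W.contL2.memLp hr'
  obtain ⟨i1, i2⟩ := integral_mul_comp_fst_le (hf.integrable (by norm_num)) hr hqm hq0 hqB
  have h1 : heatPair De f S a r τ ≤ ∫ ξ in Υ, f r ξ * q ξ.1 := by
    refine integral_mono_ae (hf.integrable_mul (memLp_of_continuous (continuous_trig _ _))) i1 ?_
    filter_upwards [W.ae_nonneg hDe hT hf₀ hr'] with ξ hξ
    rw [← hv, hab]
    exact mul_le_mul_of_nonneg_left (hC (v 2) (hv0 2) (by rw [hv2]; linarith) S b hb0 ξ.1 ξ.2) hξ
  refine (h1.trans i2).trans ?_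
  rw [hqI]
  refine mul_le_mul_of_nonneg_right (div_le_div_of_nonneg_left hC0 (by positivity)
    (Real.sqrt_le_sqrt ?_)) hm0
  rw [hv2]; linarith

end Mild

/-! ### The uniform bound -/

/-- The constant of the bootstrap after its first step. The factor `2` compensates `ε^(-1/4) ≥ 1/2`
for `ε ≤ 4`. -/
def smoothConst (Pe De C M₀ : ℝ) : ℝ := 2 * (C + M₀) + 8 * gradConst Pe De * C

/-- The constant in the uniform bound. The factor `8` here and in `smoothConst` is that of
`IsWeakSolution.heatPair_le_add`. -/
def supConst (Pe De C M₀ : ℝ) : ℝ :=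
  C + M₀ + 8 * gradConst Pe De * smoothConst Pe De C M₀

section Bound

variable {Pe De T C M₀ : ℝ} {f₀ : E → ℝ} {f : ℝ → E → ℝ} {S : Finset (Fin 3 → ℤ)}
  {a : (Fin 3 → ℤ) → ℝ}

lemma smoothConst_nonneg (Pe De : ℝ) (hC : 0 ≤ C) (hM : 0 ≤ M₀) : 0 ≤ smoothConst Pe De C M₀ := by
  have := gradConst_nonneg Pe De
  unfold smoothConst; positivity

lemma integral_mul_trig_le_of_ae_le {g : E → ℝ} (hg : MemLp g 2 (volume.restrict Υ))
    (hle : ∀ᵐ ξ ∂(volume.restrict Υ), g ξ ≤ M₀) (ha : ∀ ξ, 0 ≤ trig S a ξ) :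
    ∫ ξ in Υ, g ξ * trig S a ξ ≤ M₀ * ∫ ξ in Υ, trig S a ξ := by
  rw [← integral_const_mul]
  refine integral_mono_ae (hg.integrable_mul (memLp_of_continuous (continuous_trig S a)))
    ((integrable_Υ_of_continuous (continuous_trig S a)).const_mul _) ?_
  filter_upwards [hle] with ξ h using mul_le_mul_of_nonneg_right h (ha ξ)

/-- The data from which Duhamel's formula is started: at the time `t - 1` if it is non-negative,
where the density constraint has had time to act, and at time `0` otherwise. -/
lemma IsWeakSolution.exists_start (W : IsWeakSolution Pe De T f₀ f) (hDe : 0 < De) (hT : 0 < T)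
    (hf₀ : IsAdmissible f₀) (hC0 : 0 ≤ C) (hC : IsAngleBound C) (hM0 : 0 ≤ M₀)
    (hM : ∀ᵐ ξ ∂(volume.restrict Υ), f₀ ξ ≤ M₀) (ha : ∀ ξ, 0 ≤ trig S a ξ) {t ε : ℝ}
    (ht : t ∈ Icc 0 T) (hε : 0 < ε) (hε4 : ε ≤ 4) :
    ∃ s ∈ Icc 0 T, s ≤ t ∧ t ≤ s + 1 ∧
      heatPair De f S a s (t - s + ε) ≤ (C + M₀) * ∫ ξ in Υ, trig S a ξ := by
  have hm0 : 0 ≤ ∫ ξ in Υ, trig S a ξ := integral_nonneg ha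
  rcases le_total 1 t with h1 | h1
  · have hs : t - 1 ∈ Icc 0 T := ⟨by linarith, by linarith [ht.2]⟩
    refine ⟨t - 1, hs, by linarith, by linarith, ?_⟩
    refine (W.heatPair_le_of_density hDe hT hf₀ hC0 hC ha hs (by linarith) (by linarith)).trans
      (mul_le_mul_of_nonneg_right ?_ hm0)
    refine (div_le_self hC0 ?_).trans (by linarith)
    rw [Real.one_le_sqrt]; linarith
  · refine ⟨0, ⟨le_rfl, hT.le⟩, ht.1, by linarith, ?_⟩
    have hτ : 0 < t - 0 + ε := by linarith [ht.1]
    have h2 : ∀ᵐ ξ ∂(volume.restrict Υ), f 0 ξ ≤ M₀ := by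
      filter_upwards [hM, W.ae_eq_initial hT hf₀.memLpPer.2] with ξ h3 h4
      rwa [h4]
    have h5 := integral_mul_trig_le_of_ae_le (W.contL2.memLp ⟨le_rfl, hT.le⟩) h2
      (trig_heat_nonneg (heatTime_pos hDe hτ) ha)
    rw [integral_trig_heat] at h5
    exact h5.trans (mul_le_mul_of_nonneg_right (by linarith) hm0)

/-- The first step of the bootstrap: the rate improves from `ε^(-1/2)` to `ε^(-1/4)`. The source is
of order `τ⁻¹`, of which `τ^(-1/4) ≤ ε^(-1/4)` is split off to leave the integrable `τ^(-3/4)`. -/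
lemma IsWeakSolution.heatPair_le_rpow (W : IsWeakSolution Pe De T f₀ f) (hDe : 0 < De) (hT : 0 < T)
    (hf₀ : IsAdmissible f₀) (hC0 : 0 ≤ C) (hC : IsAngleBound C) (hM0 : 0 ≤ M₀)
    (hM : ∀ᵐ ξ ∂(volume.restrict Υ), f₀ ξ ≤ M₀) (ha : ∀ ξ, 0 ≤ trig S a ξ) {t ε : ℝ}
    (ht : t ∈ Icc 0 T) (hε : 0 < ε) (hε4 : ε ≤ 4) :
    heatPair De f S a t ε
      ≤ smoothConst Pe De C M₀ * ε ^ (-(1 / 4) : ℝ) * ∫ ξ in Υ, trig S a ξ := by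
  have hm0 : 0 ≤ ∫ ξ in Υ, trig S a ξ := integral_nonneg ha
  have hG := gradConst_nonneg Pe De
  obtain ⟨s, hs, hst, hts, h1⟩ := W.exists_start hDe hT hf₀ hC0 hC hM0 hM ha ht hε hε4
  set m := ∫ ξ in Υ, trig S a ξ
  set e := ε ^ (-(1 / 4) : ℝ) with he
  have he0 : 0 < e := Real.rpow_pos_of_pos hε _
  have h2 := W.heatPair_le_add (B := gradConst Pe De * C * e * m) hDe hT hf₀ ha hs ht hst hts hε hε4
    (by positivity) ?_
  · have he2 : 1 ≤ 2 * e := by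
      have h3 : (4 : ℝ) ^ (-(1 / 4) : ℝ) ≤ e :=
        Real.rpow_le_rpow_of_nonpos hε hε4 (by norm_num)
      have h4 : (2 : ℝ)⁻¹ ≤ (4 : ℝ) ^ (-(1 / 4) : ℝ) := by
        rw [show (4 : ℝ) = 2 ^ (2 : ℝ) by norm_num, ← Real.rpow_mul (by norm_num),
          ← Real.rpow_neg_one]
        exact Real.rpow_le_rpow_of_exponent_le (by norm_num) (by norm_num)
      linarith
    have h5 : (C + M₀) * m ≤ 2 * e * ((C + M₀) * m) := le_mul_of_one_le_left (by positivity) he2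
    rw [smoothConst]
    nlinarith
  · filter_upwards [ae_restrict_mem measurableSet_Ioo] with r hr τ hτ
    have hτ0 : 0 < τ := hε.trans_le hτ.1
    have h6 := W.heatPair_le_of_density hDe hT hf₀ hC0 hC ha (t := r) (τ := 2 * τ)
      ⟨hr.1.le, hr.2.le⟩ (by linarith) (by linarith [hτ.2])
    have h7 : C / √(2 * τ) ≤ C / √τ :=
      div_le_div_of_nonneg_left hC0 (by positivity) (Real.sqrt_le_sqrt (by linarith))
    have h8 : gradConst Pe De / √τ * heatPair De f S a r (2 * τ)
        ≤ gradConst Pe De / √τ * (C / √τ * m) :=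
      mul_le_mul_of_nonneg_left (h6.trans (mul_le_mul_of_nonneg_right h7 hm0)) (by positivity)
    refine h8.trans ?_
    have h9 : gradConst Pe De / √τ * (C / √τ * m) = gradConst Pe De * C * m * τ⁻¹ := by
      have := Real.sq_sqrt hτ0.le
      field_simp
      rw [this]; ring
    have h10 : τ⁻¹ = τ ^ (-(1 / 4) : ℝ) * τ ^ (-(3 / 4) : ℝ) := by
      rw [← Real.rpow_add hτ0, ← Real.rpow_neg_one]; norm_num
    have h11 : τ ^ (-(1 / 4) : ℝ) ≤ e := Real.rpow_le_rpow_of_nonpos hε hτ.1 (by norm_num)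
    rw [h9, h10]
    have h12 := mul_le_mul_of_nonneg_right h11
      (by positivity : 0 ≤ gradConst Pe De * C * m * τ ^ (-(3 / 4) : ℝ))
    linarith

/-- The second step of the bootstrap: the source is now of order `τ^(-3/4)`, and the bound no longer
depends on `ε`. -/
lemma IsWeakSolution.heatPair_le (W : IsWeakSolution Pe De T f₀ f) (hDe : 0 < De) (hT : 0 < T)
    (hf₀ : IsAdmissible f₀) (hC0 : 0 ≤ C) (hC : IsAngleBound C) (hM0 : 0 ≤ M₀)
    (hM : ∀ᵐ ξ ∂(volume.restrict Υ), f₀ ξ ≤ M₀) (ha : ∀ ξ, 0 ≤ trig S a ξ) {t ε : ℝ}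
    (ht : t ∈ Icc 0 T) (hε : 0 < ε) (hε1 : ε ≤ 1) :
    heatPair De f S a t ε ≤ supConst Pe De C M₀ * ∫ ξ in Υ, trig S a ξ := by
  have hm0 : 0 ≤ ∫ ξ in Υ, trig S a ξ := integral_nonneg ha
  have hG := gradConst_nonneg Pe De
  have hK := smoothConst_nonneg Pe De hC0 hM0
  obtain ⟨s, hs, hst, hts, h1⟩ :=
    W.exists_start hDe hT hf₀ hC0 hC hM0 hM ha ht hε (by linarith)
  have h2 := W.heatPair_le_add
    (B := gradConst Pe De * smoothConst Pe De C M₀ * ∫ ξ in Υ, trig S a ξ)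
    hDe hT hf₀ ha hs ht hst hts hε (by linarith) (by positivity) ?_
  · rw [supConst]; linarith
  · filter_upwards [ae_restrict_mem measurableSet_Ioo] with r hr τ hτ
    have hτ0 : 0 < τ := hε.trans_le hτ.1
    have h6 := W.heatPair_le_rpow hDe hT hf₀ hC0 hC hM0 hM ha (t := r) (ε := 2 * τ)
      ⟨hr.1.le, hr.2.le⟩ (by linarith) (by linarith [hτ.2])
    have h7 : (2 * τ) ^ (-(1 / 4) : ℝ) ≤ τ ^ (-(1 / 4) : ℝ) :=
      Real.rpow_le_rpow_of_nonpos hτ0 (by linarith) (by norm_num)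
    have h8 := mul_le_mul_of_nonneg_left (h6.trans (mul_le_mul_of_nonneg_right
      (mul_le_mul_of_nonneg_left h7 hK) hm0)) (by positivity : 0 ≤ gradConst Pe De / √τ)
    refine h8.trans (le_of_eq ?_)
    have h9 : (√τ)⁻¹ * τ ^ (-(1 / 4) : ℝ) = τ ^ (-(3 / 4) : ℝ) := by
      rw [Real.sqrt_eq_rpow, ← Real.rpow_neg hτ0.le, ← Real.rpow_add hτ0]; norm_num
    rw [← h9]; ring

lemma IsWeakSolution.integral_mul_trig_le (W : IsWeakSolution Pe De T f₀ f) (hDe : 0 < De)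
    (hT : 0 < T) (hf₀ : IsAdmissible f₀) (hC0 : 0 ≤ C) (hC : IsAngleBound C) (hM0 : 0 ≤ M₀)
    (hM : ∀ᵐ ξ ∂(volume.restrict Υ), f₀ ξ ≤ M₀) (ha : ∀ ξ, 0 ≤ trig S a ξ) {t : ℝ}
    (ht : t ∈ Icc 0 T) :
    ∫ ξ in Υ, f t ξ * trig S a ξ ≤ supConst Pe De C M₀ * ∫ ξ in Υ, trig S a ξ := by
  have hc : Continuous fun ε => heatPair De f S a t ε := by
    simp only [heatPair_eq_sum (W.contL2.memLp ht)]
    fun_prop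
  have h0 : heatPair De f S a t 0 = ∫ ξ in Υ, f t ξ * trig S a ξ := by
    have : heat (heatTime De 0) a = a := funext fun n => by simp [heat_heatTime]
    rw [heatPair, this]
  rw [← h0]
  refine le_of_tendsto ((hc.tendsto 0).mono_left (nhdsWithin_le_nhds (s := Ioi 0))) ?_
  filter_upwards [Ioc_mem_nhdsGT (one_pos : (0 : ℝ) < 1)] with ε hε
    using W.heatPair_le hDe hT hf₀ hC0 hC hM0 hM ha ht hε.1 hε.2

/-- A weak solution is bounded at every time. -/
lemma IsWeakSolution.ae_abs_le (W : IsWeakSolution Pe De T f₀ f) (hDe : 0 < De)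
    (hT : 0 < T) (hf₀ : IsAdmissible f₀) (hC0 : 0 ≤ C) (hC : IsAngleBound C) (hM0 : 0 ≤ M₀)
    (hM : ∀ᵐ ξ ∂(volume.restrict Υ), f₀ ξ ≤ M₀) {t : ℝ} (ht : t ∈ Icc 0 T) :
    ∀ᵐ ξ ∂(volume.restrict Υ), ‖f t ξ‖ ≤ supConst Pe De C M₀ := by
  have hf := W.contL2.memLp ht
  have h1 := ae_nonpos_of_integral_mul_trig_nonpos
    (g := fun ξ => f t ξ - supConst Pe De C M₀)
    ((hf.integrable (by norm_num)).sub (integrable_const _)) fun S a ha => by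
      have h2 : Integrable (fun ξ => f t ξ * trig S a ξ) (volume.restrict Υ) :=
        hf.integrable_mul (memLp_of_continuous (continuous_trig S a))
      simp only [sub_mul]
      rw [integral_sub h2
        ((integrable_Υ_of_continuous (continuous_trig S a)).const_mul _), integral_const_mul]
      exact sub_nonpos.2 (W.integral_mul_trig_le hDe hT hf₀ hC0 hC hM0 hM ha ht)
  filter_upwards [h1, W.ae_nonneg hDe hT hf₀ ht] with ξ h2 h3
  rw [Real.norm_of_nonneg h3]
  linarith

/-- A bound at every time is a bound almost everywhere in space-time, by Fubini's theorem for a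
jointly measurable representative. -/
lemma ae_prod_norm_le {M : ℝ}
    (hm : AEStronglyMeasurable (Function.uncurry f) (volume.restrict (Ioo (0 : ℝ) T ×ˢ Υ)))
    (h : ∀ t ∈ Ioo 0 T, ∀ᵐ ξ ∂(volume.restrict Υ), ‖f t ξ‖ ≤ M) :
    ∀ᵐ p ∂(volume.restrict (Ioo (0 : ℝ) T ×ˢ Υ)), ‖Function.uncurry f p‖ ≤ M := by
  rw [prod_restrict_time] at hm ⊢
  have hs : MeasurableSet {p | ‖hm.mk (Function.uncurry f) p‖ ≤ M} :=
    measurableSet_le hm.stronglyMeasurable_mk.norm.measurable measurable_const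
  have h1 : ∀ᵐ p ∂((volume.restrict (Ioo (0 : ℝ) T)).prod (volume.restrict Υ)),
      ‖hm.mk (Function.uncurry f) p‖ ≤ M := by
    rw [Measure.ae_prod_iff_ae_ae hs]
    filter_upwards [Measure.ae_ae_of_ae_prod hm.ae_eq_mk, ae_restrict_mem measurableSet_Ioo]
      with t h2 ht
    filter_upwards [h2, h t ht] with ξ h3 h4
    rw [← h3]; exact h4
  filter_upwards [h1, hm.ae_eq_mk] with p h5 h6
  rwa [h6]

lemma IsGlobalWeakSolution.ae_norm_le (W : IsGlobalWeakSolution Pe De f₀ f) (hDe : 0 < De)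
    (hf₀ : IsAdmissible f₀) (hC0 : 0 ≤ C) (hC : IsAngleBound C) (hM0 : 0 ≤ M₀)
    (hM : ∀ᵐ ξ ∂(volume.restrict Υ), f₀ ξ ≤ M₀) :
    ∀ᵐ p ∂(volume.restrict (Ioi (0 : ℝ) ×ˢ Υ)), ‖Function.uncurry f p‖ ≤ supConst Pe De C M₀ := by
  have hu : Ioi (0 : ℝ) ×ˢ Υ = ⋃ k : ℕ, Ioo (0 : ℝ) (k + 1) ×ˢ Υ := by
    rw [← iUnion_prod_const]
    congr 1
    ext t
    simp only [mem_Ioi, mem_iUnion, mem_Ioo]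
    refine ⟨fun h => ?_, fun ⟨k, h⟩ => h.1⟩
    obtain ⟨k, hk⟩ := exists_nat_gt t
    exact ⟨k, h, by linarith⟩
  rw [hu, ae_restrict_iUnion_iff]
  intro k
  have hT : (0 : ℝ) < k + 1 := by positivity
  exact ae_prod_norm_le (W _ hT).contL2.aestronglyMeasurable fun t ht =>
    (W _ hT).ae_abs_le hDe hT hf₀ hC0 hC hM0 hM ⟨ht.1.le, ht.2.le⟩

end Bound

end

end ActiveMatter

theorem theorem1p5 :
    ∃ C : ℝ → ℝ → ℝ → ℝ, ∀ (Pe De : ℝ), 0 < De →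
      ∀ f₀ : ActiveMatter.E → ℝ, ActiveMatter.IsAdmissible f₀ →
        MemLp f₀ ∞ (volume.restrict ActiveMatter.Υ) →
      ∀ f : ℝ → ActiveMatter.E → ℝ, ActiveMatter.IsGlobalWeakSolution Pe De f₀ f →
        eLpNorm (Function.uncurry f) ∞ (volume.restrict (Ioi (0 : ℝ) ×ˢ ActiveMatter.Υ))
          ≤ ENNReal.ofReal
              (C Pe De (eLpNorm f₀ ∞ (volume.restrict ActiveMatter.Υ)).toReal) := by
  obtain ⟨C, hC0, hC⟩ := ActiveMatter.exists_isAngleBound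
  refine ⟨fun Pe De M₀ => ActiveMatter.supConst Pe De C M₀, fun Pe De hDe f₀ hf₀ hi f W => ?_⟩
  have hM : ∀ᵐ ξ ∂(volume.restrict ActiveMatter.Υ),
      f₀ ξ ≤ (eLpNorm f₀ ∞ (volume.restrict ActiveMatter.Υ)).toReal := by
    have h1 := hi.2.ne
    rw [eLpNorm_exponent_top] at h1 ⊢
    filter_upwards [ae_le_eLpNormEssSup (f := f₀) (μ := volume.restrict ActiveMatter.Υ)] with ξ h2
    have h3 := ENNReal.toReal_mono h1 h2
    rw [toReal_enorm] at h3
    exact (Real.le_norm_self _).trans h3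
  rw [eLpNorm_exponent_top]
  exact eLpNormEssSup_le_of_ae_bound (W.ae_norm_le hDe hf₀ hC0 hC ENNReal.toReal_nonneg hM)
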